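/- **Setting.** Let $\mathcal T\subset\mathbb R$ and $\mathcal X\subset\mathbb R^k$ be Borel sets, $T$ a $\mathcal T$-valued treatment, $X$ an $\mathcal X$-valued covariate vector, $Y(t)$, $t\in\mathcal T$, jointly measurable real potential outcomes, $Y=Y(T)$, and let $Z_i=(Y_i,T_i,X_i)$ be i.i.d. copies of $Z=(Y,T,X)$. Let $dt$ denote a fixed $\sigma$-finite measure on $\mathcal T$, let $f(t|x)$ be the conditional density of $T$ given $X=x$ with respect to $dt$, and let $\Pi_\theta(dt|x)=\pi_\theta(t|x)\,dt$, $\theta\in\Theta\subset\mathbb R^d$, be a class of policies with jointly measurable probability densities $\pi_\theta(\cdot|x)$. Put $$m(t,x)=\mathbb E[Y|T=t,X=x],\quad \sigma^2(t,x)=\mathrm{Var}(Y|T=t,X=x),\quad \mu_\theta(x)=\int m(t,x)\pi_\theta(t|x)\,dt,$$ $$W(\theta)=\mathbb E\Big[\int Y(t)\,\Pi_\theta(dt|X)\Big],\qquad R(\theta)=W(\theta^*)-W(\theta).$$ **Assumptions.** 1. $Y(t)\perp T\mid X$ for every $t\in\mathcal T$. Moreover there are Borel maps $\tau_n:\mathcal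 T\to\mathcal T$ with countable range such that almost surely $Y(\tau_n(t))\to Y(t)$ for all $t\in\mathcal T$ (this is automatic if $\mathcal T$ is countable, and holds if $t\mapsto Y(t)$ has continuous paths). 2. $\Theta$ is convex and compact; $W$ is concave on $\Theta$ and twice differentiable on a neighbourhood of $\theta^*\in\mathrm{int}(\Theta)$; $\theta^*$ is the unique maximizer of $W$ on $\Theta$, $\nabla W(\theta^*)=0$, and $H:=-\nabla^2W(\theta^*)$ is positive definite. 3. There is an open neighbourhood $N\subset\Theta$ of $\theta^*$ such that for almost every $(t,x)$ the map $\theta\mapsto\pi_\theta(t|x)$ is differentiable on $N$; $\mathbb E\big[\|\partial_\theta\pi_\theta(T|X)\|^2\sigma^2(T,X)/f(T|X)^2\big]$ and $\mathbb E\big[\|\int\partial_\theta\pi_\theta(t|X)m(t,X)\,dt\|^2\big]$ are bounded uniformly in $\theta\in N$; and for almost every $x$ and all $\theta\in N$, $\partial_\theta\mu_\theta(x)=\int m(t,x)\,\partial_\theta\pi_\theta(t|x)\,dt$, the integral being absolutely convergent. Also $\sup_{\theta\in\Theta}\sup_{t,x}\pi_\theta(t|x)<\infty$. 4. For almost every $(t,x)$,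 $\theta\mapsto\pi_\theta(t|x)$ is continuous on $\Theta$, and it is twice differentiable on a neighbourhood of $\theta^*$ (not depending on $(t,x)$) where its second derivative is bounded in norm by a measurable $B(t,x)$ with $\mathbb E\big[(Y/f(T|X))^2B(T,X)^2\big]<\infty$. 5. There are $M<\infty$ and $\underline f>0$ such that almost surely $|Y(t)|\le M$ for all $t$, and $f(t|x)\ge\underline f$ for all $(t,x)$. **Theorem.** Let $\hat\theta^{tp}_n$ be measurable maximizers over $\Theta$ of the inverse-propensity-weighted empirical welfare with the true propensity, $\widehat W^{tp}(\theta)=\frac1n\sum_{i=1}^n\pi_\theta(T_i|X_i)Y_i/f(T_i|X_i)$. With derivatives at $\theta^*$, put $$\dot\varphi(Z)=\int\partial_\theta\pi_{\theta^*}(t|X)\,m(t,X)\,dt+\frac{\partial_\theta\pi_{\theta^*}(T|X)}{f(T|X)}\,(Y-m(T,X)),\qquad v=\frac{m(T,X)}{f(T|X)}\partial_\theta\pi_{\theta^*}(T|X)-\partial_\theta\mu_{\theta^*}(X).$$ These are square integrable. Let $V_{\mathrm{eff}}=H^{-1}\mathrm{Var}(\dot\varphi(Z))H^{-1}$ and $\Sigma_U^{tp}=H^{-1}\,\mathbb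 E[vv']\,H^{-1}$. Then, for independent $G\sim N(0,V_{\mathrm{eff}})$ and $U^{tp}\sim N(0,\Sigma_U^{tp})$, $$\sqrt n\,(\hat\theta^{tp}_n-\theta^*)\Rightarrow G+U^{tp},\qquad nR(\hat\theta^{tp}_n)\Rightarrow\tfrac12(G+U^{tp})'H(G+U^{tp}).$$ The limiting regret has mean $\frac12\mathrm{tr}\big(H^{1/2}(V_{\mathrm{eff}}+\Sigma_U^{tp})H^{1/2}\big)$ and variance $\frac12\sum_{j=1}^d(\tilde\lambda_j^{tp})^2$, where $\tilde\lambda_1^{tp},\dots,\tilde\lambda_d^{tp}$ are the eigenvalues of $H^{1/2}(V_{\mathrm{eff}}+\Sigma_U^{tp})H^{1/2}$. Unless $\frac{m(T,X)}{f(T|X)}\partial_\theta\pi_{\theta^*}(T|X)$ is almost surely a function of $X$ alone, both this mean and this variance are strictly larger than those of the efficient limiting regret $\frac12G'HG$. -/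

import Mathlib

open MeasureTheory ProbabilityTheory Filter
open scoped Topology ENNReal

noncomputable section

/-- The data of a policy learning problem with treatment space `𝓣 ⊆ ℝ`, covariate space
`𝓧 ⊆ ℝᵏ` and policy parameter in `ℝᵈ`, together with the measurability and normalisation
properties that make the objects what they are called. -/
structure PolicyModel (Ω : Type*) [MeasurableSpace Ω] {k : ℕ}
    (𝓣 : Set ℝ) (𝓧 : Set (EuclideanSpace ℝ (Fin k))) (d : ℕ) where
  /-- the population law -/
  P : Measure Ω
  isProbabilityMeasure : IsProbabilityMeasure P
  /-- potential outcomes `Y t` -/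
  Y : 𝓣 → Ω → ℝ
  measurable_Y : Measurable (fun p : 𝓣 × Ω => Y p.1 p.2)
  /-- observed treatment -/
  T : Ω → 𝓣
  measurable_T : Measurable T
  /-- covariates -/
  X : Ω → 𝓧
  measurable_X : Measurable X
  /-- the dominating measure `dt` on the treatment space -/
  ν : Measure 𝓣
  sigmaFinite : SigmaFinite ν
  /-- the propensity: `f t x` is the conditional density at `t` of `T` given `X = x` -/
  f : 𝓣 → 𝓧 → ℝ
  measurable_f : Measurable (fun p : 𝓣 × 𝓧 => f p.1 p.2)
  f_nonneg : ∀ t x, 0 ≤ f t x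
  isCondDensity_f : P.map (fun ω => (X ω, T ω)) =
    ((P.map X).prod ν).withDensity (fun p => ENNReal.ofReal (f p.2 p.1))
  /-- the set of policy parameters -/
  Θ : Set (EuclideanSpace ℝ (Fin d))
  /-- policy densities: `pol θ t x` is the density at `t` of the policy `θ` at covariates `x`;
  only the values at `θ ∈ Θ` matter -/
  pol : EuclideanSpace ℝ (Fin d) → 𝓣 → 𝓧 → ℝ
  measurable_pol : Measurable (fun p : Θ × 𝓣 × 𝓧 => pol p.1 p.2.1 p.2.2)
  pol_nonneg : ∀ θ ∈ Θ, ∀ t x, 0 ≤ pol θ t x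
  lintegral_pol : ∀ θ ∈ Θ, ∀ x, ∫⁻ t, ENNReal.ofReal (pol θ t x) ∂ν = 1

namespace PolicyModel

variable {Ω : Type*} [MeasurableSpace Ω] {k d : ℕ} {𝓣 : Set ℝ}
  {𝓧 : Set (EuclideanSpace ℝ (Fin k))}

instance (M : PolicyModel Ω 𝓣 𝓧 d) : IsProbabilityMeasure M.P := M.isProbabilityMeasure

instance (M : PolicyModel Ω 𝓣 𝓧 d) : SigmaFinite M.ν := M.sigmaFinite

variable (M : PolicyModel Ω 𝓣 𝓧 d)

/-- The observed outcome `Y = Y(T)`. -/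
def Yobs (ω : Ω) : ℝ := M.Y (M.T ω) ω

/-- The law of the observed vector `Z = (Y, T, X)`. -/
def obsLaw : Measure (ℝ × 𝓣 × 𝓧) := M.P.map (fun ω => (M.Yobs ω, M.T ω, M.X ω))

/-- The policy `Π_θ(dt | x) = π_θ(t | x) dt`. -/
def policyMeasure (θ : EuclideanSpace ℝ (Fin d)) (x : 𝓧) : Measure 𝓣 :=
  M.ν.withDensity (fun t => ENNReal.ofReal (M.pol θ t x))

/-- The welfare `W(θ) = E[∫ Y(t) Π_θ(dt | X)]`. -/
def welfare (θ : EuclideanSpace ℝ (Fin d)) : ℝ :=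
  ∫ ω, ∫ t, M.Y t ω ∂(M.policyMeasure θ (M.X ω)) ∂M.P

/-- `m(t, x) = E[Y | T = t, X = x]`, through the regular conditional law of `Y`. -/
def condMean (t : 𝓣) (x : 𝓧) : ℝ :=
  ∫ y, y ∂(condDistrib M.Yobs (fun ω => (M.T ω, M.X ω)) M.P (t, x))

/-- `σ²(t, x) = Var(Y | T = t, X = x)`. -/
def condVar (t : 𝓣) (x : 𝓧) : ℝ :=
  Var[id; condDistrib M.Yobs (fun ω => (M.T ω, M.X ω)) M.P (t, x)]

/-- The conditional value `μ_θ(x) = ∫ m(t, x) Π_θ(dt | x)` of a policy. -/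
def condValue (θ : EuclideanSpace ℝ (Fin d)) (x : 𝓧) : ℝ :=
  ∫ t, M.condMean t x ∂(M.policyMeasure θ x)

/-- The gradient `∂_θ π_θ(t | x)`. -/
def gradPol (θ : EuclideanSpace ℝ (Fin d)) (t : 𝓣) (x : 𝓧) : EuclideanSpace ℝ (Fin d) :=
  gradient (fun θ' => M.pol θ' t x) θ

/-- The gradient `∂_θ μ_θ(x)`. -/
def gradCondValue (θ : EuclideanSpace ℝ (Fin d)) (x : 𝓧) : EuclideanSpace ℝ (Fin d) :=
  gradient (fun θ' => M.condValue θ' x) θ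

/-- The negative Hessian matrix `H = -∇² W(θ)`. -/
def negHessian (θ : EuclideanSpace ℝ (Fin d)) : Matrix (Fin d) (Fin d) ℝ :=
  Matrix.of fun i j => -(fderiv ℝ (gradient M.welfare) θ (EuclideanSpace.single j 1) i)

/-- Unconfoundedness: `Y(t) ⊥ T | X` for every treatment level `t`. -/
def Unconfounded [StandardBorelSpace Ω] : Prop :=
  ∀ t : 𝓣, CondIndepFun (MeasurableSpace.comap M.X inferInstance) M.measurable_X.comap_le
    (M.Y t) M.T M.P

/-- Regularity of the sample paths `t ↦ Y(t)`: almost surely, `Y(t)` is for all `t` the limit of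
the values at the points `τ n t`, for some fixed measurable maps `τ n` of countable range.
It holds trivially (with `τ n = id`) for countable `𝓣`, and for continuous paths. Without a
condition of this kind, unconfoundedness at each single `t` says nothing about `Y(T)` when `T` is
continuously distributed. -/
def RegularPaths : Prop :=
  ∃ τ : ℕ → 𝓣 → 𝓣, (∀ n, Measurable (τ n) ∧ (Set.range (τ n)).Countable) ∧
    ∀ᵐ ω ∂M.P, ∀ t, Tendsto (fun n => M.Y (τ n t) ω) atTop (𝓝 (M.Y t ω))

/-- Concavity of the welfare on a convex compact parameter set, with a unique, interior,
nondegenerate maximizer `θs`. -/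
structure ConcaveUnique (θs : EuclideanSpace ℝ (Fin d)) : Prop where
  convex : Convex ℝ M.Θ
  isCompact : IsCompact M.Θ
  concaveOn : ConcaveOn ℝ M.Θ M.welfare
  mem_interior : θs ∈ interior M.Θ
  twice_differentiable : ∀ᶠ θ in 𝓝 θs,
    DifferentiableAt ℝ M.welfare θ ∧ DifferentiableAt ℝ (gradient M.welfare) θ
  unique_max : ∀ θ ∈ M.Θ, θ ≠ θs → M.welfare θ < M.welfare θs
  gradient_eq_zero : gradient M.welfare θs = 0
  posDef : (M.negHessian θs).PosDef

/-- Smoothness of the policy class on a neighbourhood of `θs`, and bounded policy densities. -/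
structure PolicySmooth (θs : EuclideanSpace ℝ (Fin d)) : Prop where
  exists_nhd : ∃ N : Set (EuclideanSpace ℝ (Fin d)), IsOpen N ∧ θs ∈ N ∧ N ⊆ M.Θ ∧
    (∀ᵐ p ∂((M.P.map M.X).prod M.ν), ∀ θ ∈ N,
      DifferentiableAt ℝ (fun θ' => M.pol θ' p.2 p.1) θ) ∧
    (∃ K : ℝ, ∀ θ ∈ N, ∫⁻ ω, ENNReal.ofReal
      (‖M.gradPol θ (M.T ω) (M.X ω)‖ ^ 2 / M.f (M.T ω) (M.X ω) ^ 2
        * M.condVar (M.T ω) (M.X ω)) ∂M.P ≤ ENNReal.ofReal K) ∧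
    (∃ K : ℝ, ∀ θ ∈ N, ∫⁻ ω, ENNReal.ofReal
      (‖∫ t, M.condMean t (M.X ω) • M.gradPol θ t (M.X ω) ∂M.ν‖ ^ 2) ∂M.P
        ≤ ENNReal.ofReal K) ∧
    (∀ᵐ x ∂(M.P.map M.X), ∀ θ ∈ N,
      Integrable (fun t => M.condMean t x • M.gradPol θ t x) M.ν ∧
      HasGradientAt (fun θ' => M.condValue θ' x)
        (∫ t, M.condMean t x • M.gradPol θ t x ∂M.ν) θ)
  bounded : ∃ C : ℝ, ∀ θ ∈ M.Θ, ∀ t x, M.pol θ t x ≤ C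

/-- Continuity of the policy densities in `θ ∈ Θ`, and second derivatives in `θ` near `θs` with
an envelope `B` such that `E[(Y / f(T | X))² B(T, X)²] < ∞`. -/
structure ScoreRegular (θs : EuclideanSpace ℝ (Fin d)) : Prop where
  continuousOn : ∀ᵐ p ∂((M.P.map M.X).prod M.ν), ContinuousOn (fun θ => M.pol θ p.2 p.1) M.Θ
  exists_envelope : ∃ N ∈ 𝓝 θs, ∃ B : 𝓣 → 𝓧 → ℝ, Measurable (fun p : 𝓣 × 𝓧 => B p.1 p.2) ∧
    (∀ᵐ p ∂((M.P.map M.X).prod M.ν), ∀ θ ∈ N,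
      DifferentiableAt ℝ (fun θ' => M.gradPol θ' p.2 p.1) θ ∧
      ‖fderiv ℝ (fun θ' => M.gradPol θ' p.2 p.1) θ‖ ≤ B p.2 p.1) ∧
    MemLp (fun ω => M.Yobs ω / M.f (M.T ω) (M.X ω) * B (M.T ω) (M.X ω)) 2 M.P

/-- Bounded potential outcomes and a propensity bounded away from zero. -/
structure BoundedOutcomeOverlap : Prop where
  bounded_outcome : ∃ B : ℝ, ∀ᵐ ω ∂M.P, ∀ t, |M.Y t ω| ≤ B
  propensity_lower : ∃ fmin : ℝ, 0 < fmin ∧ ∀ t x, fmin ≤ M.f t x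

/-- The inverse-propensity-weighted empirical welfare of the first `n` observations
`z i = (Yᵢ, Tᵢ, Xᵢ)`, with the true propensity. -/
def ipwWelfare (z : ℕ → ℝ × 𝓣 × 𝓧) (n : ℕ) (θ : EuclideanSpace ℝ (Fin d)) : ℝ :=
  (1 / (n : ℝ)) * ∑ i ∈ Finset.range n,
    M.pol θ (z i).2.1 (z i).2.2 * (z i).1 / M.f (z i).2.1 (z i).2.2

/-- `φ̇(Z) = ∫ ∂_θ π_θ(t | X) m(t, X) dt + (∂_θ π_θ(T | X) / f(T | X)) (Y - m(T, X))`. -/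
def effScore (θ : EuclideanSpace ℝ (Fin d)) (ω : Ω) : EuclideanSpace ℝ (Fin d) :=
  (∫ t, M.condMean t (M.X ω) • M.gradPol θ t (M.X ω) ∂M.ν) +
    ((M.Yobs ω - M.condMean (M.T ω) (M.X ω)) / M.f (M.T ω) (M.X ω)) •
      M.gradPol θ (M.T ω) (M.X ω)

/-- `(m(T, X) / f(T | X)) ∂_θ π_θ(T | X)`. -/
def weightedScore (θ : EuclideanSpace ℝ (Fin d)) (ω : Ω) : EuclideanSpace ℝ (Fin d) :=
  (M.condMean (M.T ω) (M.X ω) / M.f (M.T ω) (M.X ω)) • M.gradPol θ (M.T ω) (M.X ω)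

/-- `(m(T, X) / f(T | X)) ∂_θ π_θ(T | X) - ∂_θ μ_θ(X)`. -/
def excessScore (θ : EuclideanSpace ℝ (Fin d)) (ω : Ω) : EuclideanSpace ℝ (Fin d) :=
  M.weightedScore θ ω - M.gradCondValue θ (M.X ω)

/-- The semiparametric efficiency bound `H⁻¹ Var(φ̇(Z)) H⁻¹`. -/
def Veff (θ : EuclideanSpace ℝ (Fin d)) : Matrix (Fin d) (Fin d) ℝ :=
  (M.negHessian θ)⁻¹ *
    (Matrix.of fun i j => cov[fun ω => M.effScore θ ω i, fun ω => M.effScore θ ω j; M.P]) *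
    (M.negHessian θ)⁻¹

/-- The excess covariance `H⁻¹ E[v v'] H⁻¹` for
`v = (m(T, X) / f(T | X)) ∂_θ π_θ(T | X) - ∂_θ μ_θ(X)`. -/
def SigmaU (θ : EuclideanSpace ℝ (Fin d)) : Matrix (Fin d) (Fin d) ℝ :=
  (M.negHessian θ)⁻¹ *
    (Matrix.of fun i j => ∫ ω, M.excessScore θ ω i * M.excessScore θ ω j ∂M.P) *
    (M.negHessian θ)⁻¹

/-- The regret `R(θ) = W(θs) - W(θ)`. -/
def regret (θs θ : EuclideanSpace ℝ (Fin d)) : ℝ := M.welfare θs - M.welfare θ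

end PolicyModel

/-- The quadratic form `½ z' H z`. -/
def halfQuad {d : ℕ} (H : Matrix (Fin d) (Fin d) ℝ) (z : EuclideanSpace ℝ (Fin d)) : ℝ :=
  (1 / 2) * (z.ofLp ⬝ᵥ H.mulVec z.ofLp)

open scoped MatrixOrder in
/-- The matrix `H^{1/2} V H^{1/2}`, with the positive semidefinite square root. -/
def sqrtConj {d : ℕ} (H V : Matrix (Fin d) (Fin d) ℝ) : Matrix (Fin d) (Fin d) ℝ :=
  CFC.sqrt H * V * CFC.sqrt H

end

/-!
The inverse-propensity-weighted welfare is the sample mean of the criterion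
`ψ θ (Y, T, X) = π_θ(T | X) Y / f(T | X)`, and unconfoundedness makes `W θ` its population mean
(`PolicyModel.welfare_eq_integral_ipw`). Independence of `Y t` and `T` given `X` for each single
`t` first gives the identity for the outcome along a treatment rule `τ n` of countable range, and
then, by regularity of the paths and dominated convergence, for `Y T` itself.

The estimator is thus an M-estimator with a criterion that is bounded, continuous on `Θ`, and twice
differentiable near `θs` with a square integrable bound on the second derivative
(`SmoothCriterion`). Consistency is Wald's argument over the compact `Θ`
(`SmoothCriterion.ae_tendsto_argmax`). The second derivatives need not be continuous, but the
Taylor remainder divided by `‖u‖²` is continuous in `u` and dominated, so the empirical criterion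
has a quadratic expansion whose error is `o(‖u‖²)` uniformly in large `n`
(`SmoothCriterion.exists_taylor_majorant`, `SmoothCriterion.ae_sampleMean_expansion`). Comparing the
maximizer with the Newton step `H⁻¹ S n`, where `S n` is the mean score, gives
`θhat n - θs = H⁻¹ S n + o(‖S n‖)` (`argmax_sub_newton_le`). The central limit theorem
for the score and Slutsky's lemma yield the limit law, and the quadratic expansion of `W` at `θs`
yields that of the regret.

The score `s = (Y / f) ∂π` has `E[s | T, X] = a`, the weighted score `(m / f) ∂π`, and
`E[a | X] = b`, the gradient of the conditional value. Hence `s = (b + (s - a)) + (a - b)` is an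
orthogonal decomposition into the efficient and the excess score, and the limiting covariance is
`Veff + SigmaU` (`PolicyModel.integral_ipwScore_mul_ipwScore`).

Diagonalising `H^{1/2} V H^{1/2}` turns the law of the limiting regret into that of half a weighted
sum of independent squared standard normals, which gives its mean and variance. Both increase
strictly when a nonzero positive semidefinite matrix is added to `V` (`halfQuad_moments_lt`), and
`SigmaU = 0` forces the weighted score to be a function of `X`.
-/

open scoped RealInnerProductSpace

set_option linter.unusedSectionVars false

/-! ### Second-order Taylor expansions -/

theorem norm_smul_le_of_mem_Icc {E : Type*} [SeminormedAddCommGroup E] [NormedSpace ℝ E] {t : ℝ}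
    (ht : t ∈ Set.Icc (0 : ℝ) 1)
    (u : E) : ‖t • u‖ ≤ ‖u‖ := by
  rw [norm_smul, Real.norm_of_nonneg ht.1]
  exact mul_le_of_le_one_left (norm_nonneg _) ht.2

section Taylor

variable {E : Type*} [NormedAddCommGroup E] [InnerProductSpace ℝ E] [CompleteSpace E]

/-- The mean value inequality for `t ↦ f (x + t u) - t c - t² e / 2` on `[0, 1]`. -/
theorem abs_sub_quadratic_le_of_abs_gradient_le {f : E → ℝ} {x u : E} {c e δ : ℝ}
    (hf : ∀ t ∈ Set.Icc (0 : ℝ) 1, DifferentiableAt ℝ f (x + t • u))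
    (hδ : ∀ t ∈ Set.Icc (0 : ℝ) 1, |⟪gradient f (x + t • u), u⟫ - c - t * e| ≤ δ) :
    |f (x + u) - f x - c - 1 / 2 * e| ≤ δ := by
  have hder : ∀ t ∈ Set.Icc (0 : ℝ) 1,
      HasDerivWithinAt (fun t : ℝ => f (x + t • u) - t * c - t ^ 2 / 2 * e)
        (⟪gradient f (x + t • u), u⟫ - c - t * e) (Set.Icc 0 1) t := by
    intro t ht
    have h1 : HasDerivAt (fun t : ℝ => x + t • u) u t := by
      simpa using ((hasDerivAt_id t).smul_const u).const_add x
    have h2 : HasDerivAt (fun t : ℝ => f (x + t • u)) ⟪gradient f (x + t • u), u⟫ t := by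
      have := (hf t ht).hasGradientAt.hasFDerivAt.comp_hasDerivAt t h1
      rw [InnerProductSpace.toDual_apply_apply] at this
      exact this
    have h3 : HasDerivAt (fun t : ℝ => t ^ 2 / 2 * e) (t * e) t := by
      have := ((hasDerivAt_pow 2 t).div_const 2).mul_const e
      refine this.congr_deriv ?_
      norm_num
    have h4 : HasDerivAt (fun t : ℝ => t * c) c t := by
      simpa using (hasDerivAt_id t).mul_const c
    exact ((h2.sub h4).sub h3).hasDerivWithinAt
  have := norm_image_sub_le_of_norm_deriv_le_segment_01' hder
    (fun t ht => by simpa using hδ t ⟨ht.1, ht.2.le⟩)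
  simp only [one_smul, zero_smul, add_zero, Real.norm_eq_abs] at this
  convert this using 2
  ring

/-- Peano form of the second-order Taylor expansion: the gradient has to be differentiable at the
one point `x` only. -/
theorem taylor_two_isLittleO {f : E → ℝ} {x : E} (hf : ∀ᶠ y in 𝓝 x, DifferentiableAt ℝ f y)
    (hg : DifferentiableAt ℝ (gradient f) x) {ε : ℝ} (hε : 0 < ε) :
    ∃ δ > 0, ∀ u : E, ‖u‖ < δ →
      |f (x + u) - f x - ⟪gradient f x, u⟫ - 1 / 2 * ⟪fderiv ℝ (gradient f) x u, u⟫|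
        ≤ ε * ‖u‖ ^ 2 := by
  obtain ⟨δ₁, hδ₁, h₁⟩ := Metric.eventually_nhds_iff.1 hf
  have hg' := hg.hasFDerivAt.isLittleO
  obtain ⟨δ₂, hδ₂, h₂⟩ := Metric.eventually_nhds_iff.1 (hg'.def hε)
  refine ⟨min δ₁ δ₂, lt_min hδ₁ hδ₂, fun u hu => ?_⟩
  have hu1 := hu.trans_le (min_le_left _ _)
  have hu2 := hu.trans_le (min_le_right _ _)
  apply abs_sub_quadratic_le_of_abs_gradient_le
  · intro t ht
    refine h₁ ?_
    simpa using (norm_smul_le_of_mem_Icc ht u).trans_lt hu1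
  · intro t ht
    have := h₂ (y := x + t • u) (by simpa using (norm_smul_le_of_mem_Icc ht u).trans_lt hu2)
    simp only [add_sub_cancel_left, map_smul] at this
    have heq : ⟪gradient f (x + t • u), u⟫ - ⟪gradient f x, u⟫ -
        t * ⟪fderiv ℝ (gradient f) x u, u⟫ =
        ⟪gradient f (x + t • u) - gradient f x - t • fderiv ℝ (gradient f) x u, u⟫ := by
      simp [inner_sub_left, real_inner_smul_left]
    rw [heq]
    calc _ ≤ _ := abs_real_inner_le_norm _ _
      _ ≤ (ε * ‖u‖) * ‖u‖ := by
        gcongr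
        exact this.trans (by gcongr; exact norm_smul_le_of_mem_Icc ht u)
      _ = _ := by ring

theorem norm_gradient_sub_le {f : E → ℝ} {x u : E} {r B : ℝ}
    (hg : ∀ y ∈ Metric.ball x r, DifferentiableAt ℝ (gradient f) y)
    (hB : ∀ y ∈ Metric.ball x r, ‖fderiv ℝ (gradient f) y‖ ≤ B) (hu : ‖u‖ < r) :
    ‖gradient f (x + u) - gradient f x‖ ≤ B * ‖u‖ := by
  have hr : 0 < r := (norm_nonneg _).trans_lt hu
  simpa using (convex_ball x r).norm_image_sub_le_of_norm_fderiv_le (𝕜 := ℝ) hg hB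
    (Metric.mem_ball_self hr) (by simpa using hu : x + u ∈ Metric.ball x r)

theorem abs_sub_taylor_one_le {f : E → ℝ} {x u : E} {r B : ℝ}
    (hf : ∀ y ∈ Metric.ball x r, DifferentiableAt ℝ f y)
    (hg : ∀ y ∈ Metric.ball x r, DifferentiableAt ℝ (gradient f) y)
    (hB : ∀ y ∈ Metric.ball x r, ‖fderiv ℝ (gradient f) y‖ ≤ B) (hu : ‖u‖ < r) :
    |f (x + u) - f x - ⟪gradient f x, u⟫| ≤ B * ‖u‖ ^ 2 := by
  have hr : 0 < r := (norm_nonneg _).trans_lt hu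
  have hB0 : 0 ≤ B := (norm_nonneg _).trans (hB x (Metric.mem_ball_self hr))
  have := abs_sub_quadratic_le_of_abs_gradient_le (f := f) (x := x) (u := u)
    (c := ⟪gradient f x, u⟫) (e := 0) (δ := B * ‖u‖ ^ 2) ?_ ?_
  · simpa using this
  · intro t ht
    exact hf _ (by simpa using (norm_smul_le_of_mem_Icc ht u).trans_lt hu)
  · intro t ht
    have hn := norm_smul_le_of_mem_Icc ht u
    rw [mul_zero, sub_zero, ← inner_sub_left]
    calc _ ≤ _ := abs_real_inner_le_norm _ _
      _ ≤ (B * ‖u‖) * ‖u‖ := by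
        gcongr
        exact (norm_gradient_sub_le hg hB (hn.trans_lt hu)).trans (by gcongr)
      _ = _ := by ring

/-- Interpolation: a bounded function with bounded second derivative has a bounded gradient. -/
theorem norm_gradient_le_of_bounded {f : E → ℝ} {x : E} {r B C : ℝ} (hr : 0 < r)
    (hf : ∀ y ∈ Metric.ball x r, DifferentiableAt ℝ f y)
    (hg : ∀ y ∈ Metric.ball x r, DifferentiableAt ℝ (gradient f) y)
    (hB : ∀ y ∈ Metric.ball x r, ‖fderiv ℝ (gradient f) y‖ ≤ B)
    (hC : ∀ y ∈ Metric.ball x r, |f y| ≤ C) :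
    ‖gradient f x‖ ≤ 4 * C / r + B * r := by
  have hB0 : 0 ≤ B := (norm_nonneg _).trans (hB x (Metric.mem_ball_self hr))
  have hC0 : 0 ≤ C := (abs_nonneg _).trans (hC x (Metric.mem_ball_self hr))
  rcases eq_or_ne (gradient f x) 0 with h0 | h0
  · rw [h0, norm_zero]; positivity
  set g := gradient f x with hgdef
  have hgpos : 0 < ‖g‖ := norm_pos_iff.2 h0
  -- move by `r / 2` in the direction of the gradient
  set u : E := (r / 2 / ‖g‖) • g with hu
  have hun : ‖u‖ = r / 2 := by
    rw [hu, norm_smul, Real.norm_of_nonneg (by positivity)]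
    field_simp
  have hur : ‖u‖ < r := by rw [hun]; linarith
  have h1 := abs_sub_taylor_one_le hf hg hB hur
  have h2 : ⟪g, u⟫ = r / 2 * ‖g‖ := by
    rw [hu, real_inner_smul_right, real_inner_self_eq_norm_sq]
    field_simp
  rw [← hgdef, h2, hun] at h1
  have h3 := hC (x + u) (by simpa using hur)
  have h4 := hC x (Metric.mem_ball_self hr)
  have h5 : r / 2 * ‖g‖ ≤ 2 * C + B * (r / 2) ^ 2 := by
    have := abs_le.1 h1; have := abs_le.1 h3; have := abs_le.1 h4
    linarith
  have h6 : ‖g‖ ≤ 4 * C / r + B * (r / 2) := by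
    have : ‖g‖ = (r / 2 * ‖g‖) * (2 / r) := by field_simp
    rw [this]
    calc _ ≤ (2 * C + B * (r / 2) ^ 2) * (2 / r) := by gcongr
      _ = _ := by field_simp; ring
  have : B * (r / 2) ≤ B * r := by gcongr; linarith
  linarith

end Taylor

/-! ### Integrable moduli of continuity and laws of large numbers -/

section Majorant

variable {𝒵 E : Type*} [MeasurableSpace 𝒵] [PseudoMetricSpace E] [SecondCountableTopology E]

/-- A dominated family of random functions that is almost surely continuous at the index `u₀`
oscillates near `u₀` by at most a random variable of small mean. The majorant is a supremum over a
countable dense set of indices, which keeps it measurable. -/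
theorem exists_integrable_oscillation_le {μ : Measure 𝒵} {S : Set E} {u₀ : E}
    (hu₀ : u₀ ∈ S) {g : E → 𝒵 → ℝ} {b : 𝒵 → ℝ} (hmeas : ∀ u ∈ S, AEMeasurable (g u) μ)
    (hcont : ∀ᵐ z ∂μ, ContinuousOn (fun u => g u z) S) (hb : Integrable b μ)
    (hgb : ∀ᵐ z ∂μ, ∀ u ∈ S, |g u z| ≤ b z) {ε : ℝ} (hε : 0 < ε) :
    ∃ δ > 0, ∃ k : 𝒵 → ℝ, Integrable k μ ∧ ∫ z, k z ∂μ < ε ∧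
      ∀ᵐ z ∂μ, ∀ u ∈ S, dist u u₀ < δ → |g u z - g u₀ z| ≤ k z := by
  have : Nonempty S := ⟨⟨u₀, hu₀⟩⟩
  let s : ℕ → S := TopologicalSpace.denseSeq S
  let δ : ℕ → ℝ := fun n => 1 / ((n : ℝ) + 1)
  have hδ : ∀ n, 0 < δ n := fun n => Nat.one_div_pos_of_nat
  let F : ℕ → ℕ → 𝒵 → ℝ := fun n i z =>
    if dist (s i : E) u₀ < δ n then |g (s i) z - g u₀ z| else 0
  let k : ℕ → 𝒵 → ℝ := fun n z => ⨆ i, F n i z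
  have hF0 : ∀ n i z, 0 ≤ F n i z := fun n i z => by
    dsimp only [F]; split_ifs <;> positivity
  have hFm : ∀ n i, AEMeasurable (F n i) μ := fun n i => by
    dsimp only [F]
    split_ifs
    · exact ((hmeas _ (s i).2).sub (hmeas _ hu₀)).abs
    · exact aemeasurable_const
  have hkm : ∀ n, AEMeasurable (k n) μ := fun n => AEMeasurable.iSup (hFm n)
  have hFb : ∀ᵐ z ∂μ, ∀ n i, F n i z ≤ 2 * b z := by
    filter_upwards [hgb] with z hz n i
    have h1 := hz _ (s i).2
    have h2 := hz _ hu₀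
    dsimp only [F]
    split_ifs
    · have := abs_sub (g (s i) z) (g u₀ z); linarith
    · have := abs_nonneg (g u₀ z); linarith
  have hk0 : ∀ n z, 0 ≤ k n z := fun n z => Real.iSup_nonneg (hF0 n · z)
  have hkb : ∀ᵐ z ∂μ, ∀ n, k n z ≤ 2 * b z := by
    filter_upwards [hFb] with z hz n using ciSup_le (hz n)
  have hlim : Tendsto (fun n => ∫ z, k n z ∂μ) atTop (𝓝 (∫ _, (0 : ℝ) ∂μ)) := by
    refine tendsto_integral_of_dominated_convergence (fun z => 2 * b z)
      (fun n => (hkm n).aestronglyMeasurable) (hb.const_mul 2) ?_ ?_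
    · intro n
      filter_upwards [hkb] with z hz
      rw [Real.norm_of_nonneg (hk0 n z)]
      exact hz n
    · filter_upwards [hcont] with z hz
      rw [Metric.tendsto_atTop]
      intro η hη
      obtain ⟨r, hr, hzr⟩ := Metric.continuousWithinAt_iff.1 (hz u₀ hu₀) (η / 2) (half_pos hη)
      obtain ⟨N, hN⟩ := exists_nat_one_div_lt hr
      refine ⟨N, fun n hn => ?_⟩
      rw [Real.dist_0_eq_abs, abs_of_nonneg (hk0 n z)]
      refine (ciSup_le fun i => ?_).trans_lt (half_lt_self hη)
      dsimp only [F]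
      split_ifs with hi
      · have h1 : δ n ≤ δ N := Nat.one_div_le_one_div hn
        exact (hzr (s i).2 (hi.trans (h1.trans_lt hN))).le
      · positivity
  rw [integral_zero] at hlim
  obtain ⟨n, hn⟩ := (hlim.eventually_lt_const hε).exists
  refine ⟨δ n, hδ n, k n, ?_, hn, ?_⟩
  · refine (hb.const_mul 2).mono' (hkm n).aestronglyMeasurable ?_
    filter_upwards [hkb] with z hz
    rw [Real.norm_of_nonneg (hk0 n z)]
    exact hz n
  · filter_upwards [hcont, hFb] with z hz hFz u hu hdist
    by_contra! hlt
    have hcz : Continuous fun v : S => |g v z - g u₀ z| :=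
      ((continuousOn_iff_continuous_domRestrict.1 hz).sub continuous_const).abs
    have hopen : IsOpen {v : S | dist (v : E) u₀ < δ n ∧ k n z < |g v z - g u₀ z|} :=
      (isOpen_lt (continuous_subtype_val.dist continuous_const) continuous_const).inter
        (isOpen_lt continuous_const hcz)
    obtain ⟨v, hv, i, rfl⟩ :=
      (TopologicalSpace.denseRange_denseSeq S).inter_open_nonempty _ hopen ⟨⟨u, hu⟩, hdist, hlt⟩
    have h1 : F n i z ≤ k n z := le_ciSup (f := fun i => F n i z)
      ⟨2 * b z, by rintro _ ⟨j, rfl⟩; exact hFz n j⟩ i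
    have h2 : F n i z = |g (s i) z - g u₀ z| := if_pos hv.1
    exact absurd hv.2 (not_lt.2 (h2 ▸ h1))

end Majorant

noncomputable section

/-- The average of `h` over the first `n` observations. -/
def sampleMean {𝒵 F : Type*} [AddCommGroup F] [Module ℝ F] (z : ℕ → 𝒵)
    (n : ℕ) (h : 𝒵 → F) : F :=
  (n : ℝ)⁻¹ • ∑ i ∈ Finset.range n, h (z i)

end

theorem sampleMean_le_sampleMean {𝒵 : Type*} {z : ℕ → 𝒵} {g h : 𝒵 → ℝ} (hgh : ∀ i, g (z i) ≤ h (z i))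
    (n : ℕ) : sampleMean z n g ≤ sampleMean z n h := by
  simp only [sampleMean, smul_eq_mul]
  exact mul_le_mul_of_nonneg_left (Finset.sum_le_sum fun i _ => hgh i) (by positivity)

theorem abs_sampleMean_le {𝒵 : Type*} {z : ℕ → 𝒵} {g h : 𝒵 → ℝ} (hgh : ∀ i, |g (z i)| ≤ h (z i))
    (n : ℕ) : |sampleMean z n g| ≤ sampleMean z n h := by
  simp only [sampleMean, smul_eq_mul, abs_mul, abs_inv, Nat.abs_cast]
  exact mul_le_mul_of_nonneg_left
    ((Finset.abs_sum_le_sum_abs _ _).trans (Finset.sum_le_sum fun i _ => hgh i)) (by positivity)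

section IID

variable {𝒵 Ω' : Type*} [MeasurableSpace 𝒵] [MeasurableSpace Ω'] {μ : Measure 𝒵}
  {P' : Measure Ω'} {Z : ℕ → Ω' → 𝒵}

theorem identDistrib_comp_of_hasLaw (hZ : ∀ i, HasLaw (Z i) μ P') {F : Type*} [MeasurableSpace F]
    {h : 𝒵 → F} (hh : AEMeasurable h μ) (i : ℕ) :
    IdentDistrib (fun ω => h (Z i ω)) (fun ω => h (Z 0 ω)) P' P' :=
  ((hZ i).identDistrib (hZ 0)).comp_of_aemeasurable (u := h) (by rwa [(hZ i).map_eq])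

theorem iIndepFun_comp_of_hasLaw (hZ : ∀ i, HasLaw (Z i) μ P') (hind : iIndepFun Z P')
    {F : Type*} [MeasurableSpace F] {h : 𝒵 → F} (hh : AEMeasurable h μ) :
    iIndepFun (fun i ω => h (Z i ω)) P' :=
  hind.comp₀ (fun _ => h) (fun i => (hZ i).aemeasurable) (fun i => by rwa [(hZ i).map_eq])

theorem ae_tendsto_sampleMean (hZ : ∀ i, HasLaw (Z i) μ P') (hind : iIndepFun Z P')
    {F : Type*} [NormedAddCommGroup F] [NormedSpace ℝ F] [CompleteSpace F] [MeasurableSpace F]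
    [BorelSpace F] {h : 𝒵 → F} (hh : Integrable h μ) :
    ∀ᵐ ω ∂P', Tendsto (fun n => sampleMean (fun i => Z i ω) n h) atTop (𝓝 (∫ z, h z ∂μ)) := by
  have hm : AEMeasurable h μ := hh.1.aemeasurable
  have h0 : ∫ ω, h (Z 0 ω) ∂P' = ∫ z, h z ∂μ := (hZ 0).integral_comp hh.1
  have hint : Integrable (fun ω => h (Z 0 ω)) P' := by
    refine Integrable.comp_aemeasurable (f := Z 0) ?_ (hZ 0).aemeasurable
    rwa [(hZ 0).map_eq]
  have := strong_law_ae (μ := P') (fun i ω => h (Z i ω)) hint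
    (fun i j hij => (iIndepFun_comp_of_hasLaw hZ hind hm).indepFun hij)
    (identDistrib_comp_of_hasLaw hZ hm)
  rw [h0] at this
  exact this

theorem ae_forall_sample (hZ : ∀ i, HasLaw (Z i) μ P') {p : 𝒵 → Prop} (hp : ∀ᵐ z ∂μ, p z) :
    ∀ᵐ ω ∂P', ∀ i, p (Z i ω) := by
  rw [ae_all_iff]
  intro i
  refine ae_of_ae_map (hZ i).aemeasurable ?_
  rwa [(hZ i).map_eq]

end IID

/-! ### Smooth criterion functions -/

section DerivMeasurable

variable {𝒵 E F : Type*} [MeasurableSpace 𝒵] {μ : Measure 𝒵}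
  [NormedAddCommGroup E] [NormedSpace ℝ E]
  [NormedAddCommGroup F] [NormedSpace ℝ F] [MeasurableSpace F] [BorelSpace F]
  [SecondCountableTopology F]

theorem aemeasurable_fderiv_apply {f : E → 𝒵 → F} {x : E} (v : E)
    (hm : ∀ᶠ y in 𝓝 x, AEMeasurable (f y) μ)
    (hd : ∀ᵐ z ∂μ, DifferentiableAt ℝ (fun y => f y z) x) :
    AEMeasurable (fun z => fderiv ℝ (fun y => f y z) x v) μ := by
  let t : ℕ → ℝ := fun n => 1 / ((n : ℝ) + 1)
  have ht : Tendsto t atTop (𝓝 0) := tendsto_one_div_add_atTop_nhds_zero_nat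
  have htne : Tendsto t atTop (𝓝[≠] 0) :=
    tendsto_nhdsWithin_iff.2 ⟨ht, Eventually.of_forall fun n => Nat.one_div_pos_of_nat.ne'⟩
  have hx : Tendsto (fun n => x + t n • v) atTop (𝓝 x) := by
    simpa using (ht.smul_const v).const_add x
  obtain ⟨N, hN⟩ := eventually_atTop.1 (hx.eventually hm)
  refine aemeasurable_of_tendsto_metrizable_ae atTop
    (f := fun n z => (t (n + N))⁻¹ • (f (x + t (n + N) • v) z - f x z)) (fun n => ?_) ?_
  · exact ((hN (n + N) (Nat.le_add_left _ _)).sub hm.self_of_nhds).const_smul _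
  · filter_upwards [hd] with z hz
    have h1 : HasDerivAt (fun s : ℝ => f (x + s • v) z) (fderiv ℝ (fun y => f y z) x v) 0 :=
      hz.hasFDerivAt.hasLineDerivAt v
    have h2 := (hasDerivAt_iff_tendsto_slope_zero.1 h1).comp
      (htne.comp (tendsto_add_atTop_nat N))
    simpa [Function.comp_def] using h2

end DerivMeasurable

section Criterion

variable {𝒵 E : Type*} [MeasurableSpace 𝒵] [NormedAddCommGroup E] [InnerProductSpace ℝ E]
  [FiniteDimensional ℝ E] [MeasurableSpace E] [BorelSpace E]

/-- A family of criterion functions `ψ θ` on the sample space, measurable, bounded and continuous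
in `θ ∈ Θ`, and twice differentiable in `θ` on a ball around the interior point `θs`, with a square
integrable bound on the second derivative. Second derivatives need not be continuous. -/
structure SmoothCriterion (μ : Measure 𝒵) (Θ : Set E) (θs : E) (ψ : E → 𝒵 → ℝ) (r C : ℝ)
    (B : 𝒵 → ℝ) : Prop where
  aemeasurable : ∀ θ ∈ Θ, AEMeasurable (ψ θ) μ
  continuousOn : ∀ᵐ z ∂μ, ContinuousOn (fun θ => ψ θ z) Θ
  bounded : ∀ᵐ z ∂μ, ∀ θ ∈ Θ, |ψ θ z| ≤ C
  pos : 0 < r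
  ball_subset : Metric.ball θs r ⊆ Θ
  differentiableAt : ∀ᵐ z ∂μ, ∀ θ ∈ Metric.ball θs r, DifferentiableAt ℝ (fun θ' => ψ θ' z) θ
  differentiableAt_gradient : ∀ᵐ z ∂μ, ∀ θ ∈ Metric.ball θs r,
    DifferentiableAt ℝ (gradient fun θ' => ψ θ' z) θ
  norm_fderiv_le : ∀ᵐ z ∂μ, ∀ θ ∈ Metric.ball θs r,
    ‖fderiv ℝ (gradient fun θ' => ψ θ' z) θ‖ ≤ B z
  memLp : MemLp B 2 μ

theorem aemeasurable_of_inner_basis {μ : Measure 𝒵} {g : 𝒵 → E}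
    (h : ∀ v, AEMeasurable (fun z => ⟪g z, v⟫) μ) : AEMeasurable g μ := by
  let b := stdOrthonormalBasis ℝ E
  have : g = fun z => ∑ i, ⟪g z, b i⟫ • b i := by
    funext z
    conv_lhs => rw [← b.sum_repr' (g z)]
    simp [real_inner_comm]
  rw [this]
  exact Finset.aemeasurable_fun_sum _ fun i _ => (h (b i)).smul_const _

namespace SmoothCriterion

variable {μ : Measure 𝒵} [IsProbabilityMeasure μ] {Θ : Set E} {θs : E} {ψ : E → 𝒵 → ℝ} {r C : ℝ}
  {B : 𝒵 → ℝ}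

theorem center_mem (h : SmoothCriterion μ Θ θs ψ r C B) : θs ∈ Θ :=
  h.ball_subset (Metric.mem_ball_self h.pos)

theorem add_mem_ball {u : E} (hu : ‖u‖ < r) : θs + u ∈ Metric.ball θs r := by simpa using hu

theorem integrable (h : SmoothCriterion μ Θ θs ψ r C B) {θ : E} (hθ : θ ∈ Θ) :
    Integrable (ψ θ) μ :=
  (integrable_const C).mono' (h.aemeasurable θ hθ).aestronglyMeasurable
    (h.bounded.mono fun _ hz => hz θ hθ)

theorem aemeasurable_gradient (h : SmoothCriterion μ Θ θs ψ r C B) {θ : E}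
    (hθ : θ ∈ Metric.ball θs r) : AEMeasurable (fun z => gradient (fun θ' => ψ θ' z) θ) μ := by
  refine aemeasurable_of_inner_basis fun v => ?_
  simp only [inner_gradient_left]
  refine aemeasurable_fderiv_apply v ?_ (h.differentiableAt.mono fun z hz => hz θ hθ)
  filter_upwards [Metric.isOpen_ball.mem_nhds hθ] with y hy using
    h.aemeasurable y (h.ball_subset hy)

theorem aestronglyMeasurable_hessian (h : SmoothCriterion μ Θ θs ψ r C B) :
    AEStronglyMeasurable (fun z => fderiv ℝ (gradient fun θ' => ψ θ' z) θs) μ := by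
  let b := stdOrthonormalBasis ℝ E
  have heq : ∀ T : E →L[ℝ] E, T = ∑ i, (innerSL ℝ (b i)).smulRight (T (b i)) := by
    intro T
    ext v
    conv_lhs => rw [← b.sum_repr' v]
    simp
  have hball := Metric.isOpen_ball.mem_nhds (Metric.mem_ball_self (x := θs) h.pos)
  have : (fun z => fderiv ℝ (gradient fun θ' => ψ θ' z) θs) = fun z => ∑ i,
      (ContinuousLinearMap.smulRightL ℝ E E (innerSL ℝ (b i)))
        (fderiv ℝ (gradient fun θ' => ψ θ' z) θs (b i)) := by
    funext z
    exact heq _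
  rw [this]
  refine Finset.aestronglyMeasurable_fun_sum _ fun i _ => ?_
  refine (ContinuousLinearMap.continuous _).comp_aestronglyMeasurable ?_
  refine AEMeasurable.aestronglyMeasurable ?_
  refine aemeasurable_fderiv_apply (f := fun θ z => gradient (fun θ' => ψ θ' z) θ) (b i) ?_ ?_
  · filter_upwards [hball] with y hy using h.aemeasurable_gradient hy
  · exact h.differentiableAt_gradient.mono fun z hz => hz θs (Metric.mem_ball_self h.pos)

theorem integrable_envelope (h : SmoothCriterion μ Θ θs ψ r C B) : Integrable B μ :=
  h.memLp.integrable one_le_two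

theorem integrable_hessian (h : SmoothCriterion μ Θ θs ψ r C B) :
    Integrable (fun z => fderiv ℝ (gradient fun θ' => ψ θ' z) θs) μ :=
  h.integrable_envelope.mono' h.aestronglyMeasurable_hessian
    (h.norm_fderiv_le.mono fun _ hz => hz θs (Metric.mem_ball_self h.pos))

/-- The score is square integrable: by interpolation it is at most a multiple of `C + B`. -/
theorem memLp_score (h : SmoothCriterion μ Θ θs ψ r C B) :
    MemLp (fun z => gradient (fun θ' => ψ θ' z) θs) 2 μ := by
  refine ((memLp_const (4 * C / r)).add (h.memLp.mul_const r)).mono'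
    (h.aemeasurable_gradient (Metric.mem_ball_self h.pos)).aestronglyMeasurable ?_
  filter_upwards [h.bounded, h.differentiableAt, h.differentiableAt_gradient, h.norm_fderiv_le]
    with z h1 h2 h3 h4
  exact norm_gradient_le_of_bounded h.pos h2 h3 h4 fun y hy => h1 y (h.ball_subset hy)

/-- The second-order Taylor remainder of `ψ` at `θs` is at most `k ‖u‖²`, where `k` has as small a
mean as desired. This needs no continuity of the second derivative: the remainder divided by `‖u‖²`
is continuous in `u`, also at `0`, and dominated. -/
theorem exists_taylor_majorant (h : SmoothCriterion μ Θ θs ψ r C B) {ε : ℝ} (hε : 0 < ε) :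
    ∃ δ > 0, δ ≤ r ∧ ∃ k : 𝒵 → ℝ, Integrable k μ ∧ ∫ z, k z ∂μ < ε ∧
      ∀ᵐ z ∂μ, ∀ u : E, ‖u‖ < δ →
        |ψ (θs + u) z - ψ θs z - ⟪gradient (fun θ' => ψ θ' z) θs, u⟫
          - 1 / 2 * ⟪fderiv ℝ (gradient fun θ' => ψ θ' z) θs u, u⟫| ≤ k z * ‖u‖ ^ 2 := by
  have hc := Metric.mem_ball_self (x := θs) h.pos
  let R : E → 𝒵 → ℝ := fun u z => ψ (θs + u) z - ψ θs z - ⟪gradient (fun θ' => ψ θ' z) θs, u⟫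
          - 1 / 2 * ⟪fderiv ℝ (gradient fun θ' => ψ θ' z) θs u, u⟫
  let g : E → 𝒵 → ℝ := fun u z => R u z / ‖u‖ ^ 2
  have hS : (0 : E) ∈ Metric.ball (0 : E) r := Metric.mem_ball_self h.pos
  have hmeas : ∀ u ∈ Metric.ball (0 : E) r, AEMeasurable (g u) μ := by
    intro u hu
    have hu' : ‖u‖ < r := by simpa using hu
    refine AEMeasurable.div_const (((AEMeasurable.sub ?_ ?_).sub ?_).sub ?_) _
    · exact h.aemeasurable _ (h.ball_subset (add_mem_ball hu'))
    · exact h.aemeasurable _ h.center_mem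
    · exact (h.aemeasurable_gradient hc).inner_const
    · have : AEMeasurable (fun z => fderiv ℝ (gradient fun θ' => ψ θ' z) θs u) μ :=
        (h.aestronglyMeasurable_hessian.apply_continuousLinearMap u).aemeasurable
      exact this.inner_const.const_mul _
  have hcont : ∀ᵐ z ∂μ, ContinuousOn (fun u => g u z) (Metric.ball 0 r) := by
    filter_upwards [h.differentiableAt, h.differentiableAt_gradient] with z h1 h2 u hu
    have hu' : ‖u‖ < r := by simpa using hu
    refine ContinuousAt.continuousWithinAt ?_
    rcases eq_or_ne u 0 with rfl | hne
    · rw [Metric.continuousAt_iff]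
      intro η hη
      obtain ⟨δ, hδ, hδ'⟩ := taylor_two_isLittleO (f := fun θ' => ψ θ' z) (x := θs)
        (by filter_upwards [Metric.isOpen_ball.mem_nhds hc] with y hy using h1 y hy)
        (h2 θs hc) (half_pos hη)
      refine ⟨δ, hδ, fun {v} hv => ?_⟩
      have h3 := hδ' v (by simpa using hv)
      have h4 : g 0 z = 0 := by simp [g]
      rw [h4, Real.dist_0_eq_abs, abs_div, abs_of_nonneg (sq_nonneg ‖v‖)]
      exact (div_le_of_le_mul₀ (sq_nonneg _) (half_pos hη).le h3).trans_lt (half_lt_self hη)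
    · have h3 : ContinuousAt (fun u => ψ (θs + u) z) u :=
        ContinuousAt.comp (f := fun u => θs + u) (g := fun θ => ψ θ z)
          (h1 _ (add_mem_ball hu')).continuousAt (by fun_prop)
      refine ContinuousAt.div ?_ (by fun_prop) (by simpa using hne)
      exact ((h3.sub (by fun_prop)).sub (by fun_prop)).sub (by fun_prop)
  have hbound : ∀ᵐ z ∂μ, ∀ u ∈ Metric.ball (0 : E) r, |g u z| ≤ 2 * B z := by
    filter_upwards [h.differentiableAt, h.differentiableAt_gradient, h.norm_fderiv_le]
      with z h1 h2 h3 u hu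
    have hu' : ‖u‖ < r := by simpa using hu
    have hB := (norm_nonneg _).trans (h3 θs hc)
    have h4 := abs_sub_taylor_one_le h1 h2 h3 hu'
    have h5 : |1 / 2 * ⟪fderiv ℝ (gradient fun θ' => ψ θ' z) θs u, u⟫| ≤ B z * ‖u‖ ^ 2 := by
      rw [abs_mul, abs_of_pos (by norm_num : (0 : ℝ) < 1 / 2)]
      have : |⟪fderiv ℝ (gradient fun θ' => ψ θ' z) θs u, u⟫| ≤ (B z * ‖u‖) * ‖u‖ := by
        refine (abs_real_inner_le_norm _ _).trans ?_
        gcongr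
        exact (ContinuousLinearMap.le_opNorm _ _).trans (by gcongr; exact h3 θs hc)
      have h6 : 0 ≤ |⟪fderiv ℝ (gradient fun θ' => ψ θ' z) θs u, u⟫| := abs_nonneg _
      nlinarith
    rw [abs_div, abs_of_nonneg (sq_nonneg ‖u‖)]
    refine div_le_of_le_mul₀ (sq_nonneg _) (by positivity) ?_
    refine (abs_sub _ _).trans ?_
    linarith
  obtain ⟨δ, hδ, k, hk, hkε, hkb⟩ := exists_integrable_oscillation_le hS hmeas hcont
    (h.integrable_envelope.const_mul 2) hbound hε
  refine ⟨min δ r, lt_min hδ h.pos, min_le_right _ _, k, hk, hkε, ?_⟩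
  filter_upwards [hkb] with z hz u hu
  have h1 := hz u (by simpa using hu.trans_le (min_le_right _ _))
    (by simpa using hu.trans_le (min_le_left _ _))
  have h4 : g 0 z = 0 := by simp [g]
  rw [h4, sub_zero] at h1
  change |R u z| ≤ _
  rcases eq_or_ne u 0 with rfl | hne
  · simp [R]
  · have hpos : 0 < ‖u‖ ^ 2 := by positivity
    rwa [abs_div, abs_of_pos hpos, div_le_iff₀ hpos] at h1

end SmoothCriterion

end Criterion

/-! ### Expansions of the population and of the empirical criterion -/

section Expansion

variable {𝒵 E : Type*} [MeasurableSpace 𝒵] [NormedAddCommGroup E] [InnerProductSpace ℝ E]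
  [FiniteDimensional ℝ E] [MeasurableSpace E] [BorelSpace E]

/-- The coefficients of a second-order expansion are the derivatives; of the second-order one only
the quadratic form is determined, since `T` need not be symmetric. -/
theorem gradient_eq_and_hessian_eq_of_expansion {W : E → ℝ} {x g : E} {T : E →L[ℝ] E}
    (hd : ∀ᶠ y in 𝓝 x, DifferentiableAt ℝ W y) (hd' : DifferentiableAt ℝ (gradient W) x)
    (hexp : ∀ ε > 0, ∃ δ > 0, ∀ u : E, ‖u‖ < δ →
      |W (x + u) - W x - ⟪g, u⟫ - 1 / 2 * ⟪T u, u⟫| ≤ ε * ‖u‖ ^ 2) :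
    g = gradient W x ∧ ∀ u, ⟪T u, u⟫ = ⟪fderiv ℝ (gradient W) x u, u⟫ := by
  set g' := gradient W x with hg'
  set T' := fderiv ℝ (gradient W) x with hT'
  -- the two quadratic polynomials agree up to `o(‖u‖²)`
  have hdiff : ∀ ε > 0, ∃ δ > 0, ∀ u : E, ‖u‖ < δ →
      |⟪g - g', u⟫ + 1 / 2 * (⟪T u, u⟫ - ⟪T' u, u⟫)| ≤ ε * ‖u‖ ^ 2 := by
    intro ε hε
    obtain ⟨δ₁, hδ₁, h₁⟩ := hexp (ε / 2) (half_pos hε)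
    obtain ⟨δ₂, hδ₂, h₂⟩ := taylor_two_isLittleO hd hd' (half_pos hε)
    refine ⟨min δ₁ δ₂, lt_min hδ₁ hδ₂, fun u hu => ?_⟩
    have a₁ := abs_le.1 (h₁ u (hu.trans_le (min_le_left _ _)))
    have a₂ := abs_le.1 (h₂ u (hu.trans_le (min_le_right _ _)))
    rw [inner_sub_left, abs_le]
    constructor <;> linarith [a₁.1, a₁.2, a₂.1, a₂.2]
  -- along a ray, `t ↦ t a + t² b` is `o(t²)`
  have hray : ∀ v : E, ⟪g - g', v⟫ = 0 ∧ ⟪T v, v⟫ = ⟪T' v, v⟫ := by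
    intro v
    set a := ⟪g - g', v⟫ with ha
    set q := ⟪T v, v⟫ - ⟪T' v, v⟫ with hq
    have hsmall : ∀ ε > 0, ∃ t₀ > 0, ∀ t : ℝ, 0 < t → t ≤ t₀ →
        |a + t * (q / 2)| ≤ ε * ‖v‖ ^ 2 * t := by
      intro ε hε
      obtain ⟨δ, hδ, h⟩ := hdiff ε hε
      refine ⟨δ / (2 * (‖v‖ + 1)), by positivity, fun t ht htt => ?_⟩
      have hv := norm_nonneg v
      have h1 : ‖t • v‖ < δ := by
        rw [norm_smul, Real.norm_of_nonneg ht.le]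
        calc t * ‖v‖ ≤ δ / (2 * (‖v‖ + 1)) * (‖v‖ + 1) := by gcongr; linarith
          _ = δ / 2 := by field_simp
          _ < δ := half_lt_self hδ
      have h2 := h (t • v) h1
      simp only [map_smul, real_inner_smul_left, real_inner_smul_right, norm_smul,
        Real.norm_of_nonneg ht.le] at h2
      have h3 : t * ⟪g - g', v⟫ + 1 / 2 * (t * (t * ⟪T v, v⟫) - t * (t * ⟪T' v, v⟫))
          = t * (a + t * (q / 2)) := by rw [ha, hq]; ring
      rw [h3, abs_mul, abs_of_pos ht] at h2
      have h4 : t * |a + t * (q / 2)| ≤ t * (ε * ‖v‖ ^ 2 * t) := h2.trans_eq (by ring)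
      exact le_of_mul_le_mul_left h4 ht
    have ha0 : a = 0 := by
      obtain ⟨t₀, ht₀, h⟩ := hsmall 1 one_pos
      have hlim : Tendsto (fun t : ℝ => 1 * ‖v‖ ^ 2 * t - |a + t * (q / 2)|) (𝓝[>] 0)
          (𝓝 (1 * ‖v‖ ^ 2 * 0 - |a + 0 * (q / 2)|)) :=
        (Continuous.tendsto (by fun_prop) 0).mono_left nhdsWithin_le_nhds
      have h0 : ∀ᶠ t : ℝ in 𝓝[>] 0, 0 ≤ 1 * ‖v‖ ^ 2 * t - |a + t * (q / 2)| := by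
        filter_upwards [Ioc_mem_nhdsGT ht₀] with t ht
        exact sub_nonneg.2 (h t ht.1 ht.2)
      have := ge_of_tendsto hlim h0
      have h5 := abs_nonneg (a + 0 * (q / 2))
      have h6 : |a + 0 * (q / 2)| = 0 := by linarith
      simpa using h6
    have hq0 : |q / 2| ≤ 0 := by
      refine le_of_forall_pos_le_add fun η hη => ?_
      obtain ⟨t, ht, h⟩ := hsmall (η / (‖v‖ ^ 2 + 1)) (by positivity)
      have h7 := h t ht le_rfl
      rw [ha0, zero_add, abs_mul, abs_of_pos ht, mul_comm] at h7
      have h8 := le_of_mul_le_mul_right h7 ht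
      refine h8.trans ?_
      rw [zero_add, div_mul_eq_mul_div]
      refine div_le_of_le_mul₀ (by positivity) hη.le ?_
      nlinarith
    have hq1 : q / 2 = 0 := abs_eq_zero.1 (le_antisymm hq0 (abs_nonneg _))
    refine ⟨ha0, ?_⟩
    have : q = 0 := by linarith
    linarith
  refine ⟨?_, fun u => (hray u).2⟩
  have := (hray (g - g')).1
  rwa [inner_self_eq_zero, sub_eq_zero] at this

namespace SmoothCriterion

variable {μ : Measure 𝒵} [IsProbabilityMeasure μ] {Θ : Set E} {θs : E} {ψ : E → 𝒵 → ℝ} {r C : ℝ}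
  {B : 𝒵 → ℝ}

theorem integral_expansion (h : SmoothCriterion μ Θ θs ψ r C B) {W : E → ℝ}
    (hW : ∀ θ ∈ Θ, W θ = ∫ z, ψ θ z ∂μ) {ε : ℝ} (hε : 0 < ε) :
    ∃ δ > 0, ∀ u : E, ‖u‖ < δ →
      |W (θs + u) - W θs - ⟪∫ z, gradient (fun θ' => ψ θ' z) θs ∂μ, u⟫
        - 1 / 2 * ⟪(∫ z, fderiv ℝ (gradient fun θ' => ψ θ' z) θs ∂μ) u, u⟫| ≤ ε * ‖u‖ ^ 2 := by
  obtain ⟨δ, hδ, hδr, k, hk, hkε, hkb⟩ := h.exists_taylor_majorant hε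
  refine ⟨δ, hδ, fun u hu => ?_⟩
  have i1 := h.integrable (h.ball_subset (add_mem_ball (θs := θs) (hu.trans_le hδr)))
  have i2 := h.integrable h.center_mem
  have hs := h.memLp_score.integrable one_le_two
  have i3 := hs.inner_const (𝕜 := ℝ) u
  have i4 := (h.integrable_hessian.apply_continuousLinearMap u).inner_const (𝕜 := ℝ) u
  have hinner : ∀ {g : 𝒵 → E}, Integrable g μ → ⟪∫ z, g z ∂μ, u⟫ = ∫ z, ⟪g z, u⟫ ∂μ := by
    intro g hg
    simp only [real_inner_comm u]
    exact (integral_inner hg u).symm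
  have e3 := hinner hs
  have e4 : ⟪(∫ z, fderiv ℝ (gradient fun θ' => ψ θ' z) θs ∂μ) u, u⟫
      = ∫ z, ⟪fderiv ℝ (gradient fun θ' => ψ θ' z) θs u, u⟫ ∂μ := by
    rw [ContinuousLinearMap.integral_apply h.integrable_hessian]
    exact hinner (h.integrable_hessian.apply_continuousLinearMap u)
  rw [hW _ (h.ball_subset (add_mem_ball (hu.trans_le hδr))), hW _ h.center_mem, e3, e4,
    ← integral_const_mul, ← integral_sub i1 i2, ← integral_sub (by exact i1.sub i2) i3,
    ← integral_sub (by exact (i1.sub i2).sub i3) (i4.const_mul _), ← Real.norm_eq_abs]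
  calc _ ≤ ∫ z, k z * ‖u‖ ^ 2 ∂μ :=
        norm_integral_le_of_norm_le (hk.mul_const _) (hkb.mono fun z hz => hz u hu)
    _ = (∫ z, k z ∂μ) * ‖u‖ ^ 2 := integral_mul_const _ _
    _ ≤ _ := by gcongr

/-- Differentiation under the integral at `θs`. Both sides come from quadratic expansions of `W`, so
no domination of the gradients is needed. -/
theorem integral_score_eq (h : SmoothCriterion μ Θ θs ψ r C B) {W : E → ℝ}
    (hW : ∀ θ ∈ Θ, W θ = ∫ z, ψ θ z ∂μ)
    (hd : ∀ᶠ y in 𝓝 θs, DifferentiableAt ℝ W y) (hd' : DifferentiableAt ℝ (gradient W) θs) :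
    ∫ z, gradient (fun θ' => ψ θ' z) θs ∂μ = gradient W θs :=
  (gradient_eq_and_hessian_eq_of_expansion hd hd'
    fun _ hε => h.integral_expansion hW hε).1

theorem inner_integral_hessian_eq (h : SmoothCriterion μ Θ θs ψ r C B) {W : E → ℝ}
    (hW : ∀ θ ∈ Θ, W θ = ∫ z, ψ θ z ∂μ)
    (hd : ∀ᶠ y in 𝓝 θs, DifferentiableAt ℝ W y) (hd' : DifferentiableAt ℝ (gradient W) θs)
    (u : E) :
    ⟪(∫ z, fderiv ℝ (gradient fun θ' => ψ θ' z) θs ∂μ) u, u⟫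
      = ⟪fderiv ℝ (gradient W) θs u, u⟫ :=
  (gradient_eq_and_hessian_eq_of_expansion hd hd'
    fun _ hε => h.integral_expansion hW hε).2 u

theorem continuousOn_integral (h : SmoothCriterion μ Θ θs ψ r C B) :
    ContinuousOn (fun θ => ∫ z, ψ θ z ∂μ) Θ := by
  intro θ hθ
  refine tendsto_integral_filter_of_dominated_convergence (fun _ => C) ?_ ?_
    (integrable_const C) ?_
  · filter_upwards [self_mem_nhdsWithin] with x hx using (h.aemeasurable x hx).aestronglyMeasurable
  · filter_upwards [self_mem_nhdsWithin] with x hx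
    exact h.bounded.mono fun z hz => hz x hx
  · exact h.continuousOn.mono fun z hz => hz θ hθ

variable {Ω' : Type*} [MeasurableSpace Ω'] {P' : Measure Ω'} {Z : ℕ → Ω' → 𝒵}

/-- Almost surely the empirical criterion has a quadratic expansion at `θs`, uniformly in `n`, with
the population Hessian. -/
theorem ae_sampleMean_expansion (h : SmoothCriterion μ Θ θs ψ r C B)
    (hZ : ∀ i, HasLaw (Z i) μ P') (hind : iIndepFun Z P') :
    ∀ᵐ ω ∂P', ∀ ε > 0, ∃ δ > 0, ∀ᶠ n in atTop, ∀ u : E, ‖u‖ < δ →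
      |sampleMean (fun i => Z i ω) n (ψ (θs + u)) - sampleMean (fun i => Z i ω) n (ψ θs)
        - ⟪sampleMean (fun i => Z i ω) n (fun z => gradient (fun θ' => ψ θ' z) θs), u⟫
        - 1 / 2 * ⟪(∫ z, fderiv ℝ (gradient fun θ' => ψ θ' z) θs ∂μ) u, u⟫|
      ≤ ε * ‖u‖ ^ 2 := by
  have hmain : ∀ m : ℕ, ∃ δ > 0, ∀ᵐ ω ∂P', ∀ᶠ n in atTop, ∀ u : E, ‖u‖ < δ →
      |sampleMean (fun i => Z i ω) n (ψ (θs + u)) - sampleMean (fun i => Z i ω) n (ψ θs)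
        - ⟪sampleMean (fun i => Z i ω) n (fun z => gradient (fun θ' => ψ θ' z) θs), u⟫
        - 1 / 2 * ⟪(∫ z, fderiv ℝ (gradient fun θ' => ψ θ' z) θs ∂μ) u, u⟫|
      ≤ 2 * (1 / ((m : ℝ) + 1)) * ‖u‖ ^ 2 := by
    intro m
    set ε : ℝ := 1 / ((m : ℝ) + 1)
    have hε : 0 < ε := Nat.one_div_pos_of_nat
    obtain ⟨δ, hδ, -, k, hk, hkε, hkb⟩ := h.exists_taylor_majorant hε
    refine ⟨δ, hδ, ?_⟩
    filter_upwards [ae_tendsto_sampleMean hZ hind hk,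
      ae_tendsto_sampleMean hZ hind h.integrable_hessian, ae_forall_sample hZ hkb] with ω h1 h2 h3
    have h4 := (tendsto_iff_norm_sub_tendsto_zero.1 h2).eventually_le_const hε
    filter_upwards [h1.eventually_le_const hkε, h4] with n hn1 hn2 u hu
    set z := fun i => Z i ω
    set T := ∫ z, fderiv ℝ (gradient fun θ' => ψ θ' z) θs ∂μ
    set Tn := sampleMean z n (fun z => fderiv ℝ (gradient fun θ' => ψ θ' z) θs) with hTn
    have e1 : sampleMean z n (ψ (θs + u)) - sampleMean z n (ψ θs)
        - ⟪sampleMean z n (fun z => gradient (fun θ' => ψ θ' z) θs), u⟫ - 1 / 2 * ⟪Tn u, u⟫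
        = sampleMean z n (fun z => ψ (θs + u) z - ψ θs z
          - ⟪gradient (fun θ' => ψ θ' z) θs, u⟫
          - 1 / 2 * ⟪fderiv ℝ (gradient fun θ' => ψ θ' z) θs u, u⟫) := by
      simp only [hTn, sampleMean, real_inner_smul_left, sum_inner, Finset.sum_sub_distrib,
        smul_eq_mul, _root_.smul_apply, _root_.sum_apply,
        ← Finset.mul_sum]
      ring
    have e2 : |sampleMean z n (fun z => ψ (θs + u) z - ψ θs z
          - ⟪gradient (fun θ' => ψ θ' z) θs, u⟫
          - 1 / 2 * ⟪fderiv ℝ (gradient fun θ' => ψ θ' z) θs u, u⟫)| ≤ ε * ‖u‖ ^ 2 := by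
      refine (abs_sampleMean_le (h := fun z => k z * ‖u‖ ^ 2) (fun i => h3 i u hu) n).trans ?_
      have : sampleMean z n (fun z => k z * ‖u‖ ^ 2) = sampleMean z n k * ‖u‖ ^ 2 := by
        simp only [sampleMean, smul_eq_mul, ← Finset.sum_mul]
        ring
      rw [this]
      gcongr
    have e3 : |⟪(Tn - T) u, u⟫| ≤ ε * ‖u‖ ^ 2 :=
      calc _ ≤ ‖(Tn - T) u‖ * ‖u‖ := abs_real_inner_le_norm _ _
        _ ≤ (ε * ‖u‖) * ‖u‖ := by
          gcongr
          exact ((Tn - T).le_opNorm u).trans (by gcongr)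
        _ = _ := by ring
    rw [← e1] at e2
    rw [_root_.sub_apply, inner_sub_left] at e3
    have b2 := abs_le.1 e2
    have b3 := abs_le.1 e3
    have b4 : 0 ≤ ε * ‖u‖ ^ 2 := by positivity
    rw [abs_le]
    constructor <;> linarith [b2.1, b2.2, b3.1, b3.2]
  choose δ hδ hae using hmain
  filter_upwards [ae_all_iff.2 hae] with ω hω ε hε
  obtain ⟨m, hm⟩ := exists_nat_one_div_lt (half_pos hε)
  refine ⟨δ m, hδ m, ?_⟩
  filter_upwards [hω m] with n hn u hu
  refine (hn u hu).trans ?_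
  gcongr
  linarith

/-- Wald's argument: near any `θ₀ ∈ Θ` other than `θs`, the empirical criterion is eventually below
its value at `θs`; a finite number of such neighbourhoods covers `Θ` outside a ball at `θs`. -/
theorem ae_tendsto_argmax (h : SmoothCriterion μ Θ θs ψ r C B) (hΘ : IsCompact Θ)
    (hmax : ∀ θ ∈ Θ, θ ≠ θs → ∫ z, ψ θ z ∂μ < ∫ z, ψ θs z ∂μ)
    (hZ : ∀ i, HasLaw (Z i) μ P') (hind : iIndepFun Z P') {θhat : ℕ → Ω' → E}
    (hθ : ∀ᵐ ω ∂P', ∀ n, θhat n ω ∈ Θ ∧ ∀ θ ∈ Θ,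
      sampleMean (fun i => Z i ω) n (ψ θ) ≤ sampleMean (fun i => Z i ω) n (ψ (θhat n ω))) :
    ∀ᵐ ω ∂P', Tendsto (fun n => θhat n ω) atTop (𝓝 θs) := by
  let p : Set E → Prop := fun s => ∀ᵐ ω ∂P', ∀ᶠ n in atTop, ∀ θ ∈ s ∩ Θ,
    sampleMean (fun i => Z i ω) n (ψ θ) < sampleMean (fun i => Z i ω) n (ψ θs)
  have hp : ∀ η > 0, p (Θ \ Metric.ball θs η) := by
    intro η hη
    refine (hΘ.diff Metric.isOpen_ball).induction_on (p := p) ?_ ?_ ?_ ?_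
    · exact ae_of_all _ fun ω => Eventually.of_forall fun n θ hθ => by simp at hθ
    · intro s t hst ht
      filter_upwards [ht] with ω hω
      filter_upwards [hω] with n hn θ hθ using hn θ ⟨hst hθ.1, hθ.2⟩
    · intro s t hs ht
      filter_upwards [hs, ht] with ω h1 h2
      filter_upwards [h1, h2] with n hn1 hn2 θ hθ
      exact hθ.1.elim (fun h => hn1 θ ⟨h, hθ.2⟩) (fun h => hn2 θ ⟨h, hθ.2⟩)
    · intro θ₀ hθ₀
      have hne : θ₀ ≠ θs := by
        rintro rfl
        exact hθ₀.2 (Metric.mem_ball_self hη)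
      have hgap := hmax θ₀ hθ₀.1 hne
      obtain ⟨δ, hδ, k, hk, hkε, hkb⟩ := exists_integrable_oscillation_le hθ₀.1 h.aemeasurable
        h.continuousOn (integrable_const C) h.bounded (sub_pos.2 hgap)
      refine ⟨Metric.ball θ₀ δ, mem_nhdsWithin_of_mem_nhds (Metric.ball_mem_nhds _ hδ), ?_⟩
      filter_upwards [ae_tendsto_sampleMean hZ hind hk,
        ae_tendsto_sampleMean hZ hind (h.integrable hθ₀.1),
        ae_tendsto_sampleMean hZ hind (h.integrable h.center_mem),
        ae_forall_sample hZ hkb] with ω h1 h2 h3 h4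
      have hlt : ∫ z, k z ∂μ + ∫ z, ψ θ₀ z ∂μ < ∫ z, ψ θs z ∂μ := by linarith
      filter_upwards [(h1.add h2).eventually_lt h3 hlt] with n hn θ hθ
      refine lt_of_le_of_lt ?_ hn
      have h5 : sampleMean (fun i => Z i ω) n (ψ θ) ≤
          sampleMean (fun i => Z i ω) n (fun z => k z + ψ θ₀ z) := by
        refine sampleMean_le_sampleMean (fun i => ?_) n
        have := (abs_le.1 (h4 i θ hθ.2 hθ.1)).2
        linarith
      refine h5.trans_eq ?_
      simp only [sampleMean, Finset.sum_add_distrib, smul_add]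
  have hp' : ∀ m : ℕ, p (Θ \ Metric.ball θs (1 / ((m : ℝ) + 1))) :=
    fun m => hp _ Nat.one_div_pos_of_nat
  filter_upwards [ae_all_iff.2 hp', hθ] with ω hω hmaxω
  rw [Metric.tendsto_atTop']
  intro η hη
  obtain ⟨m, hm⟩ := exists_nat_one_div_lt hη
  obtain ⟨N, hN⟩ := eventually_atTop.1 (hω m)
  refine ⟨N, fun n hn => ?_⟩
  by_contra hfar
  refine absurd (hN n (le_of_lt hn) (θhat n ω) ⟨⟨(hmaxω n).1, fun hb => ?_⟩, (hmaxω n).1⟩)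
    (not_lt.2 ((hmaxω n).2 θs h.center_mem))
  exact hfar ((Metric.mem_ball.1 hb).trans hm)

end SmoothCriterion

/-- Maximizers of functions with a common quadratic expansion `⟪S n, u⟫ - ⟪A u, u⟫ / 2` are, up to
`o(‖S n‖)`, the maximizers `A⁻¹ (S n)` of the quadratic functions. -/
theorem argmax_sub_newton_le {A L : E →L[ℝ] E} (hsymm : ∀ u v, ⟪A u, v⟫ = ⟪u, A v⟫)
    (hAL : ∀ v, A (L v) = v) {c : ℝ} (hc : 0 < c) (hpos : ∀ u, c * ‖u‖ ^ 2 ≤ ⟪A u, u⟫)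
    {f : ℕ → E → ℝ} {S hn : ℕ → E} {ρ : ℝ} (hρ : 0 < ρ) (hS : Tendsto S atTop (𝓝 0))
    (hn0 : Tendsto hn atTop (𝓝 0)) (hmax : ∀ n, ∀ u, ‖u‖ < ρ → f n u ≤ f n (hn n))
    (hexp : ∀ ε > 0, ∃ δ > 0, ∀ᶠ n in atTop, ∀ u : E, ‖u‖ < δ →
      |f n u - f n 0 - ⟪S n, u⟫ + 1 / 2 * ⟪A u, u⟫| ≤ ε * ‖u‖ ^ 2) {η : ℝ} (hη : 0 < η) :
    ∀ᶠ n in atTop, ‖hn n - L (S n)‖ ≤ η * ‖S n‖ := by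
  set K : ℝ := (4 / c) ^ 2 + ‖L‖ ^ 2
  have hK : 0 < K := by positivity
  set ε : ℝ := min (c / 4) (c * η ^ 2 / (2 * K))
  have hε : 0 < ε := by positivity
  obtain ⟨δ, hδ, hev⟩ := hexp ε hε
  have hLS : Tendsto (fun n => L (S n)) atTop (𝓝 0) := by
    have := (L.continuous.tendsto 0).comp hS
    rwa [map_zero] at this
  have hball := Metric.ball_mem_nhds (0 : E) (lt_min hδ hρ)
  filter_upwards [hev, hn0.eventually hball, hLS.eventually hball] with n hq hh ht
  simp only [dist_zero_right, lt_min_iff] at hh ht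
  set h := hn n
  set t := L (S n) with htdef
  have hAt : A t = S n := hAL _
  have q1 := (abs_le.1 (hq h hh.1)).2
  have q2 := (abs_le.1 (hq t ht.1)).1
  have m0 := hmax n 0 (by simpa using hρ)
  have mt := hmax n t ht.2
  have p1 := hpos h
  have s1 : ⟪S n, h⟫ ≤ ‖S n‖ * ‖h‖ := real_inner_le_norm _ _
  have hε1 : ε ≤ c / 4 := min_le_left _ _
  have hbound : ‖h‖ ≤ 4 / c * ‖S n‖ := by
    have e1 : ε * ‖h‖ ^ 2 ≤ c / 4 * ‖h‖ ^ 2 := by gcongr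
    have e2 : c / 4 * ‖h‖ * ‖h‖ ≤ ‖S n‖ * ‖h‖ := by nlinarith
    rcases (norm_nonneg h).eq_or_lt with h0 | h0
    · rw [← h0]; positivity
    · have e3 := le_of_mul_le_mul_right e2 h0
      rw [div_mul_eq_mul_div, le_div_iff₀ hc]
      linarith
  have tbound : ‖t‖ ≤ ‖L‖ * ‖S n‖ := L.le_opNorm _
  -- completing the square
  have hsq : ⟪A (h - t), h - t⟫ = ⟪A h, h⟫ - 2 * ⟪S n, h⟫ + ⟪S n, t⟫ := by
    have : ⟪A h, t⟫ = ⟪S n, h⟫ := by rw [hsymm, hAt, real_inner_comm]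
    rw [map_sub, inner_sub_left, inner_sub_right, inner_sub_right, this, hAt]
    ring
  have htt : ⟪A t, t⟫ = ⟪S n, t⟫ := by rw [hAt]
  have p2 := hpos (h - t)
  have h2 : ‖h‖ ^ 2 ≤ (4 / c) ^ 2 * ‖S n‖ ^ 2 := by
    rw [← mul_pow]; gcongr
  have t2 : ‖t‖ ^ 2 ≤ ‖L‖ ^ 2 * ‖S n‖ ^ 2 := by
    rw [← mul_pow]; gcongr
  have key : c * ‖h - t‖ ^ 2 ≤ 2 * ε * (K * ‖S n‖ ^ 2) := by
    have e4 : c * ‖h - t‖ ^ 2 ≤ 2 * ε * (‖h‖ ^ 2 + ‖t‖ ^ 2) := by linarith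
    refine e4.trans ?_
    gcongr
    linarith
  have hε2 : ε ≤ c * η ^ 2 / (2 * K) := min_le_right _ _
  have key2 : c * ‖h - t‖ ^ 2 ≤ c * (η * ‖S n‖) ^ 2 := by
    refine key.trans ?_
    calc 2 * ε * (K * ‖S n‖ ^ 2) ≤ 2 * (c * η ^ 2 / (2 * K)) * (K * ‖S n‖ ^ 2) := by gcongr
      _ = _ := by field_simp
  exact le_of_sq_le_sq (le_of_mul_le_mul_left key2 hc) (by positivity)

end Expansion

/-! ### Limit laws of the maximizer and of the regret -/

section Slutsky

variable {Ω' Ω₀ E : Type*} [MeasurableSpace Ω'] [MeasurableSpace Ω₀] [NormedAddCommGroup E]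
  [InnerProductSpace ℝ E] [FiniteDimensional ℝ E] [MeasurableSpace E] [BorelSpace E]
  {P' : Measure Ω'} [IsProbabilityMeasure P'] {P₀ : Measure Ω₀} [IsProbabilityMeasure P₀]

/-- If `Y n - L (X n)` is almost surely `o(‖X n‖)` and `X n ⇒ ξ`, then `Y n ⇒ L ξ`. -/
theorem tendstoInDistribution_of_ae_sub_le {X Y : ℕ → Ω' → E} {ξ : Ω₀ → E} (L : E →L[ℝ] E)
    (hX : TendstoInDistribution X atTop ξ (fun _ => P') P₀) (hY : ∀ n, AEMeasurable (Y n) P')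
    (h : ∀ᵐ ω ∂P', ∀ η > 0, ∀ᶠ n in atTop, ‖Y n ω - L (X n ω)‖ ≤ η * ‖X n ω‖) :
    TendstoInDistribution Y atTop (fun ω => L (ξ ω)) (fun _ => P') P₀ := by
  have hXm := hX.forall_aemeasurable
  -- `Y = L X + ‖X‖ V + e`, where `V → 0` and `e` vanishes unless `X = 0`
  let D : ℕ → Ω' → E := fun n ω => Y n ω - L (X n ω)
  have hD : ∀ n, AEMeasurable (D n) P' := fun n =>
    (hY n).sub (L.continuous.measurable.comp_aemeasurable (hXm n))
  let V : ℕ → Ω' → E := fun n ω => ‖X n ω‖⁻¹ • D n ω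
  have hV : ∀ n, AEMeasurable (V n) P' := fun n => (hXm n).norm.inv.smul (hD n)
  let e : ℕ → Ω' → E := fun n ω => D n ω - ‖X n ω‖ • V n ω
  have he : ∀ n, AEMeasurable (e n) P' := fun n => (hD n).sub ((hXm n).norm.smul (hV n))
  have hlim : ∀ᵐ ω ∂P', Tendsto (fun n => (V n ω, e n ω)) atTop (𝓝 ((0 : E), (0 : E))) := by
    filter_upwards [h] with ω hω
    refine Tendsto.prodMk_nhds ?_ ?_
    · rw [Metric.tendsto_atTop']
      intro η hη
      obtain ⟨N, hN⟩ := eventually_atTop.1 (hω (η / 2) (half_pos hη))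
      refine ⟨N, fun n hn => ?_⟩
      rw [dist_zero_right, norm_smul, norm_inv, norm_norm]
      refine lt_of_le_of_lt ?_ (half_lt_self hη)
      rcases eq_or_ne ‖X n ω‖ 0 with h0 | h0
      · rw [h0]; simp [(half_pos hη).le]
      · rw [inv_mul_le_iff₀ (lt_of_le_of_ne (norm_nonneg _) h0.symm), mul_comm]
        exact hN n hn.le
    · refine tendsto_const_nhds.congr' ?_
      filter_upwards [hω 1 one_pos] with n hn
      symm
      dsimp only [e, V]
      rcases eq_or_ne ‖X n ω‖ 0 with h0 | h0
      · rw [h0, mul_zero] at hn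
        have : D n ω = 0 := norm_le_zero_iff.1 hn
        simp [this]
      · rw [smul_inv_smul₀ h0, sub_self]
  have hmeasure := tendstoInMeasure_of_tendsto_ae
    (fun n => ((hV n).prodMk (he n)).aestronglyMeasurable) hlim
  have key := hX.continuous_comp_prodMk_of_tendstoInMeasure_const
    (g := fun p : E × E × E => L p.1 + ‖p.1‖ • p.2.1 + p.2.2) (by fun_prop) hmeasure
    (fun n => (hV n).prodMk (he n))
  refine key.congr (fun n => ae_of_all _ fun ω => ?_) (ae_of_all _ fun ω => ?_)
  · simp only [e, D]
    abel
  · simp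

/-- If `R n - q (Y n)` is almost surely `o(‖Y n‖²)` and `Y n ⇒ ξ`, then `R n ⇒ q ξ`. -/
theorem tendstoInDistribution_of_ae_sub_le_sq {Y : ℕ → Ω' → E} {R : ℕ → Ω' → ℝ} {ξ : Ω₀ → E}
    {q : E → ℝ} (hq : Continuous q)
    (hY : TendstoInDistribution Y atTop ξ (fun _ => P') P₀) (hR : ∀ n, AEMeasurable (R n) P')
    (h : ∀ᵐ ω ∂P', ∀ η > 0, ∀ᶠ n in atTop, |R n ω - q (Y n ω)| ≤ η * ‖Y n ω‖ ^ 2) :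
    TendstoInDistribution R atTop (fun ω => q (ξ ω)) (fun _ => P') P₀ := by
  have hYm := hY.forall_aemeasurable
  let D : ℕ → Ω' → ℝ := fun n ω => R n ω - q (Y n ω)
  have hD : ∀ n, AEMeasurable (D n) P' := fun n =>
    (hR n).sub (hq.measurable.comp_aemeasurable (hYm n))
  let V : ℕ → Ω' → ℝ := fun n ω => D n ω / ‖Y n ω‖ ^ 2
  have hV : ∀ n, AEMeasurable (V n) P' := fun n => (hD n).div ((hYm n).norm.pow_const 2)
  let e : ℕ → Ω' → ℝ := fun n ω => D n ω - ‖Y n ω‖ ^ 2 * V n ω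
  have he : ∀ n, AEMeasurable (e n) P' := fun n =>
    (hD n).sub (((hYm n).norm.pow_const 2).mul (hV n))
  have hlim : ∀ᵐ ω ∂P', Tendsto (fun n => (V n ω, e n ω)) atTop (𝓝 ((0 : ℝ), (0 : ℝ))) := by
    filter_upwards [h] with ω hω
    refine Tendsto.prodMk_nhds ?_ ?_
    · rw [Metric.tendsto_atTop']
      intro η hη
      obtain ⟨N, hN⟩ := eventually_atTop.1 (hω (η / 2) (half_pos hη))
      refine ⟨N, fun n hn => ?_⟩
      rw [Real.dist_0_eq_abs, abs_div, abs_of_nonneg (sq_nonneg ‖Y n ω‖)]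
      exact lt_of_le_of_lt (div_le_of_le_mul₀ (sq_nonneg _) (half_pos hη).le (hN n hn.le))
        (half_lt_self hη)
    · refine tendsto_const_nhds.congr' ?_
      filter_upwards [hω 1 one_pos] with n hn
      symm
      dsimp only [e, V]
      rcases eq_or_ne (‖Y n ω‖ ^ 2) 0 with h0 | h0
      · rw [h0, mul_zero] at hn
        have : D n ω = 0 := abs_eq_zero.1 (le_antisymm hn (abs_nonneg _))
        simp [this]
      · rw [mul_div_cancel₀ _ h0, sub_self]
  have hmeasure := tendstoInMeasure_of_tendsto_ae
    (fun n => ((hV n).prodMk (he n)).aestronglyMeasurable) hlim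
  have key := hY.continuous_comp_prodMk_of_tendstoInMeasure_const
    (g := fun p : E × ℝ × ℝ => q p.1 + ‖p.1‖ ^ 2 * p.2.1 + p.2.2) (by fun_prop) hmeasure
    (fun n => (hV n).prodMk (he n))
  refine key.congr (fun n => ae_of_all _ fun ω => ?_) (ae_of_all _ fun ω => ?_)
  · simp only [e, D]
    ring
  · simp

end Slutsky

section Asymptotics

variable {𝒵 E Ω' Ω₀ : Type*} [MeasurableSpace 𝒵] [NormedAddCommGroup E] [InnerProductSpace ℝ E]
  [FiniteDimensional ℝ E] [MeasurableSpace E] [BorelSpace E] [MeasurableSpace Ω']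
  [MeasurableSpace Ω₀] {μ : Measure 𝒵} [IsProbabilityMeasure μ] {Θ : Set E} {θs : E}
  {ψ : E → 𝒵 → ℝ} {r C : ℝ} {B : 𝒵 → ℝ} {P' : Measure Ω'} [IsProbabilityMeasure P']
  {P₀ : Measure Ω₀} [IsProbabilityMeasure P₀] {Z : ℕ → Ω' → 𝒵} {W : E → ℝ}
  {A L : E →L[ℝ] E} {c : ℝ} {θhat : ℕ → Ω' → E} {ξ : Ω₀ → E}

namespace SmoothCriterion

theorem ae_tendsto_argmax_of_welfare (h : SmoothCriterion μ Θ θs ψ r C B) (hΘ : IsCompact Θ)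
    (hW : ∀ θ ∈ Θ, W θ = ∫ z, ψ θ z ∂μ) (hmax : ∀ θ ∈ Θ, θ ≠ θs → W θ < W θs)
    (hZ : ∀ i, HasLaw (Z i) μ P') (hind : iIndepFun Z P')
    (hθ : ∀ᵐ ω ∂P', ∀ n, θhat n ω ∈ Θ ∧ ∀ θ ∈ Θ,
      sampleMean (fun i => Z i ω) n (ψ θ) ≤ sampleMean (fun i => Z i ω) n (ψ (θhat n ω))) :
    ∀ᵐ ω ∂P', Tendsto (fun n => θhat n ω) atTop (𝓝 θs) := by
  refine h.ae_tendsto_argmax hΘ (fun θ hθΘ hne => ?_) hZ hind hθ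
  rw [← hW θ hθΘ, ← hW θs h.center_mem]
  exact hmax θ hθΘ hne

/-- The maximizer of the empirical criterion is asymptotically linear in the average score. -/
theorem tendstoInDistribution_argmax (h : SmoothCriterion μ Θ θs ψ r C B) (hΘ : IsCompact Θ)
    (hW : ∀ θ ∈ Θ, W θ = ∫ z, ψ θ z ∂μ) (hmax : ∀ θ ∈ Θ, θ ≠ θs → W θ < W θs)
    (hd : ∀ᶠ y in 𝓝 θs, DifferentiableAt ℝ W y) (hd' : DifferentiableAt ℝ (gradient W) θs)
    (hgrad : gradient W θs = 0) (hA : A = -fderiv ℝ (gradient W) θs)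
    (hsymm : ∀ u v, ⟪A u, v⟫ = ⟪u, A v⟫) (hAL : ∀ v, A (L v) = v) (hc : 0 < c)
    (hpos : ∀ u, c * ‖u‖ ^ 2 ≤ ⟪A u, u⟫)
    (hZ : ∀ i, HasLaw (Z i) μ P') (hind : iIndepFun Z P')
    (hθm : ∀ n, AEMeasurable (θhat n) P')
    (hθ : ∀ᵐ ω ∂P', ∀ n, θhat n ω ∈ Θ ∧ ∀ θ ∈ Θ,
      sampleMean (fun i => Z i ω) n (ψ θ) ≤ sampleMean (fun i => Z i ω) n (ψ (θhat n ω)))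
    (hξ : TendstoInDistribution (fun (n : ℕ) ω => √(n : ℝ) • sampleMean (fun i => Z i ω) n
      (fun z => gradient (fun θ' => ψ θ' z) θs)) atTop ξ (fun _ => P') P₀) :
    TendstoInDistribution (fun (n : ℕ) ω => √(n : ℝ) • (θhat n ω - θs)) atTop
      (fun ω => L (ξ ω)) (fun _ => P') P₀ := by
  refine tendstoInDistribution_of_ae_sub_le L hξ
    (fun n => ((hθm n).sub_const θs).const_smul _) ?_
  filter_upwards [h.ae_tendsto_argmax_of_welfare hΘ hW hmax hZ hind hθ,
    h.ae_sampleMean_expansion hZ hind, hθ,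
    ae_tendsto_sampleMean hZ hind (h.memLp_score.integrable one_le_two)] with ω h1 h2 h3 h4 η hη
  rw [h.integral_score_eq hW hd hd', hgrad] at h4
  have h5 := argmax_sub_newton_le (f := fun n u => sampleMean (fun i => Z i ω) n (ψ (θs + u)))
    (S := fun n => sampleMean (fun i => Z i ω) n (fun z => gradient (fun θ' => ψ θ' z) θs))
    (hn := fun n => θhat n ω - θs) hsymm hAL hc hpos h.pos h4
    (by simpa using h1.sub_const θs)
    (fun n u hu => by simpa using (h3 n).2 _ (h.ball_subset (add_mem_ball hu))) ?_ hη
  · filter_upwards [h5] with n hn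
    rw [map_smul, ← smul_sub, norm_smul, norm_smul, mul_left_comm]
    gcongr
  · intro ε hε
    obtain ⟨δ, hδ, hev⟩ := h2 ε hε
    refine ⟨δ, hδ, ?_⟩
    filter_upwards [hev] with n hn u hu
    have h6 := hn u hu
    rw [h.inner_integral_hessian_eq hW hd hd' u] at h6
    simp only [add_zero, hA, _root_.neg_apply, inner_neg_left]
    convert h6 using 2
    ring

/-- The regret of the maximizer is asymptotically the quadratic form of its estimation error. -/
theorem tendstoInDistribution_regret (h : SmoothCriterion μ Θ θs ψ r C B) (hΘ : IsCompact Θ)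
    (hW : ∀ θ ∈ Θ, W θ = ∫ z, ψ θ z ∂μ) (hmax : ∀ θ ∈ Θ, θ ≠ θs → W θ < W θs)
    (hd : ∀ᶠ y in 𝓝 θs, DifferentiableAt ℝ W y) (hd' : DifferentiableAt ℝ (gradient W) θs)
    (hgrad : gradient W θs = 0) (hA : A = -fderiv ℝ (gradient W) θs)
    (hZ : ∀ i, HasLaw (Z i) μ P') (hind : iIndepFun Z P')
    (hθm : ∀ n, AEMeasurable (θhat n) P')
    (hθ : ∀ᵐ ω ∂P', ∀ n, θhat n ω ∈ Θ ∧ ∀ θ ∈ Θ,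
      sampleMean (fun i => Z i ω) n (ψ θ) ≤ sampleMean (fun i => Z i ω) n (ψ (θhat n ω)))
    (hξ : TendstoInDistribution (fun (n : ℕ) ω => √(n : ℝ) • (θhat n ω - θs)) atTop
      ξ (fun _ => P') P₀) :
    TendstoInDistribution (fun (n : ℕ) ω => (n : ℝ) * (W θs - W (θhat n ω))) atTop
      (fun ω => 1 / 2 * ⟪A (ξ ω), ξ ω⟫) (fun _ => P') P₀ := by
  have hWm : ∀ n, AEMeasurable (fun ω => W (θhat n ω)) P' := by
    intro n
    have hcont : ContinuousOn W Θ := h.continuousOn_integral.congr hW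
    have hind : Measurable (Θ.indicator W) := by
      classical
      rw [← Set.piecewise_eq_indicator]
      exact hcont.measurable_piecewise continuousOn_const hΘ.measurableSet
    refine (hind.comp_aemeasurable (hθm n)).congr ?_
    filter_upwards [hθ] with ω hω
    exact Set.indicator_of_mem (hω n).1 W
  refine tendstoInDistribution_of_ae_sub_le_sq (q := fun y => 1 / 2 * ⟪A y, y⟫) (by fun_prop) hξ
    (fun n => ((hWm n).const_sub _).const_mul _) ?_
  filter_upwards [h.ae_tendsto_argmax_of_welfare hΘ hW hmax hZ hind hθ] with ω h1 η hη
  obtain ⟨δ, hδ, hexp⟩ := taylor_two_isLittleO hd hd' hη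
  filter_upwards [h1.eventually (Metric.ball_mem_nhds θs hδ)] with n hn
  have h2 := hexp (θhat n ω - θs) (by simpa [dist_eq_norm] using hn)
  rw [hgrad, inner_zero_left, sub_zero, add_sub_cancel] at h2
  have hn0 : (0 : ℝ) ≤ n := Nat.cast_nonneg n
  have e1 : √(n : ℝ) * √(n : ℝ) = n := Real.mul_self_sqrt hn0
  rw [norm_smul, mul_pow, Real.norm_of_nonneg (Real.sqrt_nonneg _), Real.sq_sqrt hn0, map_smul,
    real_inner_smul_left, real_inner_smul_right, ← mul_assoc (√(n : ℝ)), e1, hA,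
    _root_.neg_apply, inner_neg_left]
  set q := ⟪fderiv ℝ (gradient W) θs (θhat n ω - θs), θhat n ω - θs⟫
  have e2 : (n : ℝ) * (W θs - W (θhat n ω)) - 1 / 2 * ((n : ℝ) * -q)
      = -((n : ℝ) * (W (θhat n ω) - W θs - 1 / 2 * q)) := by ring
  rw [e2, abs_neg, abs_mul, abs_of_nonneg hn0, mul_left_comm]
  gcongr

end SmoothCriterion

end Asymptotics

/-! ### The multivariate central limit theorem -/

section CLT

variable {𝒵 Ω' Ω₀ : Type*} [MeasurableSpace 𝒵] [MeasurableSpace Ω'] [MeasurableSpace Ω₀]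
  {μ : Measure 𝒵} [IsProbabilityMeasure μ] {P' : Measure Ω'} [IsProbabilityMeasure P']
  {P₀ : Measure Ω₀} [IsProbabilityMeasure P₀] {Z : ℕ → Ω' → 𝒵} {d : ℕ}
  {s : 𝒵 → EuclideanSpace ℝ (Fin d)} {Γ : Matrix (Fin d) (Fin d) ℝ}

theorem memLp_coord {p : ℝ≥0∞} (hs : MemLp s p μ) (i : Fin d) : MemLp (fun z => s z i) p μ :=
  (EuclideanSpace.proj (𝕜 := ℝ) i).comp_memLp' hs

theorem dotProduct_secondMoment_mulVec (hs : MemLp s 2 μ)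
    (hΓ : ∀ i j, Γ i j = ∫ z, s z i * s z j ∂μ) (t : EuclideanSpace ℝ (Fin d)) :
    t.ofLp ⬝ᵥ Γ.mulVec t.ofLp = ∫ z, ⟪s z, t⟫ ^ 2 ∂μ := by
  have hi : ∀ i j, Integrable (fun z => s z i * s z j) μ := fun i j =>
    (memLp_coord hs i).integrable_mul (memLp_coord hs j)
  have e : ∀ z, ⟪s z, t⟫ ^ 2 = ∑ i, ∑ j, t i * (s z i * s z j) * t j := by
    intro z
    rw [PiLp.inner_apply, sq, Finset.sum_mul_sum]
    refine Finset.sum_congr rfl fun i _ => Finset.sum_congr rfl fun j _ => ?_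
    simp
    ring
  simp only [e]
  rw [integral_finsetSum _ fun i _ => integrable_finsetSum _ fun j _ =>
    ((hi i j).const_mul _).mul_const _]
  simp only [dotProduct, Matrix.mulVec, Finset.mul_sum]
  refine Finset.sum_congr rfl fun i _ => ?_
  rw [integral_finsetSum _ fun j _ => ((hi i j).const_mul _).mul_const _]
  refine Finset.sum_congr rfl fun j _ => ?_
  rw [integral_mul_const, integral_const_mul, hΓ]
  ring

theorem posSemidef_secondMoment (hs : MemLp s 2 μ)
    (hΓ : ∀ i j, Γ i j = ∫ z, s z i * s z j ∂μ) : Γ.PosSemidef := by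
  refine .of_dotProduct_mulVec_nonneg ?_ fun x => ?_
  · ext i j
    simp [hΓ, mul_comm]
  · have := dotProduct_secondMoment_mulVec hs hΓ (WithLp.toLp 2 x)
    rw [star_trivial, this]
    exact integral_nonneg fun z => sq_nonneg _

theorem charFun_map_inner {E : Type*} [NormedAddCommGroup E] [InnerProductSpace ℝ E]
    [MeasurableSpace E] [BorelSpace E] [SecondCountableTopology E] (ν : Measure E) (t : E) :
    charFun (ν.map fun x => ⟪x, t⟫) 1 = charFun ν t := by
  rw [charFun_apply, charFun_apply, integral_map (by fun_prop) (by fun_prop)]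
  simp

/-- By Lévy's continuity theorem, the one-dimensional central limit theorem for the projections of
`s` suffices. -/
theorem tendstoInDistribution_sqrt_smul_sampleMean (hs : MemLp s 2 μ) (hs0 : ∫ z, s z ∂μ = 0)
    (hΓ : ∀ i j, Γ i j = ∫ z, s z i * s z j ∂μ)
    (hZ : ∀ i, HasLaw (Z i) μ P') (hind : iIndepFun Z P')
    {ξ : Ω₀ → EuclideanSpace ℝ (Fin d)} (hξ : HasLaw ξ (multivariateGaussian 0 Γ) P₀) :
    TendstoInDistribution (fun (n : ℕ) ω => √(n : ℝ) • sampleMean (fun i => Z i ω) n s) atTop ξ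
      (fun _ => P') P₀ := by
  have hsm : AEMeasurable s μ := hs.1.aemeasurable
  have hsZ : ∀ i, AEMeasurable (fun ω => s (Z i ω)) P' := fun i =>
    (identDistrib_comp_of_hasLaw hZ hsm i).aemeasurable_fst
  have hXm : ∀ n : ℕ, AEMeasurable
      (fun ω => √(n : ℝ) • sampleMean (fun i => Z i ω) n s) P' := fun n =>
    AEMeasurable.fun_const_smul (AEMeasurable.fun_const_smul
      (Finset.aemeasurable_fun_sum _ fun i _ => hsZ i) _) _
  refine ⟨hXm, hξ.aemeasurable, ?_⟩
  refine ProbabilityMeasure.tendsto_iff_tendsto_charFun.2 fun t => ?_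
  have htm : AEMeasurable (fun z => ⟪s z, t⟫) μ := hsm.inner_const
  have hlp : MemLp (fun z => ⟪s z, t⟫) 2 μ := hs.inner_const t
  have hmean : ∫ z, ⟪s z, t⟫ ∂μ = 0 := by
    have := integral_inner (𝕜 := ℝ) (hs.integrable one_le_two) t
    rw [hs0, inner_zero_right] at this
    simpa only [real_inner_comm t] using this
  have hident := identDistrib_comp_of_hasLaw hZ htm
  have hlaw0 : P'.map (Z 0) = μ := (hZ 0).map_eq
  have hlp0 : MemLp (fun ω => ⟪s (Z 0 ω), t⟫) 2 P' := by
    refine MemLp.comp_of_map (f := Z 0) (g := fun z => ⟪s z, t⟫) ?_ (hZ 0).aemeasurable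
    rwa [hlaw0]
  have hmean0 : ∫ ω, ⟪s (Z 0 ω), t⟫ ∂P' = 0 :=
    ((hZ 0).integral_comp htm.aestronglyMeasurable).trans hmean
  have hvar0 : Var[fun ω => ⟪s (Z 0 ω), t⟫; P'] = t.ofLp ⬝ᵥ Γ.mulVec t.ofLp := by
    rw [variance_of_integral_eq_zero hlp0.1.aemeasurable hmean0,
      dotProduct_secondMoment_mulVec hs hΓ]
    exact (hZ 0).integral_comp (f := fun z => ⟪s z, t⟫ ^ 2) (htm.pow_const 2).aestronglyMeasurable
  have hclt := tendstoInDistribution_inv_sqrt_mul_sum_sub (P := P')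
    (X := fun i ω => ⟪s (Z i ω), t⟫) (HasLaw.id) hlp0 (iIndepFun_comp_of_hasLaw hZ hind htm) hident
  have hch := (ProbabilityMeasure.tendsto_iff_tendsto_charFun.1 hclt.tendsto) 1
  simp only [ProbabilityMeasure.coe_mk] at hch ⊢
  rw [hξ.map_eq, charFun_multivariateGaussian (posSemidef_secondMoment hs hΓ)]
  rw [Measure.map_id, charFun_gaussianReal, hvar0] at hch
  have hpsd : 0 ≤ t.ofLp ⬝ᵥ Γ.mulVec t.ofLp := by
    rw [dotProduct_secondMoment_mulVec hs hΓ]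
    exact integral_nonneg fun z => sq_nonneg _
  convert hch using 2
  · rename_i n
    rw [← charFun_map_inner, AEMeasurable.map_map_of_aemeasurable (by fun_prop) (hXm n)]
    congr 2
    funext ω
    simp only [Function.comp, sampleMean, real_inner_smul_left, sum_inner, hmean0, mul_zero,
      sub_zero]
    rw [← mul_assoc]
    congr 1
    rcases Nat.eq_zero_or_pos n with rfl | hn
    · simp
    · have : (0 : ℝ) < n := Nat.cast_pos.2 hn
      rw [← div_eq_mul_inv, ← one_div, div_eq_div_iff this.ne' (by positivity), one_mul,
        Real.mul_self_sqrt this.le]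
  · simp [Real.coe_toNNReal _ hpsd]

end CLT

/-! ### Gaussian quadratic forms -/

section Moments

theorem integral_pow_four_gaussianReal : ∫ x, x ^ 4 ∂(gaussianReal 0 1) = 3 := by
  have hderiv : ∀ (p p' : ℝ → ℝ), (∀ t, HasDerivAt p (p' t) t) →
      deriv (fun t => p t * Real.exp (t ^ 2 / 2)) =
        fun t => (p' t + p t * t) * Real.exp (t ^ 2 / 2) := by
    intro p p' hp
    funext t
    have h1 : HasDerivAt (fun t : ℝ => Real.exp (t ^ 2 / 2)) (Real.exp (t ^ 2 / 2) * t) t := by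
      refine HasDerivAt.exp ?_
      refine ((hasDerivAt_pow 2 t).div_const 2).congr_deriv ?_
      norm_num
    rw [((hp t).fun_mul h1).deriv]
    ring
  have h := iteratedDeriv_mgf_zero (X := id) (μ := gaussianReal 0 1) (by simp) 4
  have hm : mgf id (gaussianReal 0 1) = fun t => 1 * Real.exp (t ^ 2 / 2) := by
    rw [mgf_id_gaussianReal]
    funext t
    simp
  rw [hm, iteratedDeriv_succ', hderiv (fun _ => 1) (fun _ => 0) (fun t => hasDerivAt_const t 1),
    iteratedDeriv_succ', hderiv (fun t => 0 + 1 * t) (fun _ => 1)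
      (fun t => (((hasDerivAt_id' t).const_mul 1).const_add 0).congr_deriv (by norm_num)),
    iteratedDeriv_succ', hderiv (fun t => 1 + (0 + 1 * t) * t) (fun t => 2 * t) (fun t => by
      have := ((hasDerivAt_pow 2 t)).const_add 1
      refine (this.congr_of_eventuallyEq (Eventually.of_forall fun x => ?_)).congr_deriv ?_
      · simp only []; ring
      · norm_num),
    iteratedDeriv_succ', hderiv (fun t => 2 * t + (1 + (0 + 1 * t) * t) * t)
      (fun t => 3 + 3 * t ^ 2) (fun t => by
      have := ((hasDerivAt_pow 3 t)).add ((hasDerivAt_id t).const_mul 3)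
      refine (this.congr_of_eventuallyEq (Eventually.of_forall fun x => ?_)).congr_deriv ?_
      · simp; ring
      · norm_num; ring)] at h
  simpa using h.symm

theorem memLp_sq_gaussianReal : MemLp (fun x : ℝ => x ^ 2) 2 (gaussianReal 0 1) := by
  have h4 : MemLp (id : ℝ → ℝ) 4 (gaussianReal 0 1) := memLp_id_gaussianReal 4
  have := MemLp.mul (p := 4) (q := 4) (r := 2) h4 h4 (hpqr := ⟨by
    rw [← two_mul, show (4 : ℝ≥0∞) = 2 * 2 by norm_num,
      ENNReal.mul_inv (Or.inl (by simp)) (Or.inl (by simp)), ← mul_assoc,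
      ENNReal.mul_inv_cancel (by simp) (by simp), one_mul]⟩)
  refine (memLp_congr_ae (ae_of_all _ fun x => ?_)).1 this
  simp [sq]

theorem integral_sq_gaussianReal : ∫ x, x ^ 2 ∂(gaussianReal 0 1) = 1 := by
  have h := variance_of_integral_eq_zero (X := fun x : ℝ => x) (μ := gaussianReal 0 1)
    (by fun_prop) (by simp)
  rw [variance_fun_id_gaussianReal] at h
  simpa using h.symm

theorem variance_sq_gaussianReal : Var[fun x : ℝ => x ^ 2; gaussianReal 0 1] = 2 := by
  have h := variance_eq_sub memLp_sq_gaussianReal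
  rw [h, integral_sq_gaussianReal]
  have : ∫ x, ((fun x : ℝ => x ^ 2) ^ 2) x ∂(gaussianReal 0 1) = 3 := by
    rw [← integral_pow_four_gaussianReal]
    congr with x
    simp only [Pi.pow_apply]
    ring
  rw [this]
  norm_num

variable {d : ℕ} (lam : Fin d → ℝ)

theorem memLp_eval_sq_pi (i : Fin d) :
    MemLp (fun x : Fin d → ℝ => x i ^ 2) 2 (Measure.pi fun _ => gaussianReal 0 1) :=
  memLp_sq_gaussianReal.comp_measurePreserving (measurePreserving_eval _ i)

theorem memLp_weighted_sq : MemLp (fun x : Fin d → ℝ => 1 / 2 * ∑ j, lam j * x j ^ 2) 2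
    (Measure.pi fun _ => gaussianReal 0 1) :=
  (memLp_finsetSum _ fun i _ => (memLp_eval_sq_pi i).const_mul (lam i)).const_mul _

theorem integral_weighted_sq : ∫ x : Fin d → ℝ, 1 / 2 * ∑ j, lam j * x j ^ 2
    ∂(Measure.pi fun _ => gaussianReal 0 1) = 1 / 2 * ∑ j, lam j := by
  rw [integral_const_mul, integral_finsetSum _ fun i _ =>
    ((memLp_eval_sq_pi i).integrable one_le_two).const_mul (lam i)]
  congr 1
  refine Finset.sum_congr rfl fun i _ => ?_
  rw [integral_const_mul]
  have h2 : ∫ x : Fin d → ℝ, x i ^ 2 ∂(Measure.pi fun _ => gaussianReal 0 1) = 1 := by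
    have h := measurePreserving_eval (fun _ : Fin d => gaussianReal 0 1) i
    have h3 := integral_map (μ := Measure.pi fun _ : Fin d => gaussianReal 0 1)
      h.measurable.aemeasurable (f := fun x : ℝ => x ^ 2) (by fun_prop)
    rw [h.map_eq, integral_sq_gaussianReal] at h3
    exact h3.symm
  rw [h2, mul_one]

theorem variance_weighted_sq : Var[fun x : Fin d → ℝ => 1 / 2 * ∑ j, lam j * x j ^ 2;
    Measure.pi fun _ => gaussianReal 0 1] = 1 / 2 * ∑ j, lam j ^ 2 := by
  rw [variance_const_mul]
  have h := variance_sum_pi (μ := fun _ : Fin d => gaussianReal 0 1)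
    (X := fun i (x : ℝ) => lam i * x ^ 2) (fun i => memLp_sq_gaussianReal.const_mul (lam i))
  have e : (∑ i, fun ω : Fin d → ℝ => lam i * ω i ^ 2) =
      fun x : Fin d → ℝ => ∑ j, lam j * x j ^ 2 := by
    funext x
    simp
  rw [e] at h
  rw [h]
  simp only [variance_const_mul, variance_sq_gaussianReal, Finset.mul_sum]
  refine Finset.sum_congr rfl fun i _ => ?_
  ring

end Moments

section QuadForm

open scoped MatrixOrder
open Matrix

variable {d : ℕ} {H V : Matrix (Fin d) (Fin d) ℝ}

theorem map_toEuclideanCLM_multivariateGaussian (L : Matrix (Fin d) (Fin d) ℝ)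
    (hV : V.PosSemidef) :
    (multivariateGaussian 0 V).map (toEuclideanCLM (𝕜 := ℝ) L)
      = multivariateGaussian 0 (L * V * Lᵀ) := by
  have hLV : (L * V * Lᵀ).PosSemidef := by
    simpa [conjTranspose_eq_transpose_of_trivial] using hV.mul_mul_conjTranspose_same L
  refine Measure.ext_of_charFun ?_
  funext t
  have h1 : charFun ((multivariateGaussian 0 V).map (toEuclideanCLM (𝕜 := ℝ) L)) t
      = charFun (multivariateGaussian 0 V) (toEuclideanCLM (𝕜 := ℝ) Lᵀ t) := by
    rw [charFun_apply, charFun_apply, integral_map (by fun_prop) (by fun_prop)]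
    congr with x
    congr 3
    rw [real_inner_comm, inner_toEuclideanCLM, inner_toEuclideanCLM, dotProduct_mulVec,
      mulVec_transpose, dotProduct_comm]
  rw [h1, charFun_multivariateGaussian hV, charFun_multivariateGaussian hLV]
  congr 1
  simp only [inner_zero_right, ofLp_toEuclideanCLM]
  rw [← mulVec_mulVec, ← mulVec_mulVec, dotProduct_mulVec _ L, ← mulVec_transpose]

theorem hasLaw_add_multivariateGaussian {Ω₀ : Type*} [MeasurableSpace Ω₀] {ρ : Measure Ω₀}
    [IsProbabilityMeasure ρ] {G U : Ω₀ → EuclideanSpace ℝ (Fin d)}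
    {V' : Matrix (Fin d) (Fin d) ℝ} (hV : V.PosSemidef) (hV' : V'.PosSemidef)
    (hG : HasLaw G (multivariateGaussian 0 V) ρ) (hU : HasLaw U (multivariateGaussian 0 V') ρ)
    (hGU : IndepFun G U ρ) :
    HasLaw (fun ω => G ω + U ω) (multivariateGaussian 0 (V + V')) ρ := by
  refine ⟨hG.aemeasurable.add hU.aemeasurable, ?_⟩
  refine Measure.ext_of_charFun ?_
  rw [hGU.charFun_map_fun_add_eq_mul hG.aemeasurable hU.aemeasurable, hG.map_eq, hU.map_eq]
  funext t
  rw [Pi.mul_apply, charFun_multivariateGaussian hV, charFun_multivariateGaussian hV',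
    charFun_multivariateGaussian (hV.add hV'), ← Complex.exp_add]
  congr 1
  simp [add_mulVec, dotProduct_add]
  ring

theorem sqrt_mul_sqrt (hH : H.PosDef) : CFC.sqrt H * CFC.sqrt H = H :=
  CFC.sqrt_mul_sqrt_self H hH.posSemidef.nonneg

theorem transpose_sqrt (H : Matrix (Fin d) (Fin d) ℝ) : (CFC.sqrt H)ᵀ = CFC.sqrt H := by
  have h := (nonneg_iff_posSemidef.1 (CFC.sqrt_nonneg H)).isHermitian
  rwa [IsHermitian, conjTranspose_eq_transpose_of_trivial] at h

theorem isUnit_det_sqrt (hH : H.PosDef) : IsUnit (CFC.sqrt H).det := by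
  have h : (CFC.sqrt H).det * (CFC.sqrt H).det = H.det := by rw [← det_mul, sqrt_mul_sqrt hH]
  have h2 := hH.det_pos
  rw [isUnit_iff_ne_zero]
  intro h0
  rw [h0, mul_zero] at h
  exact h2.ne h

theorem posSemidef_sqrtConj (hV : V.PosSemidef) : (sqrtConj H V).PosSemidef := by
  have := hV.mul_mul_conjTranspose_same (CFC.sqrt H)
  rwa [conjTranspose_eq_transpose_of_trivial, transpose_sqrt] at this

theorem sqrtConj_add (V V' : Matrix (Fin d) (Fin d) ℝ) :
    sqrtConj H (V + V') = sqrtConj H V + sqrtConj H V' := by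
  simp [sqrtConj, mul_add, add_mul]

theorem sqrtConj_eq_zero (hH : H.PosDef) (h : sqrtConj H V = 0) : V = 0 := by
  have hu := isUnit_det_sqrt hH
  have : (CFC.sqrt H)⁻¹ * sqrtConj H V * (CFC.sqrt H)⁻¹ = V := by
    rw [sqrtConj, mul_assoc, mul_assoc, mul_nonsing_inv _ hu, mul_one, ← mul_assoc,
      nonsing_inv_mul _ hu, one_mul]
  rw [← this, h, mul_zero, zero_mul]

/-- A square root `B` of `V` that diagonalises the quadratic form of `H`. -/
theorem exists_simultaneous_diagonalization (hH : H.PosDef) (hV : V.PosSemidef)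
    (h : (sqrtConj H V).IsHermitian) :
    ∃ B : Matrix (Fin d) (Fin d) ℝ, B * Bᵀ = V ∧ Bᵀ * H * B = diagonal h.eigenvalues := by
  set K := CFC.sqrt H with hK
  have hu := isUnit_det_sqrt hH
  have hKT : Kᵀ = K := transpose_sqrt H
  have hKK : K * K = H := sqrt_mul_sqrt hH
  have hKi : (K⁻¹)ᵀ = K⁻¹ := by rw [transpose_nonsing_inv, hKT]
  set Q : Matrix (Fin d) (Fin d) ℝ := (h.eigenvectorUnitary : Matrix (Fin d) (Fin d) ℝ)
  have hQ : Qᵀ * Q = 1 := by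
    have := (Matrix.mem_unitaryGroup_iff' (A := Q)).1 h.eigenvectorUnitary.2
    rwa [star_eq_conjTranspose, conjTranspose_eq_transpose_of_trivial] at this
  have hspec : sqrtConj H V = Q * diagonal h.eigenvalues * Qᵀ := by
    have := h.spectral_theorem
    rw [Unitary.conjStarAlgAut_apply] at this
    simpa [star_eq_conjTranspose, conjTranspose_eq_transpose_of_trivial, Function.comp_def]
      using this
  have hnonneg : ∀ i, 0 ≤ h.eigenvalues i := (posSemidef_sqrtConj hV).eigenvalues_nonneg
  set D : Matrix (Fin d) (Fin d) ℝ := diagonal fun i => √(h.eigenvalues i)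
  have hDD : D * D = diagonal h.eigenvalues := by
    simp only [D, diagonal_mul_diagonal]
    congr with i
    exact Real.mul_self_sqrt (hnonneg i)
  have hDT : Dᵀ = D := diagonal_transpose _
  have hK1 : K⁻¹ * K = 1 := nonsing_inv_mul _ hu
  have hK2 : K * K⁻¹ = 1 := mul_nonsing_inv _ hu
  refine ⟨K⁻¹ * Q * D, ?_, ?_⟩
  · rw [transpose_mul, transpose_mul, hKi, hDT]
    calc K⁻¹ * Q * D * (D * (Qᵀ * K⁻¹)) = K⁻¹ * (Q * (D * D) * Qᵀ) * K⁻¹ := by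
          simp only [mul_assoc]
      _ = K⁻¹ * (K * V * K) * K⁻¹ := by rw [hDD, ← hspec, sqrtConj]
      _ = (K⁻¹ * K) * V * (K * K⁻¹) := by simp only [mul_assoc]
      _ = V := by rw [hK1, hK2, one_mul, mul_one]
  · rw [transpose_mul, transpose_mul, hKi, hDT]
    calc D * (Qᵀ * K⁻¹) * H * (K⁻¹ * Q * D)
        = D * (Qᵀ * K⁻¹) * (K * K) * (K⁻¹ * Q * D) := by rw [hKK]
      _ = D * Qᵀ * (K⁻¹ * K) * (K * K⁻¹) * Q * D := by simp only [mul_assoc]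
      _ = D * (Qᵀ * Q) * D := by rw [hK1, hK2, mul_one, mul_one, mul_assoc D]
      _ = _ := by rw [hQ, mul_one, hDD]

/-- A Gaussian quadratic form is a weighted sum of squares of independent standard Gaussians. -/
theorem identDistrib_halfQuad (hH : H.PosDef) (hV : V.PosSemidef)
    (h : (sqrtConj H V).IsHermitian) {Ω₀ : Type*} [MeasurableSpace Ω₀] {P₀ : Measure Ω₀}
    {ξ : Ω₀ → EuclideanSpace ℝ (Fin d)} (hξ : HasLaw ξ (multivariateGaussian 0 V) P₀) :
    IdentDistrib (fun ω => halfQuad H (ξ ω))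
      (fun x : Fin d → ℝ => 1 / 2 * ∑ j, h.eigenvalues j * x j ^ 2) P₀
      (Measure.pi fun _ => gaussianReal 0 1) := by
  obtain ⟨B, hB1, hB2⟩ := exists_simultaneous_diagonalization hH hV h
  have hlaw : HasLaw (fun x : Fin d → ℝ => toEuclideanCLM (𝕜 := ℝ) B (WithLp.toLp 2 x))
      (multivariateGaussian 0 V) (Measure.pi fun _ => gaussianReal 0 1) := by
    refine ⟨by fun_prop, ?_⟩
    have := map_toEuclideanCLM_multivariateGaussian B (PosSemidef.one (n := Fin d) (R := ℝ))
    rw [mul_one, hB1, multivariateGaussian_zero_one, ← map_pi_eq_stdGaussian,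
      Measure.map_map (by fun_prop) (by fun_prop)] at this
    exact this
  have hq : Continuous (halfQuad H) := by
    unfold halfQuad
    simp only [← inner_toEuclideanCLM]
    fun_prop
  refine (((hξ.identDistrib hlaw).comp hq.measurable)).trans (IdentDistrib.of_ae_eq ?_ ?_)
  · exact (hq.measurable.comp (by fun_prop)).aemeasurable
  · refine ae_of_all _ fun x => ?_
    simp only [Function.comp, halfQuad, toEuclideanCLM_toLp]
    congr 1
    have : (B *ᵥ x) ⬝ᵥ H *ᵥ B *ᵥ x = x ⬝ᵥ (Bᵀ * H * B) *ᵥ x := by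
      rw [← mulVec_mulVec, ← mulVec_mulVec, dotProduct_mulVec x, vecMul_transpose]
    rw [this, hB2]
    simp only [dotProduct, mulVec_diagonal]
    refine Finset.sum_congr rfl fun i _ => ?_
    ring

theorem trace_mul_self_eq_sum_eigenvalues_sq {A : Matrix (Fin d) (Fin d) ℝ}
    (h : A.IsHermitian) : (A * A).trace = ∑ j, h.eigenvalues j ^ 2 := by
  set Q : Matrix (Fin d) (Fin d) ℝ := (h.eigenvectorUnitary : Matrix (Fin d) (Fin d) ℝ)
  have hQ : Qᵀ * Q = 1 := by
    have := (Matrix.mem_unitaryGroup_iff' (A := Q)).1 h.eigenvectorUnitary.2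
    rwa [star_eq_conjTranspose, conjTranspose_eq_transpose_of_trivial] at this
  have hspec : A = Q * diagonal h.eigenvalues * Qᵀ := by
    have := h.spectral_theorem
    rw [Unitary.conjStarAlgAut_apply] at this
    simpa [star_eq_conjTranspose, conjTranspose_eq_transpose_of_trivial, Function.comp_def]
      using this
  set D := diagonal h.eigenvalues
  calc (A * A).trace = (Q * (D * (Qᵀ * Q) * D) * Qᵀ).trace := by
        conv_lhs => rw [hspec]
        simp only [mul_assoc]
    _ = (Q * (D * D) * Qᵀ).trace := by rw [hQ, mul_one]
    _ = (Qᵀ * Q * (D * D)).trace := by rw [trace_mul_comm, ← mul_assoc]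
    _ = _ := by
        rw [hQ, one_mul, diagonal_mul_diagonal, trace_diagonal]
        simp only [sq]

section

variable {Ω₀ : Type*} [MeasurableSpace Ω₀] {P₀ : Measure Ω₀} {ξ : Ω₀ → EuclideanSpace ℝ (Fin d)}

theorem memLp_halfQuad (hH : H.PosDef) (hV : V.PosSemidef)
    (hξ : HasLaw ξ (multivariateGaussian 0 V) P₀) :
    MemLp (fun ω => halfQuad H (ξ ω)) 2 P₀ :=
  (identDistrib_halfQuad hH hV (posSemidef_sqrtConj hV).isHermitian hξ).memLp_iff.2
    (memLp_weighted_sq _)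

theorem integral_halfQuad (hH : H.PosDef) (hV : V.PosSemidef)
    (hξ : HasLaw ξ (multivariateGaussian 0 V) P₀) :
    ∫ ω, halfQuad H (ξ ω) ∂P₀ = 1 / 2 * (sqrtConj H V).trace := by
  have h := (posSemidef_sqrtConj (H := H) hV).isHermitian
  rw [(identDistrib_halfQuad hH hV h hξ).integral_eq, integral_weighted_sq,
    h.trace_eq_sum_eigenvalues]
  rfl

theorem variance_halfQuad (hH : H.PosDef) (hV : V.PosSemidef) (h : (sqrtConj H V).IsHermitian)
    (hξ : HasLaw ξ (multivariateGaussian 0 V) P₀) :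
    Var[fun ω => halfQuad H (ξ ω); P₀] = 1 / 2 * ∑ j, h.eigenvalues j ^ 2 := by
  rw [(identDistrib_halfQuad hH hV h hξ).variance_eq, variance_weighted_sq]

end

theorem trace_mul_nonneg_of_posSemidef {A A' : Matrix (Fin d) (Fin d) ℝ} (hA : A.PosSemidef)
    (hA' : A'.PosSemidef) : 0 ≤ (A * A').trace := by
  set K := CFC.sqrt A
  have hKK : K * K = A := CFC.sqrt_mul_sqrt_self A hA.nonneg
  have hKT : Kᵀ = K := transpose_sqrt A
  have := (hA'.mul_mul_conjTranspose_same K).trace_nonneg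
  rwa [conjTranspose_eq_transpose_of_trivial, hKT, trace_mul_comm, ← mul_assoc, hKK] at this

/-- Adding a nonzero positive semidefinite covariance increases mean and variance of the quadratic
form: `tr (A + A')² - tr A² = 2 tr (A A') + tr A'²`. -/
theorem halfQuad_moments_lt (hH : H.PosDef) {V' : Matrix (Fin d) (Fin d) ℝ} (hV : V.PosSemidef)
    (hV' : V'.PosSemidef) (hne : V' ≠ 0) {Ω₀ : Type*} [MeasurableSpace Ω₀] {P₀ : Measure Ω₀}
    {ξ ζ : Ω₀ → EuclideanSpace ℝ (Fin d)} (hξ : HasLaw ξ (multivariateGaussian 0 V) P₀)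
    (hζ : HasLaw ζ (multivariateGaussian 0 (V + V')) P₀) :
    ∫ ω, halfQuad H (ξ ω) ∂P₀ < ∫ ω, halfQuad H (ζ ω) ∂P₀ ∧
      Var[fun ω => halfQuad H (ξ ω); P₀] < Var[fun ω => halfQuad H (ζ ω); P₀] := by
  set A := sqrtConj H V
  set A' := sqrtConj H V' with hA'def
  have hA : A.PosSemidef := posSemidef_sqrtConj hV
  have hA' : A'.PosSemidef := posSemidef_sqrtConj hV'
  have hne' : A' ≠ 0 := fun h0 => hne (sqrtConj_eq_zero hH h0)
  constructor
  · rw [integral_halfQuad hH hV hξ, integral_halfQuad hH (hV.add hV') hζ, sqrtConj_add, trace_add]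
    have h1 : 0 < A'.trace :=
      lt_of_le_of_ne hA'.trace_nonneg fun h0 => hne' (hA'.trace_eq_zero_iff.1 h0.symm)
    change 1 / 2 * A.trace < 1 / 2 * (A.trace + A'.trace)
    linarith
  · have hs := (posSemidef_sqrtConj (H := H) (hV.add hV')).isHermitian
    rw [variance_halfQuad hH hV hA.isHermitian hξ, variance_halfQuad hH (hV.add hV') hs hζ,
      ← trace_mul_self_eq_sum_eigenvalues_sq, ← trace_mul_self_eq_sum_eigenvalues_sq,
      sqrtConj_add]
    change 1 / 2 * (A * A).trace < 1 / 2 * ((A + A') * (A + A')).trace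
    have h1 : 0 < (A' * A').trace := by
      have hT : A'ᴴ = A' := hA'.isHermitian
      have h2 : 0 ≤ (A' * A').trace := trace_mul_nonneg_of_posSemidef hA' hA'
      refine lt_of_le_of_ne h2 fun h0 => hne' ?_
      rw [← trace_conjTranspose_mul_self_eq_zero_iff, hT]
      exact h0.symm
    have h3 := trace_mul_nonneg_of_posSemidef hA hA'
    have h4 : (A' * A).trace = (A * A').trace := trace_mul_comm _ _
    rw [add_mul, mul_add, mul_add, trace_add, trace_add, trace_add, h4]
    linarith

end QuadForm

/-! ### Causal identification of the welfare -/

namespace PolicyModel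

variable {Ω : Type*} [MeasurableSpace Ω] {k d : ℕ} {𝓣 : Set ℝ}
  {𝓧 : Set (EuclideanSpace ℝ (Fin k))} (M : PolicyModel Ω 𝓣 𝓧 d)

instance : IsProbabilityMeasure (M.P.map M.X) :=
  Measure.isProbabilityMeasure_map M.measurable_X.aemeasurable

theorem measurable_XT : Measurable fun ω => (M.X ω, M.T ω) := M.measurable_X.prodMk M.measurable_T

theorem measurable_f_swap : Measurable fun p : 𝓧 × 𝓣 => M.f p.2 p.1 :=
  M.measurable_f.comp measurable_swap

theorem measurable_Yobs : Measurable M.Yobs :=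
  M.measurable_Y.comp (M.measurable_T.prodMk measurable_id)

theorem measurable_Y_apply (t : 𝓣) : Measurable (M.Y t) :=
  M.measurable_Y.comp measurable_prodMk_left

theorem map_XT_absolutelyContinuous :
    M.P.map (fun ω => (M.X ω, M.T ω)) ≪ (M.P.map M.X).prod M.ν := by
  rw [M.isCondDensity_f]
  exact withDensity_absolutelyContinuous _ _

/-- `f` is the density of `(X, T)` with respect to the product of the law of `X` and `dt`. -/
theorem integral_XT {F : Type*} [NormedAddCommGroup F] [NormedSpace ℝ F] {g : 𝓧 × 𝓣 → F}
    (hg : AEStronglyMeasurable g ((M.P.map M.X).prod M.ν)) :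
    ∫ ω, g (M.X ω, M.T ω) ∂M.P = ∫ p, M.f p.2 p.1 • g p ∂((M.P.map M.X).prod M.ν) := by
  rw [← integral_map M.measurable_XT.aemeasurable (hg.mono_ac M.map_XT_absolutelyContinuous),
    M.isCondDensity_f, integral_withDensity_eq_integral_toReal_smul
      M.measurable_f_swap.ennreal_ofReal (ae_of_all _ fun _ => ENNReal.ofReal_lt_top)]
  simp only [ENNReal.toReal_ofReal (M.f_nonneg _ _)]

theorem integrable_XT_iff {F : Type*} [NormedAddCommGroup F] [NormedSpace ℝ F] {g : 𝓧 × 𝓣 → F}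
    (hg : AEStronglyMeasurable g ((M.P.map M.X).prod M.ν)) :
    Integrable (fun ω => g (M.X ω, M.T ω)) M.P ↔
      Integrable (fun p => M.f p.2 p.1 • g p) ((M.P.map M.X).prod M.ν) := by
  have h1 := integrable_map_measure (hg.mono_ac M.map_XT_absolutelyContinuous)
    M.measurable_XT.aemeasurable
  rw [M.isCondDensity_f, integrable_withDensity_iff_integrable_smul'
      M.measurable_f_swap.ennreal_ofReal (ae_of_all _ fun _ => ENNReal.ofReal_lt_top)] at h1
  simp only [ENNReal.toReal_ofReal (M.f_nonneg _ _)] at h1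
  exact h1.symm

theorem measurePreserving_XT_prod :
    MeasurePreserving (fun p : Ω × 𝓣 => (M.X p.1, p.2)) (M.P.prod M.ν)
      ((M.P.map M.X).prod M.ν) :=
  (M.measurable_X.measurePreserving M.P).prod (MeasurePreserving.id M.ν)

theorem measurable_pol_apply {θ : EuclideanSpace ℝ (Fin d)} (hθ : θ ∈ M.Θ) :
    Measurable fun p : 𝓧 × 𝓣 => M.pol θ p.2 p.1 :=
  M.measurable_pol.comp (g := fun q : M.Θ × 𝓣 × 𝓧 => M.pol q.1 q.2.1 q.2.2)
    (f := fun p : 𝓧 × 𝓣 => ((⟨θ, hθ⟩ : M.Θ), p.2, p.1)) (by fun_prop)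

theorem integrable_pol {θ : EuclideanSpace ℝ (Fin d)} (hθ : θ ∈ M.Θ) :
    Integrable (fun p : 𝓧 × 𝓣 => M.pol θ p.2 p.1) ((M.P.map M.X).prod M.ν) := by
  have hm := M.measurable_pol_apply hθ
  refine ⟨hm.aestronglyMeasurable, ?_⟩
  rw [hasFiniteIntegral_iff_ofReal (ae_of_all _ fun p => M.pol_nonneg θ hθ _ _),
    lintegral_prod _ hm.ennreal_ofReal.aemeasurable]
  simp [M.lintegral_pol θ hθ]

end PolicyModel

section PullOut

variable {Ω α : Type*} [MeasurableSpace Ω] [MeasurableSpace α] {P : Measure Ω}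
  [IsProbabilityMeasure P]

theorem integral_mul_eq_integral_mul_condExp {Ω : Type*} {m m₀ : MeasurableSpace Ω}
    {P : Measure[m₀] Ω} [IsProbabilityMeasure P] {f g : Ω → ℝ} (hm : m ≤ m₀)
    (hg : AEStronglyMeasurable[m] g P)
    (hfg : Integrable (fun ω => g ω * f ω) P) (hf : Integrable f P) :
    ∫ ω, g ω * f ω ∂P = ∫ ω, g ω * P[f | m] ω ∂P := by
  rw [← integral_condExp hm (f := fun ω => g ω * f ω)]
  exact integral_congr_ae (condExp_mul_of_aestronglyMeasurable_left hg hfg hf)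

theorem integral_mul_eq_integral_mul_condDistrib {X : Ω → α} {Y : Ω → ℝ} {g : α → ℝ}
    (hX : Measurable X) (hg : Measurable g) (hfg : Integrable (fun ω => g (X ω) * Y ω) P)
    (hY : Integrable Y P) :
    ∫ ω, g (X ω) * Y ω ∂P = ∫ ω, g (X ω) * ∫ y, y ∂(condDistrib Y X P (X ω)) ∂P := by
  rw [integral_mul_eq_integral_mul_condExp (g := fun ω => g (X ω)) hX.comap_le
    (hg.stronglyMeasurable.comp_measurable (comap_measurable X)).aestronglyMeasurable hfg hY]
  refine integral_congr_ae ?_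
  filter_upwards [condExp_ae_eq_integral_condDistrib' hX hY] with ω hω
  rw [hω]

end PullOut

namespace PolicyModel

variable {Ω : Type*} [MeasurableSpace Ω] [StandardBorelSpace Ω] {k d : ℕ} {𝓣 : Set ℝ}
  {𝓧 : Set (EuclideanSpace ℝ (Fin k))} (M : PolicyModel Ω 𝓣 𝓧 d)

/-- Identification of a single potential outcome: given `X`, the weight `w (X, T)` and `Y c` are
independent. -/
theorem integral_weight_mul_potentialOutcome (h𝓣 : MeasurableSet 𝓣) (hunc : M.Unconfounded)
    (c : 𝓣) {B : ℝ} (hB : ∀ᵐ ω ∂M.P, |M.Y c ω| ≤ B) {w : 𝓧 × 𝓣 → ℝ} (hw : Measurable w)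
    (hint : Integrable (fun p : 𝓧 × 𝓣 => M.f p.2 p.1 * w p) ((M.P.map M.X).prod M.ν)) :
    ∫ ω, w (M.X ω, M.T ω) * M.Y c ω ∂M.P
      = ∫ p : Ω × 𝓣, M.f p.2 (M.X p.1) * w (M.X p.1, p.2) * M.Y c p.1 ∂(M.P.prod M.ν) := by
  have : StandardBorelSpace 𝓣 := h𝓣.standardBorel
  have : Nonempty 𝓣 := ⟨c⟩
  have hYm := M.measurable_Y_apply c
  have hYint : Integrable (M.Y c) M.P :=
    (integrable_const B).mono' hYm.aestronglyMeasurable hB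
  let η : 𝓧 → ℝ := fun x => ∫ y, y ∂(condDistrib (M.Y c) M.X M.P x)
  have hη : StronglyMeasurable η :=
    StronglyMeasurable.integral_condDistrib (f := fun p : 𝓧 × ℝ => p.2) (by fun_prop)
  let γ : 𝓧 → ℝ := fun x => ∫ t, M.f t x * w (x, t) ∂M.ν
  have hfw : Measurable fun p : 𝓧 × 𝓣 => M.f p.2 p.1 * w p := M.measurable_f_swap.mul hw
  have hγ : StronglyMeasurable γ :=
    StronglyMeasurable.integral_prod_right' (f := fun p : 𝓧 × 𝓣 => M.f p.2 p.1 * w p)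
      hfw.stronglyMeasurable
  have hγint : Integrable (fun ω => γ (M.X ω)) M.P :=
    hint.integral_prod_left.comp_measurable M.measurable_X
  have hci := (condIndepFun_iff_condDistrib_prod_ae_eq_prodMkRight hYm M.measurable_T
    M.measurable_X).1 (hunc c).symm
  have hwint : Integrable (fun ω => w (M.X ω, M.T ω)) M.P :=
    (M.integrable_XT_iff hw.aestronglyMeasurable).2 hint
  have hbdd : ∀ {g : Ω → ℝ}, Integrable g M.P → Integrable (fun ω => g ω * M.Y c ω) M.P :=
    fun hg => hg.mul_bdd (c := B) hYm.aestronglyMeasurable hB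
  -- condition on `(X, T)`, use the conditional independence, and undo the conditioning on `X`
  have e1 : ∫ ω, w (M.X ω, M.T ω) * M.Y c ω ∂M.P
      = ∫ ω, w (M.X ω, M.T ω) * η (M.X ω) ∂M.P := by
    rw [integral_mul_eq_integral_mul_condDistrib M.measurable_XT hw (hbdd hwint) hYint]
    refine integral_congr_ae ?_
    filter_upwards [ae_of_ae_map M.measurable_XT.aemeasurable hci] with ω hω
    rw [hω, Kernel.prodMkRight_apply]
  have hηb : ∀ᵐ ω ∂M.P, |η (M.X ω)| ≤ B := by
    filter_upwards [ae_bdd_abs_condExp_of_ae_bdd_abs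
      (m := MeasurableSpace.comap M.X inferInstance) hB,
      condExp_ae_eq_integral_condDistrib' M.measurable_X hYint] with ω h1 h2
    rwa [h2] at h1
  have e2 : ∫ ω, w (M.X ω, M.T ω) * η (M.X ω) ∂M.P = ∫ ω, γ (M.X ω) * η (M.X ω) ∂M.P := by
    have hm : Measurable fun p : 𝓧 × 𝓣 => w p * η p.1 :=
      hw.mul (hη.measurable.comp measurable_fst)
    rw [M.integral_XT (g := fun p => w p * η p.1) hm.aestronglyMeasurable]
    have hi : Integrable (fun p : 𝓧 × 𝓣 => M.f p.2 p.1 • (w p * η p.1))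
        ((M.P.map M.X).prod M.ν) := by
      rw [← M.integrable_XT_iff hm.aestronglyMeasurable]
      exact hwint.mul_bdd (c := B) (hη.comp_measurable M.measurable_X).aestronglyMeasurable hηb
    rw [integral_prod _ hi, ← integral_map (f := fun x => γ x * η x)
      M.measurable_X.aemeasurable (hγ.mul hη).aestronglyMeasurable]
    congr with x
    simp only [smul_eq_mul, ← mul_assoc, γ]
    rw [integral_mul_const]
  have e3 : ∫ ω, γ (M.X ω) * η (M.X ω) ∂M.P = ∫ ω, γ (M.X ω) * M.Y c ω ∂M.P :=
    (integral_mul_eq_integral_mul_condDistrib M.measurable_X hγ.measurable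
      (hbdd hγint) hYint).symm
  have hprod : Integrable
      (fun p : Ω × 𝓣 => M.f p.2 (M.X p.1) * w (M.X p.1, p.2) * M.Y c p.1) (M.P.prod M.ν) := by
    refine Integrable.mul_bdd (M.measurePreserving_XT_prod.integrable_comp_of_integrable hint) (c := B)
      (hYm.comp measurable_fst).aestronglyMeasurable ?_
    exact Measure.quasiMeasurePreserving_fst.ae hB
  rw [e1, e2, e3, integral_prod _ hprod]
  congr with ω
  simp only [γ]
  rw [integral_mul_const]

/-- Identification of the outcomes along a treatment rule `τ` of countable range. -/
theorem integral_weight_mul_countable (h𝓣 : MeasurableSet 𝓣) (hunc : M.Unconfounded)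
    {B : ℝ} (hB : ∀ᵐ ω ∂M.P, ∀ t, |M.Y t ω| ≤ B) {w : 𝓧 × 𝓣 → ℝ} (hw : Measurable w)
    (hint : Integrable (fun p : 𝓧 × 𝓣 => M.f p.2 p.1 * w p) ((M.P.map M.X).prod M.ν))
    {τ : 𝓣 → 𝓣} (hτ : Measurable τ) (hτc : (Set.range τ).Countable) :
    ∫ ω, w (M.X ω, M.T ω) * M.Y (τ (M.T ω)) ω ∂M.P
      = ∫ p : Ω × 𝓣, M.f p.2 (M.X p.1) * w (M.X p.1, p.2) * M.Y (τ p.2) p.1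
          ∂(M.P.prod M.ν) := by
  have : Countable (Set.range τ) := hτc.to_subtype
  have hA : ∀ c : Set.range τ, MeasurableSet {t : 𝓣 | τ t = c} := fun c =>
    hτ (measurableSet_singleton (c : 𝓣))
  let A : Set.range τ → Set Ω := fun c => {ω | τ (M.T ω) = c}
  let A' : Set.range τ → Set (Ω × 𝓣) := fun c => {p | τ p.2 = c}
  have hAm : ∀ c, MeasurableSet (A c) := fun c => M.measurable_T (hA c)
  have hAm' : ∀ c, MeasurableSet (A' c) := fun c => measurable_snd (hA c)
  have hAd : Pairwise (Function.onFun Disjoint A) := fun c c' hcc' =>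
    Set.disjoint_left.2 fun ω h h' => hcc' (Subtype.ext (h.symm.trans h'))
  have hAd' : Pairwise (Function.onFun Disjoint A') := fun c c' hcc' =>
    Set.disjoint_left.2 fun ω h h' => hcc' (Subtype.ext (h.symm.trans h'))
  have hAu : ⋃ c, A c = Set.univ :=
    Set.eq_univ_of_forall fun ω => Set.mem_iUnion.2 ⟨⟨τ (M.T ω), _, rfl⟩, rfl⟩
  have hAu' : ⋃ c, A' c = Set.univ :=
    Set.eq_univ_of_forall fun p => Set.mem_iUnion.2 ⟨⟨τ p.2, _, rfl⟩, rfl⟩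
  have hwint : Integrable (fun ω => w (M.X ω, M.T ω)) M.P :=
    (M.integrable_XT_iff hw.aestronglyMeasurable).2 hint
  have i1 : Integrable (fun ω => w (M.X ω, M.T ω) * M.Y (τ (M.T ω)) ω) M.P :=
    hwint.mul_bdd (c := B) (M.measurable_Y.comp
      ((hτ.comp M.measurable_T).prodMk measurable_id)).aestronglyMeasurable
      (hB.mono fun ω hω => hω _)
  have i2 : Integrable
      (fun p : Ω × 𝓣 => M.f p.2 (M.X p.1) * w (M.X p.1, p.2) * M.Y (τ p.2) p.1)
      (M.P.prod M.ν) :=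
    Integrable.mul_bdd (M.measurePreserving_XT_prod.integrable_comp_of_integrable hint) (c := B)
      (M.measurable_Y.comp ((hτ.comp measurable_snd).prodMk measurable_fst)).aestronglyMeasurable
      ((Measure.quasiMeasurePreserving_fst.ae hB).mono fun p hp => hp _)
  rw [← setIntegral_univ, ← hAu, integral_iUnion hAm hAd i1.integrableOn,
    ← setIntegral_univ (μ := M.P.prod M.ν), ← hAu', integral_iUnion hAm' hAd' i2.integrableOn]
  refine tsum_congr fun c => ?_
  have hA2 : MeasurableSet {p : 𝓧 × 𝓣 | τ p.2 = c} := measurable_snd (hA c)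
  have h := M.integral_weight_mul_potentialOutcome h𝓣 hunc c (hB.mono fun ω hω => hω c)
    (w := {p : 𝓧 × 𝓣 | τ p.2 = c}.indicator w) (hw.indicator hA2) (by
      refine (hint.indicator hA2).congr (ae_of_all _ fun p => ?_)
      by_cases hp : τ p.2 = c <;> simp [Set.indicator, hp])
  rw [← integral_indicator (hAm c), ← integral_indicator (hAm' c)]
  refine Eq.trans ?_ (h.trans ?_)
  · congr with ω
    by_cases hp : τ (M.T ω) = c <;> simp [Set.indicator, A, hp]
  · congr with p
    by_cases hp : τ p.2 = c <;> simp [Set.indicator, A', hp]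

/-- Inverse propensity weighting: unconfoundedness passes from the single potential outcomes to the
observed outcome through treatment rules of countable range. -/
theorem integral_weight_mul_Yobs (h𝓣 : MeasurableSet 𝓣) (hunc : M.Unconfounded)
    (hpaths : M.RegularPaths) {B : ℝ} (hB : ∀ᵐ ω ∂M.P, ∀ t, |M.Y t ω| ≤ B) {w : 𝓧 × 𝓣 → ℝ}
    (hw : Measurable w)
    (hint : Integrable (fun p : 𝓧 × 𝓣 => M.f p.2 p.1 * w p) ((M.P.map M.X).prod M.ν)) :
    ∫ ω, w (M.X ω, M.T ω) * M.Yobs ω ∂M.P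
      = ∫ p : Ω × 𝓣, M.f p.2 (M.X p.1) * w (M.X p.1, p.2) * M.Y p.2 p.1 ∂(M.P.prod M.ν) := by
  obtain ⟨τ, hτ, hlim⟩ := hpaths
  have hwint : Integrable (fun ω => w (M.X ω, M.T ω)) M.P :=
    (M.integrable_XT_iff hw.aestronglyMeasurable).2 hint
  have hint' : Integrable (fun p : Ω × 𝓣 => M.f p.2 (M.X p.1) * w (M.X p.1, p.2))
      (M.P.prod M.ν) := M.measurePreserving_XT_prod.integrable_comp_of_integrable hint
  have l1 : Tendsto (fun n => ∫ ω, w (M.X ω, M.T ω) * M.Y (τ n (M.T ω)) ω ∂M.P) atTop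
      (𝓝 (∫ ω, w (M.X ω, M.T ω) * M.Yobs ω ∂M.P)) := by
    refine tendsto_integral_of_dominated_convergence (fun ω => ‖w (M.X ω, M.T ω)‖ * B)
      (fun n => ?_) (hwint.norm.mul_const B) (fun n => ?_) ?_
    · exact hwint.1.mul (M.measurable_Y.comp
        (((hτ n).1.comp M.measurable_T).prodMk measurable_id)).aestronglyMeasurable
    · filter_upwards [hB] with ω hω
      rw [norm_mul]
      exact mul_le_mul_of_nonneg_left (hω _) (norm_nonneg _)
    · filter_upwards [hlim] with ω hω
      exact (hω (M.T ω)).const_mul _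
  have l2 : Tendsto (fun n => ∫ p : Ω × 𝓣, M.f p.2 (M.X p.1) * w (M.X p.1, p.2)
      * M.Y (τ n p.2) p.1 ∂(M.P.prod M.ν)) atTop
      (𝓝 (∫ p : Ω × 𝓣, M.f p.2 (M.X p.1) * w (M.X p.1, p.2) * M.Y p.2 p.1
        ∂(M.P.prod M.ν))) := by
    refine tendsto_integral_of_dominated_convergence
      (fun p => ‖M.f p.2 (M.X p.1) * w (M.X p.1, p.2)‖ * B)
      (fun n => ?_) (hint'.norm.mul_const B) (fun n => ?_) ?_
    · exact hint'.1.mul (M.measurable_Y.comp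
        (((hτ n).1.comp measurable_snd).prodMk measurable_fst)).aestronglyMeasurable
    · filter_upwards [Measure.quasiMeasurePreserving_fst.ae hB] with p hp
      rw [norm_mul]
      exact mul_le_mul_of_nonneg_left (hp _) (norm_nonneg _)
    · filter_upwards [Measure.quasiMeasurePreserving_fst.ae hlim] with p hp
      exact (hp p.2).const_mul _
  refine tendsto_nhds_unique l1 (l2.congr fun n => ?_)
  exact (M.integral_weight_mul_countable h𝓣 hunc hB hw hint (hτ n).1 (hτ n).2).symm

/-- The welfare is the mean of the inverse-propensity-weighted outcome. -/
theorem welfare_eq_integral_ipw (h𝓣 : MeasurableSet 𝓣) (hunc : M.Unconfounded)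
    (hpaths : M.RegularPaths) (hbdd : M.BoundedOutcomeOverlap)
    {θ : EuclideanSpace ℝ (Fin d)} (hθ : θ ∈ M.Θ) :
    M.welfare θ = ∫ z, M.pol θ z.2.1 z.2.2 * z.1 / M.f z.2.1 z.2.2 ∂M.obsLaw := by
  obtain ⟨⟨B, hB⟩, fmin, hfmin, hf⟩ := hbdd
  have hfpos : ∀ t x, 0 < M.f t x := fun t x => hfmin.trans_le (hf t x)
  have hpm := M.measurable_pol_apply hθ
  have hw : Measurable fun p : 𝓧 × 𝓣 => M.pol θ p.2 p.1 / M.f p.2 p.1 :=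
    hpm.div M.measurable_f_swap
  have hfw : ∀ t x, M.f t x * (M.pol θ t x / M.f t x) = M.pol θ t x := fun t x =>
    mul_div_cancel₀ _ (hfpos t x).ne'
  have hpi := M.integrable_pol hθ
  have key := M.integral_weight_mul_Yobs h𝓣 hunc hpaths hB hw (by simpa only [hfw] using hpi)
  simp only [hfw] at key
  have hpi' : Integrable (fun p : Ω × 𝓣 => M.pol θ p.2 (M.X p.1) * M.Y p.2 p.1)
      (M.P.prod M.ν) := by
    refine Integrable.mul_bdd (M.measurePreserving_XT_prod.integrable_comp_of_integrable hpi) (c := B)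
      (M.measurable_Y.comp measurable_swap).aestronglyMeasurable ?_
    filter_upwards [Measure.quasiMeasurePreserving_fst.ae hB] with p hp using hp _
  have hZm : Measurable fun ω => (M.Yobs ω, M.T ω, M.X ω) :=
    M.measurable_Yobs.prodMk (M.measurable_T.prodMk M.measurable_X)
  have hψm : Measurable fun z : ℝ × 𝓣 × 𝓧 =>
      M.pol θ z.2.1 z.2.2 * z.1 / M.f z.2.1 z.2.2 :=
    ((hpm.comp (measurable_snd.snd.prodMk measurable_snd.fst)).mul measurable_fst).div
      (M.measurable_f.comp measurable_snd)
  rw [obsLaw, integral_map hZm.aemeasurable hψm.aestronglyMeasurable]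
  have e1 : ∀ ω, M.pol θ (M.T ω) (M.X ω) * M.Yobs ω / M.f (M.T ω) (M.X ω)
      = M.pol θ (M.T ω) (M.X ω) / M.f (M.T ω) (M.X ω) * M.Yobs ω := fun ω => by ring
  simp only [e1]
  rw [key, integral_prod _ hpi', welfare]
  congr with ω
  have hpmω : Measurable fun t => M.pol θ t (M.X ω) := hpm.comp measurable_prodMk_left
  rw [policyMeasure, integral_withDensity_eq_integral_toReal_smul hpmω.ennreal_ofReal
    (ae_of_all _ fun _ => ENNReal.ofReal_lt_top)]
  simp only [ENNReal.toReal_ofReal (M.pol_nonneg θ hθ _ _), smul_eq_mul]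

end PolicyModel

/-! ### The inverse-propensity-weighted criterion -/

section Gradient

variable {E : Type*} [NormedAddCommGroup E] [InnerProductSpace ℝ E] [CompleteSpace E]

/-- No differentiability of `h` is needed, as `ℝ` is a field. -/
theorem gradient_mul_div (h : E → ℝ) (y c : ℝ) :
    (gradient fun θ => h θ * y / c) = fun θ => (y / c) • gradient h θ := by
  funext θ
  have : (fun θ => h θ * y / c) = (y / c) • h := by
    funext θ
    simp only [Pi.smul_apply, smul_eq_mul]
    ring
  rw [this, gradient, fderiv_const_smul_field]
  simp [gradient]

end Gradient

namespace PolicyModel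

variable {Ω : Type*} [MeasurableSpace Ω] {k d : ℕ} {𝓣 : Set ℝ}
  {𝓧 : Set (EuclideanSpace ℝ (Fin k))} (M : PolicyModel Ω 𝓣 𝓧 d)

theorem measurable_obs : Measurable fun ω => (M.Yobs ω, M.T ω, M.X ω) :=
  M.measurable_Yobs.prodMk (M.measurable_T.prodMk M.measurable_X)

instance : IsProbabilityMeasure M.obsLaw :=
  Measure.isProbabilityMeasure_map M.measurable_obs.aemeasurable

theorem quasiMeasurePreserving_XT :
    Measure.QuasiMeasurePreserving (fun z : ℝ × 𝓣 × 𝓧 => (z.2.2, z.2.1)) M.obsLaw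
      ((M.P.map M.X).prod M.ν) := by
  refine ⟨by fun_prop, ?_⟩
  rw [obsLaw, Measure.map_map (by fun_prop) M.measurable_obs]
  exact M.map_XT_absolutelyContinuous

theorem ae_obsLaw_abs_le {B : ℝ} (hB : ∀ᵐ ω ∂M.P, ∀ t, |M.Y t ω| ≤ B) :
    ∀ᵐ z ∂M.obsLaw, |z.1| ≤ B := by
  rw [obsLaw, ae_map_iff M.measurable_obs.aemeasurable
    (measurableSet_le (by fun_prop) measurable_const)]
  exact hB.mono fun ω hω => hω _

/-- The inverse-propensity-weighted criterion is a smooth criterion. -/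
theorem exists_smoothCriterion {θs : EuclideanSpace ℝ (Fin d)} (hs : M.PolicySmooth θs)
    (hr : M.ScoreRegular θs) (hb : M.BoundedOutcomeOverlap) :
    ∃ r C B, SmoothCriterion M.obsLaw M.Θ θs
      (fun θ z => M.pol θ z.2.1 z.2.2 * z.1 / M.f z.2.1 z.2.2) r C B := by
  obtain ⟨⟨Y₀, hY₀⟩, fmin, hfmin, hf⟩ := hb
  obtain ⟨⟨N, hNo, hθN, hNΘ, hdiff, -⟩, C₀, hC₀⟩ := hs
  obtain ⟨hcont, N', hN', B, hBm, hB, hBL⟩ := hr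
  obtain ⟨r, hr, hball⟩ := Metric.mem_nhds_iff.1 (inter_mem (hNo.mem_nhds hθN) hN')
  have hq := M.quasiMeasurePreserving_XT
  have hfm : Measurable fun z : ℝ × 𝓣 × 𝓧 => M.f z.2.1 z.2.2 := M.measurable_f.comp measurable_snd
  refine ⟨r, C₀ * Y₀ / fmin, fun z => ‖z.1 / M.f z.2.1 z.2.2 * B z.2.1 z.2.2‖, ?_⟩
  refine ⟨fun θ hθ => ?_, ?_, ?_, hr, fun θ hθ => hNΘ (hball hθ).1, ?_, ?_, ?_, ?_⟩
  · exact ((((M.measurable_pol_apply hθ).comp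
      (measurable_snd.snd.prodMk measurable_snd.fst)).mul measurable_fst).div hfm).aemeasurable
  · filter_upwards [hq.ae hcont] with z hz
    exact (hz.mul_const _).div_const _
  · filter_upwards [M.ae_obsLaw_abs_le hY₀] with z hz θ hθ
    have hf0 := hfmin.trans_le (hf z.2.1 z.2.2)
    have hp := M.pol_nonneg θ hθ z.2.1 z.2.2
    rw [abs_div, abs_mul, abs_of_nonneg hp, abs_of_pos hf0]
    have hC := hC₀ θ hθ z.2.1 z.2.2
    exact div_le_div₀ (mul_nonneg (hp.trans hC) ((abs_nonneg _).trans hz))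
      (mul_le_mul hC hz (abs_nonneg _) (hp.trans hC)) hfmin (hf _ _)
  · filter_upwards [hq.ae hdiff] with z hz θ hθ
    have h1 := (hz θ (hball hθ).1).mul_const (z.1 / M.f z.2.1 z.2.2)
    simpa only [mul_div_assoc] using h1
  · filter_upwards [hq.ae hB] with z hz θ hθ
    rw [gradient_mul_div]
    exact (hz θ (hball hθ).2).1.const_smul (z.1 / M.f z.2.1 z.2.2)
  · filter_upwards [hq.ae hB] with z hz θ hθ
    rw [gradient_mul_div]
    have hn := (hz θ (hball hθ).2).2
    change ‖fderiv ℝ ((z.1 / M.f z.2.1 z.2.2) • fun θ' => M.gradPol θ' z.2.1 z.2.2) θ‖ ≤ _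
    rw [fderiv_const_smul_field, Pi.smul_apply, norm_smul, norm_mul]
    exact mul_le_mul_of_nonneg_left (hn.trans (le_abs_self _)) (norm_nonneg _)
  · refine MemLp.norm ?_
    have hm : Measurable fun z : ℝ × 𝓣 × 𝓧 => z.1 / M.f z.2.1 z.2.2 * B z.2.1 z.2.2 :=
      (measurable_fst.div hfm).mul (hBm.comp measurable_snd)
    rwa [obsLaw, memLp_map_measure_iff hm.aestronglyMeasurable M.measurable_obs.aemeasurable]

theorem aemeasurable_gradPol {θs : EuclideanSpace ℝ (Fin d)} (hs : M.PolicySmooth θs) :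
    AEMeasurable (fun p : 𝓧 × 𝓣 => M.gradPol θs p.2 p.1) ((M.P.map M.X).prod M.ν) := by
  obtain ⟨⟨N, hNo, hθN, hNΘ, hdiff, -⟩, -⟩ := hs
  refine aemeasurable_of_inner_basis fun v => ?_
  simp only [gradPol, inner_gradient_left]
  refine aemeasurable_fderiv_apply (f := fun θ (p : 𝓧 × 𝓣) => M.pol θ p.2 p.1) v ?_
    (hdiff.mono fun p hp => hp θs hθN)
  filter_upwards [hNo.mem_nhds hθN] with θ hθ using
    (M.measurable_pol_apply (hNΘ hθ)).aemeasurable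

end PolicyModel

/-! ### Orthogonal decomposition of the score -/

section Orthogonal

variable {Ω : Type*} {m₁ m₂ m₀ : MeasurableSpace Ω} {P : Measure[m₀] Ω} [IsProbabilityMeasure P]

theorem integral_mul_sub_condExp_eq_zero {m : MeasurableSpace Ω} {f g : Ω → ℝ} (hm : m ≤ m₀)
    (hgm : AEStronglyMeasurable[m] g P) (hg : MemLp g 2 P) (hf : MemLp f 2 P) :
    ∫ ω, g ω * (f ω - P[f | m] ω) ∂P = 0 := by
  have hc : MemLp (P[f | m]) 2 P := hf.condExp one_le_two
  have i1 : Integrable (fun ω => g ω * f ω) P := hg.integrable_mul hf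
  have i2 : Integrable (fun ω => g ω * P[f | m] ω) P := hg.integrable_mul hc
  simp only [mul_sub]
  rw [integral_sub i1 i2, sub_eq_zero]
  exact integral_mul_eq_integral_mul_condExp hm hgm i1 (hf.integrable one_le_two)

/-- For nested `σ`-algebras `m₁ ≤ m₂` and `a = E[s | m₂]`, `b = E[a | m₁]`, the variables
`b + (s - a)` and `a - b` are orthogonal. -/
theorem integral_mul_condExp_sub_eq_zero (h₁₂ : m₁ ≤ m₂) (h₂ : m₂ ≤ m₀)
    {s a b s' a' b' : Ω → ℝ} (hs : MemLp s 2 P) (hs' : MemLp s' 2 P)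
    (ha : P[s | m₂] =ᵐ[P] a) (hb : P[a | m₁] =ᵐ[P] b)
    (ha' : P[s' | m₂] =ᵐ[P] a') (hb' : P[a' | m₁] =ᵐ[P] b') :
    ∫ ω, (b ω + (s ω - a ω)) * (a' ω - b' ω) ∂P = 0 := by
  have la : MemLp a 2 P := (memLp_congr_ae ha).1 (hs.condExp one_le_two)
  have lb : MemLp b 2 P := (memLp_congr_ae hb).1 (la.condExp one_le_two)
  have la' : MemLp a' 2 P := (memLp_congr_ae ha').1 (hs'.condExp one_le_two)
  have lb' : MemLp b' 2 P := (memLp_congr_ae hb').1 (la'.condExp one_le_two)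
  have e1 : ∫ ω, b ω * (a' ω - b' ω) ∂P = 0 := by
    have hbm : AEStronglyMeasurable[m₁] b P := stronglyMeasurable_condExp.aestronglyMeasurable.congr hb
    rw [← integral_mul_sub_condExp_eq_zero (h₁₂.trans h₂) hbm lb la']
    refine integral_congr_ae ?_
    filter_upwards [hb'] with ω hω
    rw [hω]
  have e2 : ∫ ω, (a' ω - b' ω) * (s ω - a ω) ∂P = 0 := by
    have hm : AEStronglyMeasurable[m₂] (fun ω => a' ω - b' ω) P :=
      (stronglyMeasurable_condExp.aestronglyMeasurable.congr ha').sub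
        ((stronglyMeasurable_condExp.mono h₁₂).aestronglyMeasurable.congr hb')
    rw [← integral_mul_sub_condExp_eq_zero h₂ hm (la'.sub lb') hs]
    refine integral_congr_ae ?_
    filter_upwards [ha] with ω hω
    rw [hω]
  have i1 : Integrable (fun ω => b ω * (a' ω - b' ω)) P := lb.integrable_mul (la'.sub lb')
  have i2 : Integrable (fun ω => (a' ω - b' ω) * (s ω - a ω)) P :=
    (la'.sub lb').integrable_mul (hs.sub la)
  have e : ∀ ω, (b ω + (s ω - a ω)) * (a' ω - b' ω)
      = b ω * (a' ω - b' ω) + (a' ω - b' ω) * (s ω - a ω) := fun ω => by ring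
  simp only [e]
  rw [integral_add i1 i2, e1, e2, add_zero]

/-- The second moments of `s` are those of `b + (s - a)` plus those of `a - b`. -/
theorem integral_mul_eq_add_of_condExp (h₁₂ : m₁ ≤ m₂) (h₂ : m₂ ≤ m₀)
    {s a b s' a' b' : Ω → ℝ} (hs : MemLp s 2 P) (hs' : MemLp s' 2 P)
    (ha : P[s | m₂] =ᵐ[P] a) (hb : P[a | m₁] =ᵐ[P] b)
    (ha' : P[s' | m₂] =ᵐ[P] a') (hb' : P[a' | m₁] =ᵐ[P] b') :
    ∫ ω, s ω * s' ω ∂P = ∫ ω, (b ω + (s ω - a ω)) * (b' ω + (s' ω - a' ω)) ∂P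
      + ∫ ω, (a ω - b ω) * (a' ω - b' ω) ∂P := by
  have la : MemLp a 2 P := (memLp_congr_ae ha).1 (hs.condExp one_le_two)
  have lb : MemLp b 2 P := (memLp_congr_ae hb).1 (la.condExp one_le_two)
  have la' : MemLp a' 2 P := (memLp_congr_ae ha').1 (hs'.condExp one_le_two)
  have lb' : MemLp b' 2 P := (memLp_congr_ae hb').1 (la'.condExp one_le_two)
  have le : MemLp (fun ω => b ω + (s ω - a ω)) 2 P := lb.add (hs.sub la)
  have le' : MemLp (fun ω => b' ω + (s' ω - a' ω)) 2 P := lb'.add (hs'.sub la')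
  have lv : MemLp (fun ω => a ω - b ω) 2 P := la.sub lb
  have lv' : MemLp (fun ω => a' ω - b' ω) 2 P := la'.sub lb'
  have z1 := integral_mul_condExp_sub_eq_zero h₁₂ h₂ hs hs' ha hb ha' hb'
  have z2 := integral_mul_condExp_sub_eq_zero h₁₂ h₂ hs' hs ha' hb' ha hb
  have e : ∀ ω, s ω * s' ω = ((b ω + (s ω - a ω)) * (b' ω + (s' ω - a' ω))
      + (a ω - b ω) * (a' ω - b' ω)) + ((b ω + (s ω - a ω)) * (a' ω - b' ω)
      + (b' ω + (s' ω - a' ω)) * (a ω - b ω)) := fun ω => by ring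
  simp only [e]
  have i1 : Integrable (fun ω => (b ω + (s ω - a ω)) * (b' ω + (s' ω - a' ω))) P :=
    le.integrable_mul le'
  have i2 : Integrable (fun ω => (a ω - b ω) * (a' ω - b' ω)) P := lv.integrable_mul lv'
  have i3 : Integrable (fun ω => (b ω + (s ω - a ω)) * (a' ω - b' ω)) P := le.integrable_mul lv'
  have i4 : Integrable (fun ω => (b' ω + (s' ω - a' ω)) * (a ω - b ω)) P := le'.integrable_mul lv
  have i12 : Integrable (fun ω => (b ω + (s ω - a ω)) * (b' ω + (s' ω - a' ω))
      + (a ω - b ω) * (a' ω - b' ω)) P := i1.add i2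
  have i34 : Integrable (fun ω => (b ω + (s ω - a ω)) * (a' ω - b' ω)
      + (b' ω + (s' ω - a' ω)) * (a ω - b ω)) P := i3.add i4
  rw [integral_add i12 i34, integral_add i1 i2,
    integral_add i3 i4, z1, z2]
  ring

end Orthogonal

namespace PolicyModel

variable {Ω : Type*} [MeasurableSpace Ω] {k d : ℕ} {𝓣 : Set ℝ}
  {𝓧 : Set (EuclideanSpace ℝ (Fin k))} (M : PolicyModel Ω 𝓣 𝓧 d)
  {θs : EuclideanSpace ℝ (Fin d)}

/-- The score of the inverse-propensity-weighted criterion, `(Y / f(T | X)) ∂_θ π_θ(T | X)`. -/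
noncomputable def ipwScore (θ : EuclideanSpace ℝ (Fin d)) (ω : Ω) : EuclideanSpace ℝ (Fin d) :=
  (M.Yobs ω / M.f (M.T ω) (M.X ω)) • M.gradPol θ (M.T ω) (M.X ω)

theorem measurable_TX : Measurable fun ω => (M.T ω, M.X ω) := M.measurable_T.prodMk M.measurable_X

theorem integrable_Yobs (hb : M.BoundedOutcomeOverlap) : Integrable M.Yobs M.P := by
  obtain ⟨⟨B, hB⟩, -⟩ := hb
  exact (integrable_const B).mono' M.measurable_Yobs.aestronglyMeasurable
    (hB.mono fun ω hω => hω _)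

theorem stronglyMeasurable_condMean :
    StronglyMeasurable fun p : 𝓣 × 𝓧 => M.condMean p.1 p.2 :=
  StronglyMeasurable.integral_condDistrib (f := fun p : (𝓣 × 𝓧) × ℝ => p.2) (by fun_prop)

theorem aestronglyMeasurable_TX {g : 𝓧 × 𝓣 → ℝ}
    (hg : AEStronglyMeasurable g ((M.P.map M.X).prod M.ν)) :
    AEStronglyMeasurable[MeasurableSpace.comap (fun ω => (M.T ω, M.X ω)) inferInstance]
      (fun ω => g (M.X ω, M.T ω)) M.P := by
  refine (AEStronglyMeasurable.comp_ae_measurable' (hg.mono_ac M.map_XT_absolutelyContinuous)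
    M.measurable_XT.aemeasurable).mono ?_
  exact Measurable.comap_le (measurable_swap.comp (comap_measurable _))

theorem aestronglyMeasurable_gradPol_coord (hs : M.PolicySmooth θs) (i : Fin d) :
    AEStronglyMeasurable (fun p : 𝓧 × 𝓣 => M.gradPol θs p.2 p.1 i)
      ((M.P.map M.X).prod M.ν) :=
  (EuclideanSpace.proj (𝕜 := ℝ) i).continuous.comp_aestronglyMeasurable
    (M.aemeasurable_gradPol hs).aestronglyMeasurable

/-- Given `(T, X)`, only the outcome is averaged. -/
theorem condExp_ipwScore (hs : M.PolicySmooth θs) (hb : M.BoundedOutcomeOverlap)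
    (hsq : MemLp (M.ipwScore θs) 2 M.P) (i : Fin d) :
    M.P[fun ω => M.ipwScore θs ω i |
        MeasurableSpace.comap (fun ω => (M.T ω, M.X ω)) inferInstance]
      =ᵐ[M.P] fun ω => M.weightedScore θs ω i := by
  let g : 𝓧 × 𝓣 → ℝ := fun p => M.gradPol θs p.2 p.1 i / M.f p.2 p.1
  have hg : AEStronglyMeasurable g ((M.P.map M.X).prod M.ν) :=
    (M.aestronglyMeasurable_gradPol_coord hs i).div₀ M.measurable_f_swap.aestronglyMeasurable
  have e : (fun ω => M.ipwScore θs ω i) = (fun ω => g (M.X ω, M.T ω)) * M.Yobs := by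
    funext ω
    simp only [ipwScore, PiLp.smul_apply, smul_eq_mul, Pi.mul_apply, g]
    ring
  have hint : Integrable (fun ω => M.ipwScore θs ω i) M.P :=
    (memLp_coord hsq i).integrable one_le_two
  rw [e] at hint ⊢
  filter_upwards [condExp_mul_of_aestronglyMeasurable_left (M.aestronglyMeasurable_TX hg) hint
    (M.integrable_Yobs hb),
    condExp_ae_eq_integral_condDistrib' M.measurable_TX (M.integrable_Yobs hb)] with ω h1 h2
  rw [h1, Pi.mul_apply, h2]
  simp only [weightedScore, condMean, PiLp.smul_apply, smul_eq_mul, g]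
  ring

theorem ae_gradCondValue (hs : M.PolicySmooth θs) : ∀ᵐ x ∂(M.P.map M.X),
    Integrable (fun t => M.condMean t x • M.gradPol θs t x) M.ν ∧
      M.gradCondValue θs x = ∫ t, M.condMean t x • M.gradPol θs t x ∂M.ν := by
  obtain ⟨⟨N, -, hθN, -, -, -, -, h⟩, -⟩ := hs
  filter_upwards [h] with x hx
  exact ⟨(hx θs hθN).1, (hx θs hθN).2.gradient⟩

theorem memLp_weightedScore (hs : M.PolicySmooth θs) (hb : M.BoundedOutcomeOverlap)
    (hsq : MemLp (M.ipwScore θs) 2 M.P) : MemLp (M.weightedScore θs) 2 M.P := by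
  rw [memLp_piLp_iff]
  intro i
  exact (memLp_congr_ae (M.condExp_ipwScore hs hb hsq i)).1 ((memLp_coord hsq i).condExp one_le_two)

/-- Given `X`, the density of `T` cancels the weight `1 / f`. -/
theorem condExp_weightedScore (hs : M.PolicySmooth θs) (hb : M.BoundedOutcomeOverlap)
    (hsq : MemLp (M.ipwScore θs) 2 M.P) (i : Fin d) :
    M.P[fun ω => M.weightedScore θs ω i | MeasurableSpace.comap M.X inferInstance]
      =ᵐ[M.P] fun ω => M.gradCondValue θs (M.X ω) i := by
  have hint : Integrable (fun ω => M.weightedScore θs ω i) M.P :=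
    (memLp_coord (M.memLp_weightedScore hs hb hsq) i).integrable one_le_two
  obtain ⟨-, fmin, hfmin, hf⟩ := hb
  have hfne : ∀ t x, M.f t x ≠ 0 := fun t x => (hfmin.trans_le (hf t x)).ne'
  let g : 𝓧 × 𝓣 → ℝ := fun p => M.condMean p.2 p.1 / M.f p.2 p.1 * M.gradPol θs p.2 p.1 i
  let h : 𝓧 × 𝓣 → ℝ := fun p => M.condMean p.2 p.1 * M.gradPol θs p.2 p.1 i
  have hcm : AEStronglyMeasurable (fun p : 𝓧 × 𝓣 => M.condMean p.2 p.1)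
      ((M.P.map M.X).prod M.ν) :=
    (M.stronglyMeasurable_condMean.comp_measurable measurable_swap).aestronglyMeasurable
  have hg : AEStronglyMeasurable g ((M.P.map M.X).prod M.ν) :=
    (hcm.div₀ M.measurable_f_swap.aestronglyMeasurable).mul
      (M.aestronglyMeasurable_gradPol_coord hs i)
  have hgh : ∀ p : 𝓧 × 𝓣, M.f p.2 p.1 • g p = h p := fun p => by
    have := hfne p.2 p.1
    simp only [g, h, smul_eq_mul]
    field_simp
  have hh : Integrable h ((M.P.map M.X).prod M.ν) := by
    have := (M.integrable_XT_iff hg).1 hint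
    simpa only [hgh] using this
  have hcond : ∀ᵐ x ∂(M.P.map M.X), M.gradCondValue θs x i = ∫ t, h (x, t) ∂M.ν := by
    filter_upwards [M.ae_gradCondValue hs] with x hx
    rw [hx.2]
    exact ((EuclideanSpace.proj (𝕜 := ℝ) i).integral_comp_comm hx.1).symm
  have hcond' := ae_of_ae_map M.measurable_X.aemeasurable hcond
  have hbint : Integrable (fun ω => M.gradCondValue θs (M.X ω) i) M.P :=
    (hh.integral_prod_left.comp_measurable M.measurable_X).congr (hcond'.mono fun ω hω => hω.symm)
  have hbm : AEStronglyMeasurable (fun x => M.gradCondValue θs x i) (M.P.map M.X) :=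
    hh.integral_prod_left.1.congr (hcond.mono fun x hx => hx.symm)
  refine (ae_eq_condExp_of_forall_setIntegral_eq M.measurable_X.comap_le hint
    (fun _ _ _ => hbint.integrableOn) ?_
    (AEStronglyMeasurable.comp_ae_measurable' hbm M.measurable_X.aemeasurable)).symm
  rintro _ ⟨S, hS, rfl⟩ -
  have hS' : MeasurableSet (Prod.fst ⁻¹' S : Set (𝓧 × 𝓣)) := measurable_fst hS
  rw [← integral_indicator (M.measurable_X hS), ← integral_indicator (M.measurable_X hS)]
  have e1 := M.integral_XT (g := (Prod.fst ⁻¹' S : Set (𝓧 × 𝓣)).indicator g) (hg.indicator hS')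
  have e2 : ∀ p : 𝓧 × 𝓣, M.f p.2 p.1 • (Prod.fst ⁻¹' S : Set (𝓧 × 𝓣)).indicator g p
      = (Prod.fst ⁻¹' S : Set (𝓧 × 𝓣)).indicator h p := fun p => by
    by_cases hp : p.1 ∈ S
    · simpa [Set.indicator, hp] using hgh p
    · simp [Set.indicator, hp]
  simp only [e2] at e1
  rw [integral_prod _ (hh.indicator hS')] at e1
  have e3 : ∫ ω, (M.X ⁻¹' S).indicator (fun ω => M.weightedScore θs ω i) ω ∂M.P
      = ∫ ω, (Prod.fst ⁻¹' S : Set (𝓧 × 𝓣)).indicator g (M.X ω, M.T ω) ∂M.P := rfl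
  have e4 : ∫ ω, (M.X ⁻¹' S).indicator (fun ω => M.gradCondValue θs (M.X ω) i) ω ∂M.P
      = ∫ ω, S.indicator (fun x => M.gradCondValue θs x i) (M.X ω) ∂M.P := rfl
  rw [e3, e1, e4, ← integral_map M.measurable_X.aemeasurable (hbm.indicator hS)]
  refine integral_congr_ae ?_
  filter_upwards [hcond] with x hx
  by_cases hxS : x ∈ S <;> simp [Set.indicator, hxS, hx]

theorem effScore_ae_eq (hs : M.PolicySmooth θs) : M.effScore θs =ᵐ[M.P] fun ω =>
    M.gradCondValue θs (M.X ω) + (M.ipwScore θs ω - M.weightedScore θs ω) := by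
  filter_upwards [ae_of_ae_map M.measurable_X.aemeasurable (M.ae_gradCondValue hs)] with ω hω
  rw [effScore, ← hω.2, ipwScore, weightedScore, sub_div, sub_smul]

theorem memLp_gradCondValue (hs : M.PolicySmooth θs) (hb : M.BoundedOutcomeOverlap)
    (hsq : MemLp (M.ipwScore θs) 2 M.P) :
    MemLp (fun ω => M.gradCondValue θs (M.X ω)) 2 M.P := by
  rw [memLp_piLp_iff]
  intro i
  exact (memLp_congr_ae (M.condExp_weightedScore hs hb hsq i)).1
    ((memLp_coord (M.memLp_weightedScore hs hb hsq) i).condExp one_le_two)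

theorem memLp_excessScore (hs : M.PolicySmooth θs) (hb : M.BoundedOutcomeOverlap)
    (hsq : MemLp (M.ipwScore θs) 2 M.P) : MemLp (M.excessScore θs) 2 M.P :=
  (M.memLp_weightedScore hs hb hsq).sub (M.memLp_gradCondValue hs hb hsq)

theorem memLp_effScore (hs : M.PolicySmooth θs) (hb : M.BoundedOutcomeOverlap)
    (hsq : MemLp (M.ipwScore θs) 2 M.P) : MemLp (M.effScore θs) 2 M.P :=
  (memLp_congr_ae (M.effScore_ae_eq hs)).2 ((M.memLp_gradCondValue hs hb hsq).add
    (hsq.sub (M.memLp_weightedScore hs hb hsq)))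

theorem integral_effScore_coord (hs : M.PolicySmooth θs) (hb : M.BoundedOutcomeOverlap)
    (hsq : MemLp (M.ipwScore θs) 2 M.P) (h0 : ∫ ω, M.ipwScore θs ω ∂M.P = 0) (i : Fin d) :
    ∫ ω, M.effScore θs ω i ∂M.P = 0 := by
  have ha := M.memLp_weightedScore hs hb hsq
  have hc := M.memLp_gradCondValue hs hb hsq
  have is : Integrable (fun ω => M.ipwScore θs ω i) M.P :=
    (memLp_coord hsq i).integrable one_le_two
  have ia : Integrable (fun ω => M.weightedScore θs ω i) M.P :=
    (memLp_coord ha i).integrable one_le_two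
  have ib : Integrable (fun ω => M.gradCondValue θs (M.X ω) i) M.P :=
    (memLp_coord hc i).integrable one_le_two
  have e : ∫ ω, M.effScore θs ω i ∂M.P = ∫ ω, (M.gradCondValue θs (M.X ω) i
      + (M.ipwScore θs ω i - M.weightedScore θs ω i)) ∂M.P := by
    refine integral_congr_ae ?_
    filter_upwards [M.effScore_ae_eq hs] with ω hω
    rw [hω]
    rfl
  have e0 : ∫ ω, M.ipwScore θs ω i ∂M.P = 0 := by
    have := (EuclideanSpace.proj (𝕜 := ℝ) i).integral_comp_comm (hsq.integrable one_le_two)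
    rw [h0] at this
    simpa using this
  have eb : ∫ ω, M.gradCondValue θs (M.X ω) i ∂M.P = ∫ ω, M.weightedScore θs ω i ∂M.P := by
    rw [← integral_congr_ae (M.condExp_weightedScore hs hb hsq i),
      integral_condExp M.measurable_X.comap_le]
  have i2 : Integrable (fun ω => M.ipwScore θs ω i - M.weightedScore θs ω i) M.P := is.sub ia
  rw [e, integral_add ib i2, integral_sub is ia, e0, eb]
  ring

/-- The variance of the score splits into the efficient part and the part explained by weighting
with the known propensity: the two scores are orthogonal. -/
theorem integral_ipwScore_mul_ipwScore (hs : M.PolicySmooth θs) (hb : M.BoundedOutcomeOverlap)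
    (hsq : MemLp (M.ipwScore θs) 2 M.P) (h0 : ∫ ω, M.ipwScore θs ω ∂M.P = 0) (i j : Fin d) :
    ∫ ω, M.ipwScore θs ω i * M.ipwScore θs ω j ∂M.P
      = cov[fun ω => M.effScore θs ω i, fun ω => M.effScore θs ω j; M.P]
        + ∫ ω, M.excessScore θs ω i * M.excessScore θs ω j ∂M.P := by
  have h12 : MeasurableSpace.comap M.X inferInstance
      ≤ MeasurableSpace.comap (fun ω => (M.T ω, M.X ω)) inferInstance :=
    Measurable.comap_le (measurable_snd.comp (comap_measurable _))
  rw [integral_mul_eq_add_of_condExp h12 M.measurable_TX.comap_le (memLp_coord hsq i)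
    (memLp_coord hsq j) (M.condExp_ipwScore hs hb hsq i) (M.condExp_weightedScore hs hb hsq i)
    (M.condExp_ipwScore hs hb hsq j) (M.condExp_weightedScore hs hb hsq j)]
  congr 1
  simp only [covariance, M.integral_effScore_coord hs hb hsq h0, sub_zero]
  refine integral_congr_ae ?_
  filter_upwards [M.effScore_ae_eq hs] with ω hω
  rw [hω]
  rfl

/-- If the excess score has no second moments, then the weighted score is a function of the
covariates. -/
theorem exists_weightedScore_ae_eq_comp (hs : M.PolicySmooth θs) (hb : M.BoundedOutcomeOverlap)
    (hsq : MemLp (M.ipwScore θs) 2 M.P)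
    (h : ∀ i, ∫ ω, M.excessScore θs ω i * M.excessScore θs ω i ∂M.P = 0) :
    ∃ c : 𝓧 → EuclideanSpace ℝ (Fin d), ∀ᵐ ω ∂M.P, M.weightedScore θs ω = c (M.X ω) := by
  refine ⟨M.gradCondValue θs, ?_⟩
  have hv := M.memLp_excessScore hs hb hsq
  have h0 : ∀ᵐ ω ∂M.P, ∀ i, M.excessScore θs ω i * M.excessScore θs ω i = 0 :=
    ae_all_iff.2 fun i => (integral_eq_zero_iff_of_nonneg (fun ω => mul_self_nonneg _)
      ((memLp_coord hv i).integrable_mul (memLp_coord hv i))).1 (h i)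
  filter_upwards [h0] with ω hω
  rw [← sub_eq_zero]
  ext i
  exact mul_self_eq_zero.1 (hω i)

end PolicyModel

/-! ### The limit theorem for the policy estimator -/

section QuadraticForm

open Matrix
open scoped MatrixOrder

variable {d : ℕ} {H : Matrix (Fin d) (Fin d) ℝ}

theorem halfQuad_eq_inner (z : EuclideanSpace ℝ (Fin d)) :
    halfQuad H z = 1 / 2 * ⟪toEuclideanCLM (𝕜 := ℝ) H z, z⟫ := by
  rw [real_inner_comm, inner_toEuclideanCLM, halfQuad]

theorem transpose_eq_of_posDef (hH : H.PosDef) : Hᵀ = H := by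
  have := hH.isHermitian
  rwa [IsHermitian, conjTranspose_eq_transpose_of_trivial] at this

theorem posSemidef_inv_conj (hH : H.PosDef) {V : Matrix (Fin d) (Fin d) ℝ} (hV : V.PosSemidef) :
    (H⁻¹ * V * H⁻¹).PosSemidef := by
  have := hV.mul_mul_conjTranspose_same H⁻¹
  rwa [conjTranspose_eq_transpose_of_trivial, transpose_nonsing_inv,
    transpose_eq_of_posDef hH] at this

/-- A positive definite matrix is coercive, by invertibility of its square root. -/
theorem exists_mul_norm_sq_le_inner (hH : H.PosDef) :
    ∃ c > 0, ∀ u, c * ‖u‖ ^ 2 ≤ ⟪toEuclideanCLM (𝕜 := ℝ) H u, u⟫ := by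
  set K := CFC.sqrt H
  set J := toEuclideanCLM (𝕜 := ℝ) K⁻¹
  have hJ : 0 < ‖J‖ ^ 2 + 1 := by positivity
  refine ⟨(‖J‖ ^ 2 + 1)⁻¹, inv_pos.2 hJ, fun u => ?_⟩
  have h1 : J (toEuclideanCLM (𝕜 := ℝ) K u) = u := by
    rw [← mul_apply_eq_comp, ← map_mul, nonsing_inv_mul _ (isUnit_det_sqrt hH), map_one,
      one_apply_eq_self]
  have h2 : ⟪toEuclideanCLM (𝕜 := ℝ) H u, u⟫ = ‖toEuclideanCLM (𝕜 := ℝ) K u‖ ^ 2 := by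
    have h : u.ofLp ⬝ᵥ H *ᵥ u.ofLp = K *ᵥ u.ofLp ⬝ᵥ K *ᵥ u.ofLp := by
      conv_lhs => rw [← sqrt_mul_sqrt hH, ← mulVec_mulVec, dotProduct_mulVec, ← mulVec_transpose,
        transpose_sqrt]
    rw [real_inner_comm, inner_toEuclideanCLM, ← real_inner_self_eq_norm_sq, inner_toEuclideanCLM,
      ofLp_toEuclideanCLM, h, dotProduct_mulVec, ← mulVec_transpose, transpose_sqrt,
      dotProduct_comm]
  have h3 : ‖u‖ ≤ ‖J‖ * ‖toEuclideanCLM (𝕜 := ℝ) K u‖ := by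
    conv_lhs => rw [← h1]
    exact J.le_opNorm _
  rw [h2, inv_mul_le_iff₀ hJ]
  have h4 : ‖u‖ ^ 2 ≤ ‖J‖ ^ 2 * ‖toEuclideanCLM (𝕜 := ℝ) K u‖ ^ 2 := by
    rw [← mul_pow]
    exact pow_le_pow_left₀ (norm_nonneg _) h3 2
  nlinarith [sq_nonneg ‖toEuclideanCLM (𝕜 := ℝ) K u‖]

end QuadraticForm

namespace PolicyModel

open Matrix

variable {Ω : Type*} [MeasurableSpace Ω] {k d : ℕ} {𝓣 : Set ℝ}
  {𝓧 : Set (EuclideanSpace ℝ (Fin k))} (M : PolicyModel Ω 𝓣 𝓧 d)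
  {θs : EuclideanSpace ℝ (Fin d)}

theorem toEuclideanCLM_negHessian :
    toEuclideanCLM (𝕜 := ℝ) (M.negHessian θs) = -fderiv ℝ (gradient M.welfare) θs := by
  refine ContinuousLinearMap.coe_injective ?_
  refine (EuclideanSpace.basisFun (Fin d) ℝ).toBasis.ext fun j => ?_
  ext i
  simp [negHessian, EuclideanSpace.basisFun_apply, ofLp_toEuclideanCLM]

theorem ipwWelfare_eq_sampleMean (z : ℕ → ℝ × 𝓣 × 𝓧) (n : ℕ) (θ : EuclideanSpace ℝ (Fin d)) :
    M.ipwWelfare z n θ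
      = sampleMean z n (fun z => M.pol θ z.2.1 z.2.2 * z.1 / M.f z.2.1 z.2.2) := by
  simp [ipwWelfare, sampleMean]

theorem negHessian_mul_covariance_mul (hH : (M.negHessian θs).PosDef) :
    M.negHessian θs * (M.Veff θs + M.SigmaU θs) * (M.negHessian θs)ᵀ
      = (Matrix.of fun i j => cov[fun ω => M.effScore θs ω i, fun ω => M.effScore θs ω j; M.P])
        + Matrix.of fun i j => ∫ ω, M.excessScore θs ω i * M.excessScore θs ω j ∂M.P := by
  have hu : IsUnit (M.negHessian θs).det := hH.det_pos.ne'.isUnit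
  have key : ∀ V : Matrix (Fin d) (Fin d) ℝ,
      M.negHessian θs * ((M.negHessian θs)⁻¹ * V * (M.negHessian θs)⁻¹) * M.negHessian θs = V := by
    intro V
    rw [← mul_assoc, ← mul_assoc, mul_nonsing_inv _ hu, one_mul, mul_assoc,
      nonsing_inv_mul _ hu, mul_one]
  rw [transpose_eq_of_posDef hH, mul_add, add_mul, Veff, SigmaU, key, key]

theorem posSemidef_Veff (hH : (M.negHessian θs).PosDef) (hs : M.PolicySmooth θs)
    (hb : M.BoundedOutcomeOverlap) (hsq : MemLp (M.ipwScore θs) 2 M.P)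
    (h0 : ∫ ω, M.ipwScore θs ω ∂M.P = 0) : (M.Veff θs).PosSemidef := by
  refine posSemidef_inv_conj hH (posSemidef_secondMoment (M.memLp_effScore hs hb hsq) ?_)
  intro i j
  simp only [Matrix.of_apply, covariance, M.integral_effScore_coord hs hb hsq h0, sub_zero]

theorem posSemidef_SigmaU (hH : (M.negHessian θs).PosDef) (hs : M.PolicySmooth θs)
    (hb : M.BoundedOutcomeOverlap) (hsq : MemLp (M.ipwScore θs) 2 M.P) :
    (M.SigmaU θs).PosSemidef :=
  posSemidef_inv_conj hH
    (posSemidef_secondMoment (M.memLp_excessScore hs hb hsq) fun _ _ => rfl)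

theorem SigmaU_ne_zero (hH : (M.negHessian θs).PosDef) (hs : M.PolicySmooth θs)
    (hb : M.BoundedOutcomeOverlap) (hsq : MemLp (M.ipwScore θs) 2 M.P)
    (h : ¬ ∃ c : 𝓧 → EuclideanSpace ℝ (Fin d), ∀ᵐ ω ∂M.P, M.weightedScore θs ω = c (M.X ω)) :
    M.SigmaU θs ≠ 0 := by
  intro h0
  refine h (M.exists_weightedScore_ae_eq_comp hs hb hsq fun i => ?_)
  have hu : IsUnit (M.negHessian θs).det := hH.det_pos.ne'.isUnit
  have h1 : M.negHessian θs * M.SigmaU θs * M.negHessian θs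
      = Matrix.of fun i j => ∫ ω, M.excessScore θs ω i * M.excessScore θs ω j ∂M.P := by
    rw [SigmaU, ← mul_assoc, ← mul_assoc, mul_nonsing_inv _ hu, one_mul, mul_assoc,
      nonsing_inv_mul _ hu, mul_one]
  rw [h0, mul_zero, zero_mul] at h1
  exact (congrFun (congrFun h1 i) i).symm

theorem ipwScore_eq_gradient (θ : EuclideanSpace ℝ (Fin d)) (ω : Ω) :
    M.ipwScore θ ω = gradient (fun θ' => M.pol θ' (M.T ω) (M.X ω) * M.Yobs ω
      / M.f (M.T ω) (M.X ω)) θ := by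
  rw [gradient_mul_div]
  rfl

end PolicyModel

theorem theorem4 {Ω Ω' : Type*} [MeasurableSpace Ω] [StandardBorelSpace Ω] [MeasurableSpace Ω']
    {k d : ℕ} {𝓣 : Set ℝ} {𝓧 : Set (EuclideanSpace ℝ (Fin k))}
    (h𝓣 : MeasurableSet 𝓣) (h𝓧 : MeasurableSet 𝓧)
    -- the population
    (M : PolicyModel Ω 𝓣 𝓧 d) (θs : EuclideanSpace ℝ (Fin d))
    (h_unconf : M.Unconfounded) (h_paths : M.RegularPaths)
    (h_concave : M.ConcaveUnique θs) (h_smooth : M.PolicySmooth θs)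
    (h_score : M.ScoreRegular θs) (h_bdd : M.BoundedOutcomeOverlap)
    -- the i.i.d. sample and the estimator
    (P' : Measure Ω') [IsProbabilityMeasure P'] (Z : ℕ → Ω' → ℝ × 𝓣 × 𝓧)
    (hZ_law : ∀ i, HasLaw (Z i) M.obsLaw P') (hZ_indep : iIndepFun Z P')
    (θhat : ℕ → Ω' → EuclideanSpace ℝ (Fin d)) (hθ_meas : ∀ n, AEMeasurable (θhat n) P')
    (hθ_max : ∀ n, ∀ᵐ ω ∂P', θhat n ω ∈ M.Θ ∧
      ∀ θ ∈ M.Θ, M.ipwWelfare (fun i => Z i ω) n θ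
        ≤ M.ipwWelfare (fun i => Z i ω) n (θhat n ω)) :
    -- the scores are square integrable, so that the covariance matrices are genuine
    MemLp (M.effScore θs) 2 M.P ∧ MemLp (M.excessScore θs) 2 M.P ∧
    (M.Veff θs).PosSemidef ∧ (M.SigmaU θs).PosSemidef ∧
    ∃ (Ω₀ : Type) (_ : MeasurableSpace Ω₀) (P₀ : Measure Ω₀) (_ : IsProbabilityMeasure P₀)
      (G U : Ω₀ → EuclideanSpace ℝ (Fin d)),
      HasLaw G (multivariateGaussian 0 (M.Veff θs)) P₀ ∧
      HasLaw U (multivariateGaussian 0 (M.SigmaU θs)) P₀ ∧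
      IndepFun G U P₀ ∧
      -- the policy estimator
      TendstoInDistribution (fun (n : ℕ) ω => √(n : ℝ) • (θhat n ω - θs)) atTop
        (fun ω => G ω + U ω) (fun _ => P') P₀ ∧
      -- the regret
      TendstoInDistribution (fun (n : ℕ) ω => (n : ℝ) * M.regret θs (θhat n ω)) atTop
        (fun ω => halfQuad (M.negHessian θs) (G ω + U ω)) (fun _ => P') P₀ ∧
      -- mean and variance of the limiting regret
      MemLp (fun ω => halfQuad (M.negHessian θs) (G ω + U ω)) 2 P₀ ∧
      ∫ ω, halfQuad (M.negHessian θs) (G ω + U ω) ∂P₀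
        = (1 / 2) * (sqrtConj (M.negHessian θs) (M.Veff θs + M.SigmaU θs)).trace ∧
      (∃ h : (sqrtConj (M.negHessian θs) (M.Veff θs + M.SigmaU θs)).IsHermitian,
        Var[fun ω => halfQuad (M.negHessian θs) (G ω + U ω); P₀]
          = (1 / 2) * ∑ j, h.eigenvalues j ^ 2) ∧
      -- strict excess over the efficient limiting regret, outside the degenerate case
      MemLp (fun ω => halfQuad (M.negHessian θs) (G ω)) 2 P₀ ∧
      ((¬ ∃ c : 𝓧 → EuclideanSpace ℝ (Fin d), ∀ᵐ ω ∂M.P, M.weightedScore θs ω = c (M.X ω)) →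
        ∫ ω, halfQuad (M.negHessian θs) (G ω) ∂P₀
          < ∫ ω, halfQuad (M.negHessian θs) (G ω + U ω) ∂P₀ ∧
        Var[fun ω => halfQuad (M.negHessian θs) (G ω); P₀]
          < Var[fun ω => halfQuad (M.negHessian θs) (G ω + U ω); P₀]) := by
  have hH := h_concave.posDef
  obtain ⟨r, C, B, hψ⟩ := M.exists_smoothCriterion h_smooth h_score h_bdd
  have hW : ∀ θ ∈ M.Θ, M.welfare θ
      = ∫ z, M.pol θ z.2.1 z.2.2 * z.1 / M.f z.2.1 z.2.2 ∂M.obsLaw := fun θ hθ =>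
    M.welfare_eq_integral_ipw h𝓣 h_unconf h_paths h_bdd hθ
  have hd : ∀ᶠ θ in 𝓝 θs, DifferentiableAt ℝ M.welfare θ :=
    h_concave.twice_differentiable.mono fun θ hθ => hθ.1
  have hd' := h_concave.twice_differentiable.self_of_nhds.2
  -- the score of the criterion, on the sample space and on the population space
  let s : ℝ × 𝓣 × 𝓧 → EuclideanSpace ℝ (Fin d) := fun z =>
    gradient (fun θ' => M.pol θ' z.2.1 z.2.2 * z.1 / M.f z.2.1 z.2.2) θs
  have hs2 : MemLp s 2 M.obsLaw := hψ.memLp_score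
  have hs0 : ∫ z, s z ∂M.obsLaw = 0 := by
    rw [← h_concave.gradient_eq_zero]
    exact hψ.integral_score_eq hW hd hd'
  have hsobs : (fun ω => s (M.Yobs ω, M.T ω, M.X ω)) = M.ipwScore θs :=
    funext fun ω => (M.ipwScore_eq_gradient θs ω).symm
  have hsq : MemLp (M.ipwScore θs) 2 M.P := by
    rw [← hsobs]
    exact (memLp_map_measure_iff hs2.1 M.measurable_obs.aemeasurable).1 hs2
  have h0 : ∫ ω, M.ipwScore θs ω ∂M.P = 0 := by
    rw [← hsobs, ← hs0]
    exact (integral_map M.measurable_obs.aemeasurable hs2.1).symm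
  have hV := M.posSemidef_Veff hH h_smooth h_bdd hsq h0
  have hS := M.posSemidef_SigmaU hH h_smooth h_bdd hsq
  refine ⟨M.memLp_effScore h_smooth h_bdd hsq, M.memLp_excessScore h_smooth h_bdd hsq, hV, hS, ?_⟩
  set H := M.negHessian θs
  let P₀ : Measure (EuclideanSpace ℝ (Fin d) × EuclideanSpace ℝ (Fin d)) :=
    (multivariateGaussian 0 (M.Veff θs)).prod (multivariateGaussian 0 (M.SigmaU θs))
  have hG : HasLaw Prod.fst (multivariateGaussian 0 (M.Veff θs)) P₀ :=
    ⟨measurable_fst.aemeasurable, Measure.map_fst_prod.trans (by simp)⟩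
  have hU : HasLaw Prod.snd (multivariateGaussian 0 (M.SigmaU θs)) P₀ :=
    ⟨measurable_snd.aemeasurable, Measure.map_snd_prod.trans (by simp)⟩
  have hGU : IndepFun (Prod.fst : EuclideanSpace ℝ (Fin d) × EuclideanSpace ℝ (Fin d) → _)
      Prod.snd P₀ := indepFun_prod measurable_id measurable_id
  have hsum := hasLaw_add_multivariateGaussian hV hS hG hU hGU
  -- the limit `ξ` of the normalised score is chosen such that `H⁻¹ ξ = G + U`
  let A := Matrix.toEuclideanCLM (𝕜 := ℝ) H
  let L := Matrix.toEuclideanCLM (𝕜 := ℝ) H⁻¹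
  have hu : IsUnit H.det := hH.det_pos.ne'.isUnit
  have hAL : ∀ v, A (L v) = v := fun v => by
    rw [← mul_apply_eq_comp, ← map_mul, Matrix.mul_nonsing_inv _ hu, map_one,
      one_apply_eq_self]
  have hLA : ∀ v, L (A v) = v := fun v => by
    rw [← mul_apply_eq_comp, ← map_mul, Matrix.nonsing_inv_mul _ hu, map_one,
      one_apply_eq_self]
  have hA : A = -fderiv ℝ (gradient M.welfare) θs := M.toEuclideanCLM_negHessian
  have hsymm : ∀ u v, ⟪A u, v⟫ = ⟪u, A v⟫ := fun u v => by
    rw [real_inner_comm, Matrix.inner_toEuclideanCLM, Matrix.inner_toEuclideanCLM,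
      Matrix.dotProduct_mulVec, ← Matrix.mulVec_transpose, transpose_eq_of_posDef hH,
      dotProduct_comm]
  obtain ⟨c, hc, hpos⟩ := exists_mul_norm_sq_le_inner hH
  have hξ : HasLaw (fun p => A (p.1 + p.2)) (multivariateGaussian 0
      (H * (M.Veff θs + M.SigmaU θs) * H.transpose)) P₀ := by
    refine ⟨A.continuous.measurable.comp_aemeasurable hsum.aemeasurable, ?_⟩
    rw [← map_toEuclideanCLM_multivariateGaussian H (hV.add hS), ← hsum.map_eq,
      AEMeasurable.map_map_of_aemeasurable A.continuous.aemeasurable hsum.aemeasurable]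
    rfl
  have hΓ : ∀ i j, (H * (M.Veff θs + M.SigmaU θs) * H.transpose) i j
      = ∫ z, s z i * s z j ∂M.obsLaw := by
    intro i j
    have h1 : ∫ z, s z i * s z j ∂M.obsLaw
        = ∫ ω, M.ipwScore θs ω i * M.ipwScore θs ω j ∂M.P := by
      rw [← hsobs]
      exact integral_map M.measurable_obs.aemeasurable
        ((memLp_coord hs2 i).1.mul (memLp_coord hs2 j).1)
    rw [M.negHessian_mul_covariance_mul hH, h1,
      M.integral_ipwScore_mul_ipwScore h_smooth h_bdd hsq h0 i j]
    rfl
  have hclt := tendstoInDistribution_sqrt_smul_sampleMean hs2 hs0 hΓ hZ_law hZ_indep hξ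
  have hθ : ∀ᵐ ω ∂P', ∀ n, θhat n ω ∈ M.Θ ∧ ∀ θ ∈ M.Θ,
      sampleMean (fun i => Z i ω) n (fun z => M.pol θ z.2.1 z.2.2 * z.1 / M.f z.2.1 z.2.2)
        ≤ sampleMean (fun i => Z i ω) n
          (fun z => M.pol (θhat n ω) z.2.1 z.2.2 * z.1 / M.f z.2.1 z.2.2) := by
    simpa only [M.ipwWelfare_eq_sampleMean] using ae_all_iff.2 hθ_max
  have hest := hψ.tendstoInDistribution_argmax h_concave.isCompact hW h_concave.unique_max hd hd'
    h_concave.gradient_eq_zero hA hsymm hAL hc hpos hZ_law hZ_indep hθ_meas hθ hclt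
  simp only [hLA] at hest
  have hreg := hψ.tendstoInDistribution_regret h_concave.isCompact hW h_concave.unique_max hd hd'
    h_concave.gradient_eq_zero hA hZ_law hZ_indep hθ_meas hθ hest
  refine ⟨EuclideanSpace ℝ (Fin d) × EuclideanSpace ℝ (Fin d), inferInstance, P₀, inferInstance,
    Prod.fst, Prod.snd, hG, hU, hGU, hest, ?_, memLp_halfQuad hH (hV.add hS) hsum,
    integral_halfQuad hH (hV.add hS) hsum,
    ⟨(posSemidef_sqrtConj (hV.add hS)).isHermitian, variance_halfQuad hH (hV.add hS) _ hsum⟩,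
    memLp_halfQuad hH hV hG, fun hne => ?_⟩
  · simpa only [halfQuad_eq_inner, PolicyModel.regret] using hreg
  · exact halfQuad_moments_lt hH hV hS (M.SigmaU_ne_zero hH h_smooth h_bdd hsq hne) hG hsum
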